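/- Let $\gamma\in C^3((0,1])$ and $\psi\in C^2((0,1])$ be real-valued functions with $\psi>0$ on $(0,1]$ (derivatives at $1$ are one-sided). Assume that, for some constants $C>0$, $s_0\ge\gamma'(1)$ and a sufficiently small $t_0>0$, the following hold. (a.1) Each of $\gamma,\psi,\gamma',\gamma'',\psi'$ is monotone on $(0,1]$; moreover $\gamma'(t)>0$ on $(0,1]$ and $\gamma'$ is strictly decreasing on $(0,1]$. (a.2) $\left|\dfrac{\psi'(t)}{\psi(t)}\right|\le \dfrac12\left|\dfrac{\gamma'''(t)}{\gamma''(t)}\right|$ for $0<t<t_0$. (a.3) $|\gamma''(\gamma'^{-1}(2s))|\le C\,|\gamma''(\gamma'^{-1}(s))|$ for $s>s_0$, where $\gamma'^{-1}$ is the inverse function of $\gamma'$ on $(0,1]$. (a.4) There exist $\epsilon>0$ and $A_0>1+\epsilon$ such that $\gamma'(t)\ge A_0\,\gamma'((1+\epsilon)t)$ for $0<t<t_0$ (where $(1+\epsilon)t_0\le 1$). (a.5) There exists $1/2<\lambda<1$ such that $|\gamma''(t)|\le C\,\gamma'(t)^{2\lambda}$ for $0<t<t_0$. For $\varepsilon>0$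 and $\beta\in\mathbb R$ let $$K_{\varepsilon,\beta}(x)=\begin{cases}\dfrac{e^{i\gamma(x)}}{x^{1+i\beta}\,\psi(x)^{-i\beta}}, & \varepsilon\le x\le 1,\\[2mm] 0, & \text{otherwise,}\end{cases}$$ and let $T_{\varepsilon,\beta}f=K_{\varepsilon,\beta}*f$. Then there is a constant $A>0$ (depending only on $\gamma$ and $\psi$, hence independent of $\varepsilon$, $\beta$, $f$ and $\alpha$) such that for all $\varepsilon>0$, $\beta\in\mathbb R$ and $f\in L^1(\mathbb R)$ (complex-valued) the convolution integral $T_{\varepsilon,\beta}f(x)$ converges absolutely for every $x\in\mathbb R$, and for all $\alpha>0$ $$\left|\{x\in\mathbb R: |T_{\varepsilon,\beta}f(x)|>\alpha\}\right|\le \frac{A(1+|\beta|)}{\alpha}\,\|f\|_{L^1}.$$ -/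

import Mathlib

open MeasureTheory Set

/-- The derivative of a function on the interval `(0, 1]` (one-sided at the endpoint `1`). -/
noncomputable def derivIoc (f : ℝ → ℝ) : ℝ → ℝ := derivWithin f (Ioc 0 1)

/-- The inverse `γ'⁻¹ : [γ'(1), ∞) → (0, 1]` of the derivative of `γ`. -/
noncomputable def derivInv (γ : ℝ → ℝ) : ℝ → ℝ := Function.invFunOn (derivIoc γ) (Ioc 0 1)

/-- A function is monotone (increasing or decreasing) on `(0, 1]`. -/
def IsMonotoneIoc (f : ℝ → ℝ) : Prop := MonotoneOn f (Ioc 0 1) ∨ AntitoneOn f (Ioc 0 1)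

/-- The regularity and growth assumptions on the phase `γ` and the function `ψ`. -/
structure PhaseAssumptions (γ ψ : ℝ → ℝ) : Prop where
  contDiff_phase : ContDiffOn ℝ 3 γ (Ioc 0 1)
  contDiff_psi : ContDiffOn ℝ 2 ψ (Ioc 0 1)
  psi_pos : ∀ t ∈ Ioc (0 : ℝ) 1, 0 < ψ t
  monotone_phase : IsMonotoneIoc γ
  monotone_psi : IsMonotoneIoc ψ
  monotone_phase_deriv : IsMonotoneIoc (derivIoc γ)
  monotone_phase_deriv_two : IsMonotoneIoc (derivIoc (derivIoc γ))
  monotone_psi_deriv : IsMonotoneIoc (derivIoc ψ)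
  phase_deriv_pos : ∀ t ∈ Ioc (0 : ℝ) 1, 0 < derivIoc γ t
  phase_deriv_strictAnti : StrictAntiOn (derivIoc γ) (Ioc 0 1)
  /-- The conditions `t₀ < 1`, `γ'(1) ≤ s₀` and `(1 + ε) t₀ ≤ 1` only say that `t₀` is so small and
  `s₀` so large that all the expressions below are evaluated inside the domains. -/
  growth : ∃ t₀ s₀ C : ℝ, 0 < t₀ ∧ t₀ < 1 ∧ 0 < s₀ ∧ derivIoc γ 1 ≤ s₀ ∧ 0 < C ∧
    (∀ t ∈ Ioo 0 t₀, |derivIoc ψ t / ψ t| ≤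
      1 / 2 * |derivIoc (derivIoc (derivIoc γ)) t / derivIoc (derivIoc γ) t|) ∧
    (∀ s > s₀, |derivIoc (derivIoc γ) (derivInv γ (2 * s))| ≤
      C * |derivIoc (derivIoc γ) (derivInv γ s)|) ∧
    (∃ ε A : ℝ, 0 < ε ∧ 1 + ε < A ∧ (1 + ε) * t₀ ≤ 1 ∧
      ∀ t ∈ Ioo 0 t₀, A * derivIoc γ ((1 + ε) * t) ≤ derivIoc γ t) ∧
    (∃ lam : ℝ, 1 / 2 < lam ∧ lam < 1 ∧
      ∀ t ∈ Ioo 0 t₀, |derivIoc (derivIoc γ) t| ≤ C * derivIoc γ t ^ (2 * lam))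

open scoped Classical in
/-- The truncated kernel `K_{ε,β}(x) = e^{iγ(x)} / (x^{1+iβ} ψ(x)^{-iβ})` for `ε ≤ x ≤ 1`,
and `0` otherwise. -/
noncomputable def oscKernel (γ ψ : ℝ → ℝ) (ε β : ℝ) (x : ℝ) : ℂ :=
  if x ∈ Icc ε 1 then
    Complex.exp (Complex.I * (γ x : ℂ)) /
      ((x : ℂ) ^ (1 + Complex.I * (β : ℂ)) * (ψ x : ℂ) ^ (-(Complex.I * (β : ℂ))))
  else 0

/-- The convolution operator `T_{ε,β} f = K_{ε,β} * f`. -/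
noncomputable def oscOperator (γ ψ : ℝ → ℝ) (ε β : ℝ) (f : ℝ → ℂ) : ℝ → ℂ :=
  convolution (oscKernel γ ψ ε β) f (ContinuousLinearMap.mul ℝ ℂ) volume

/-! Write `g = γ'`. The argument is Fefferman's method for strongly singular kernels, with the
autocorrelation of the kernel in the role of its Fourier transform. Iterating (a.4) gives `g (θ * t)
≳ θ ^ (-1/κ) * g t` with `κ < 1`, so `g` beats `1 / t` at `0` and the length `1 / g ρ` is at most a
small multiple of `ρ`.

Two estimates on the kernel carry the proof. The first is a Hörmander condition with a finer
translation length than usual: moving `K` by `t ≤ 1 / g ρ` changes it by `O(1 + |β|)` in `L¹` of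
`|z| ≥ 2ρ` (`lintegral_oscKernel_sub_le`). The second is decay of the autocorrelation. Its phase has
derivative `g (y + x) - g y` up to terms in `β`, convexity of `g` keeps that difference away from
`0`, and one integration by parts yields `O((1 + |β|) x ^ (-κ))` globally, together with `O((1 +
|β|) / ρ * (1 + (x * g ρ) ^ (-κ)))` for `x ≤ ρ / 2` (`exists_norm_kernelCorr_oscKernel_le`,
`norm_kernelCorr_oscKernel_le_rpow`). The factors `x ^ (-iβ)` and `ψ ^ (iβ)` belong to the phase but
are treated as perturbations, so `β` enters linearly; (a.2) and (a.3) bound the integrals of `ψ' /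
ψ` that arise.

For the weak type bound (`AdaptedKernel.weak_type`) let `E` be the union of the balls where `|f|`
averages more than `α`. Mass of `f` at `y` is spread uniformly over `[y, y + 1 / g ρ]`, where `ρ` is
half the distance from `y` to the complement of `E`, capped at `a`. Off `E` this costs `O((1 + |β|)
‖f‖₁)` in `L¹` by the Hörmander condition. By `TT*`, the squared `L²` norm of the spread convolution
is at most `‖f‖₁` times the supremum of the spread `|f|` integrated against the absolute
autocorrelation. That supremum is `O((1 + |β|) α)`: balls meeting the complement of `E` have average
at most `α`, and spreading integrates out the singularity since `κ < 1`. Chebyshev in `L¹` and `L²`,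
and `|E| ≤ 5 ‖f‖₁ / α`, finish. -/

/-! ### Growth, convexity and logarithmic variation of `γ'` -/

lemma derivIoc_contDiffOn {f : ℝ → ℝ} {m n : WithTop ℕ∞} (hf : ContDiffOn ℝ n f (Ioc 0 1))
    (h : m + 1 ≤ n) : ContDiffOn ℝ m (derivIoc f) (Ioc 0 1) :=
  hf.derivWithin (uniqueDiffOn_Ioc 0 1) h

lemma hasDerivAt_derivIoc {f : ℝ → ℝ} {n : WithTop ℕ∞} (hf : ContDiffOn ℝ n f (Ioc 0 1))
    (h : 1 ≤ n) {t : ℝ} (ht : t ∈ Ioo (0 : ℝ) 1) : HasDerivAt f (derivIoc f t) t := by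
  have h1 : DifferentiableWithinAt ℝ f (Ioc 0 1) t :=
    hf.differentiableOn (by positivity) t (Ioo_subset_Ioc_self ht)
  exact h1.hasDerivWithinAt.hasDerivAt (Ioc_mem_nhds ht.1 ht.2)

/-- Iterating `A * g ((1 + e) * t) ≤ g t` gives growth of order `log A / log (1 + e)` at `0`. -/
lemma growth_of_iterate {g : ℝ → ℝ} {t₀ e A : ℝ} (he : 0 < e) (hA : 1 < A)
    (ht₀ : (1 + e) * t₀ ≤ 1) (hanti : AntitoneOn g (Ioc 0 1)) (hpos : ∀ t ∈ Ioc (0 : ℝ) 1, 0 < g t)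
    (h : ∀ t ∈ Ioo 0 t₀, A * g ((1 + e) * t) ≤ g t) {t θ : ℝ} (ht : t ∈ Ioc 0 t₀)
    (hθ : θ ∈ Ioc (0 : ℝ) 1) :
    A⁻¹ * θ ^ (-(Real.log A / Real.log (1 + e))) * g t ≤ g (θ * t) := by
  have h1e : 1 < 1 + e := by linarith
  have ht₁ : t₀ ≤ 1 := by nlinarith [ht.1, ht.2]
  have iter : ∀ n : ℕ, A ^ n * g t ≤ g (t / (1 + e) ^ n) := by
    intro n
    induction n with
    | zero => simp
    | succ n ih =>
      have hp : 0 < (1 + e) ^ n := by positivity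
      have hp1 : 1 ≤ (1 + e) ^ n := one_le_pow₀ h1e.le
      have e1 : (1 + e) * (t / (1 + e) ^ (n + 1)) = t / (1 + e) ^ n := by
        field_simp
        ring
      have hmem : t / (1 + e) ^ (n + 1) ∈ Ioo 0 t₀ := by
        refine ⟨div_pos ht.1 (by positivity), ?_⟩
        rw [div_lt_iff₀ (by positivity)]
        have : 1 < (1 + e) ^ (n + 1) := one_lt_pow₀ h1e (by omega)
        nlinarith [ht.1, ht.2]
      have := h _ hmem
      rw [e1] at this
      calc A ^ (n + 1) * g t = A * (A ^ n * g t) := by ring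
        _ ≤ A * g (t / (1 + e) ^ n) := by gcongr
        _ ≤ _ := this
  -- `θ` is rounded up to the power `(1 + e) ^ (-n)`; the incomplete last step accounts for the
  -- factor `A⁻¹`.
  obtain ⟨n, hn1, hn2⟩ : ∃ n : ℕ, θ⁻¹ < (1 + e) ^ (n + 1) ∧ (1 + e) ^ n ≤ θ⁻¹ := by
    obtain ⟨n, hn⟩ := exists_nat_pow_near (one_le_inv_iff₀.2 hθ) h1e
    exact ⟨n, hn.2, hn.1⟩
  have hlog : 0 < Real.log (1 + e) := Real.log_pos h1e
  have key : θ ^ (-(Real.log A / Real.log (1 + e))) ≤ A ^ (n + 1) := by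
    rw [Real.rpow_neg hθ.1.le, ← Real.inv_rpow hθ.1.le]
    calc (θ⁻¹) ^ (Real.log A / Real.log (1 + e))
        ≤ ((1 + e) ^ (n + 1)) ^ (Real.log A / Real.log (1 + e)) :=
          Real.rpow_le_rpow (inv_nonneg.2 hθ.1.le) hn1.le (div_nonneg (Real.log_pos hA).le hlog.le)
      _ = A ^ (n + 1) := by
        rw [← Real.rpow_natCast, ← Real.rpow_mul (by positivity),
          Real.rpow_def_of_pos (by positivity : 0 < 1 + e)]
        rw [← Real.rpow_natCast A, Real.rpow_def_of_pos (by linarith)]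
        congr 1
        field_simp
  have hgt : 0 < g t := hpos t ⟨ht.1, ht.2.trans ht₁⟩
  calc A⁻¹ * θ ^ (-(Real.log A / Real.log (1 + e))) * g t
      ≤ A⁻¹ * A ^ (n + 1) * g t := by gcongr
    _ = A ^ n * g t := by field_simp; ring
    _ ≤ g (t / (1 + e) ^ n) := iter n
    _ ≤ g (θ * t) := by
      have hp : 0 < (1 + e) ^ n := by positivity
      have hp1 : 1 ≤ (1 + e) ^ n := one_le_pow₀ h1e.le
      have : θ * t ≤ t / (1 + e) ^ n := by
        rw [le_div_iff₀ hp]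
        have : (1 + e) ^ n * θ ≤ 1 := by
          calc _ ≤ θ⁻¹ * θ := by gcongr; exact hθ.1.le
            _ = 1 := inv_mul_cancel₀ hθ.1.ne'
        nlinarith [ht.1]
      apply hanti ⟨mul_pos hθ.1 ht.1, by nlinarith [hθ.1, hθ.2, ht.1, ht.2]⟩ _ this
      exact ⟨div_pos ht.1 hp, (div_le_self ht.1.le hp1).trans (ht.2.trans ht₁)⟩

/-- A convex decreasing function whose values drop by a fixed factor from `y` to `(1 + e) * y`
has increments bounded below. -/
lemma sub_shift_ge {g : ℝ → ℝ} {e A y x : ℝ} (he : 0 < e) (hA : 1 < A)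
    (hconv : ConvexOn ℝ (Ioc 0 1) g) (hanti : AntitoneOn g (Ioc 0 1)) (hy : 0 < y)
    (hey : (1 + e) * y ≤ 1) (hg : 0 < g y) (hdrop : A * g ((1 + e) * y) ≤ g y) (hx : 0 < x)
    (hyx : y + x ≤ 1) :
    (1 - A⁻¹) * min 1 e⁻¹ * (g y * min (x / y) 1) ≤ g y - g (y + x) := by
  have hA' : A⁻¹ < 1 := inv_lt_one_of_one_lt₀ hA
  have hd : g ((1 + e) * y) ≤ A⁻¹ * g y := by
    rw [← div_eq_inv_mul, le_div_iff₀ (by linarith)]; linarith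
  have hy1 : y ∈ Ioc (0 : ℝ) 1 := ⟨hy, by linarith⟩
  have hey1 : (1 + e) * y ∈ Ioc (0 : ℝ) 1 := ⟨by positivity, hey⟩
  have hm0 : 0 < min (1 : ℝ) e⁻¹ := lt_min one_pos (inv_pos.2 he)
  have hn0 : 0 < min (x / y) 1 := lt_min (by positivity) one_pos
  -- For `x ≥ e * y` monotonicity already gives the full drop. For smaller `x` the graph lies below
  -- the chord from `y` to `(1 + e) * y`, which gives the fraction `x / (e * y)` of the drop.
  rcases le_or_gt (e * y) x with h | h
  · have h1 : g (y + x) ≤ g ((1 + e) * y) :=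
      hanti hey1 ⟨by positivity, hyx⟩ (by linarith)
    have : min (1 : ℝ) e⁻¹ * min (x / y) 1 ≤ 1 :=
      mul_le_one₀ (min_le_left _ _) hn0.le (min_le_right _ _)
    have h2 : (1 - A⁻¹) * g y * (min (1 : ℝ) e⁻¹ * min (x / y) 1) ≤ (1 - A⁻¹) * g y * 1 := by
      gcongr
    nlinarith
  · have hl0 : 0 < x / (e * y) := by positivity
    have hl1 : x / (e * y) < 1 := by rw [div_lt_one (by positivity)]; exact h
    have h1 := hconv.2 hy1 hey1 (sub_nonneg.2 hl1.le) hl0.le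
      (sub_add_cancel _ _)
    have e1 : (1 - x / (e * y)) • y + (x / (e * y)) • ((1 + e) * y) = y + x := by
      simp only [smul_eq_mul]; field_simp
      try ring
    rw [e1] at h1
    simp only [smul_eq_mul] at h1
    have h3 : x / (e * y) * g ((1 + e) * y) ≤ x / (e * y) * (A⁻¹ * g y) := by gcongr
    have h4 : min (1 : ℝ) e⁻¹ * min (x / y) 1 ≤ x / (e * y) := by
      calc _ ≤ e⁻¹ * (x / y) := by
            gcongr
            · exact min_le_right _ _
            · exact min_le_left _ _
        _ = _ := by field_simp
    have h2 : (1 - A⁻¹) * g y * (min (1 : ℝ) e⁻¹ * min (x / y) 1) ≤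
        (1 - A⁻¹) * g y * (x / (e * y)) := by
      gcongr
    nlinarith

/-- If `|g₁|` changes by a bounded factor whenever `g` doubles, then it changes by at most a power
of the change of `g`. -/
lemma log_abs_sub_log_abs_le {g g₁ : ℝ → ℝ} {s₀ C σ : ℝ} (hs₀ : 0 < s₀) (hC : 1 ≤ C)
    (hanti : StrictAntiOn g (Ioc 0 1)) (hcont : ContinuousOn g (Ioc 0 1))
    (hunb : ∀ s, ∃ t ∈ Ioc (0 : ℝ) 1, s ≤ g t) (hmono : MonotoneOn g₁ (Ioc 0 1))
    (hneg : ∀ t ∈ Ioo (0 : ℝ) 1, g₁ t < 0)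
    (hdouble : ∀ s > s₀, |g₁ (Function.invFunOn g (Ioc 0 1) (2 * s))| ≤
      C * |g₁ (Function.invFunOn g (Ioc 0 1) s)|)
    (hσ : 0 < σ) {y₁ y₂ : ℝ} (hy₁ : 0 < y₁) (hy : y₁ ≤ y₂) (hy₂ : y₂ < 1) (hs : s₀ < g y₂) :
    Real.log |g₁ y₁| - Real.log |g₁ y₂| ≤
      Real.log C * (2 ^ σ / (σ * Real.log 2)) * (g y₁ / g y₂) ^ σ := by
  set u := Function.invFunOn g (Ioc 0 1) with hu
  have hleft : ∀ y ∈ Ioc (0 : ℝ) 1, u (g y) = y := fun y hy => hanti.injOn.leftInvOn_invFunOn hy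
  have hsurj : ∀ s, g 1 ≤ s → ∃ t ∈ Ioc (0 : ℝ) 1, g t = s := by
    intro s h1
    obtain ⟨t, ht, hst⟩ := hunb s
    have := intermediate_value_Icc' ht.2 (hcont.mono fun z hz => ⟨ht.1.trans_le hz.1, hz.2⟩)
    obtain ⟨z, hz, hz'⟩ := this ⟨h1, hst⟩
    exact ⟨z, ⟨ht.1.trans_le hz.1, hz.2⟩, hz'⟩
  have iter : ∀ n : ℕ, ∀ s > s₀, |g₁ (u (2 ^ n * s))| ≤ C ^ n * |g₁ (u s)| := by
    intro n s hs
    induction n with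
    | zero => simp
    | succ n ih =>
      have h1 : s₀ < 2 ^ n * s := by
        have : (1 : ℝ) ≤ 2 ^ n := one_le_pow₀ (by norm_num)
        nlinarith
      have h2 := hdouble _ h1
      rw [show 2 * (2 ^ n * s) = 2 ^ (n + 1) * s by ring] at h2
      calc _ ≤ C * |g₁ (u (2 ^ n * s))| := h2
        _ ≤ C * (C ^ n * |g₁ (u s)|) := by gcongr
        _ = _ := by ring
  have m1 : y₁ ∈ Ioc (0 : ℝ) 1 := ⟨hy₁, by linarith⟩
  have m2 : y₂ ∈ Ioc (0 : ℝ) 1 := ⟨by linarith, by linarith⟩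
  have hg2 : 0 < g y₂ := hs₀.trans hs
  have hg12 : g y₂ ≤ g y₁ := hanti.antitoneOn m1 m2 hy
  have hR : 1 ≤ g y₁ / g y₂ := by rwa [one_le_div hg2]
  -- `n + 1` doublings lead from `g y₂` to a value at least `g y₁`. The overshoot is harmless
  -- because `|g₁|` decreases.
  obtain ⟨n, hn⟩ := exists_nat_pow_near hR (one_lt_two)
  have h1 : |g₁ y₁| ≤ C ^ (n + 1) * |g₁ y₂| := by
    have hbig : g y₁ ≤ 2 ^ (n + 1) * g y₂ := by
      have := hn.2.le
      rwa [div_le_iff₀ hg2] at this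
    obtain ⟨t, ht, hgt⟩ := hsurj (2 ^ (n + 1) * g y₂) (by
      have := hanti.antitoneOn m2 (right_mem_Ioc.2 one_pos) hy₂.le
      linarith)
    have hty : t ≤ y₁ := by
      by_contra! hlt
      have := hanti m1 ht hlt
      linarith
    have h3 := iter (n + 1) _ hs
    rw [← hgt, hleft t ht, hleft y₂ m2] at h3
    have ht1 : t ∈ Ioo (0 : ℝ) 1 := ⟨ht.1, by linarith⟩
    have h4 : |g₁ y₁| ≤ |g₁ t| := by
      rw [abs_of_neg (hneg _ ht1), abs_of_neg (hneg y₁ ⟨hy₁, by linarith⟩)]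
      have := hmono ht m1 hty
      linarith
    linarith
  have p1 : 0 < |g₁ y₁| := abs_pos.2 (hneg y₁ ⟨hy₁, by linarith⟩).ne
  have p2 : 0 < |g₁ y₂| := abs_pos.2 (hneg y₂ ⟨by linarith, by linarith⟩).ne
  have hlogC : 0 ≤ Real.log C := Real.log_nonneg hC
  have h2 : Real.log |g₁ y₁| - Real.log |g₁ y₂| ≤ (n + 1 : ℕ) * Real.log C := by
    have := Real.log_le_log p1 h1
    rw [Real.log_mul (by positivity) p2.ne', Real.log_pow] at this
    linarith
  have hl2 : 0 < Real.log 2 := Real.log_pos one_lt_two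
  -- The number of doublings is logarithmic in `g y₁ / g y₂`, hence below any positive power of it;
  -- `1 + x ≤ exp x` makes the constant explicit.
  have h3 : ((n + 1 : ℕ) : ℝ) ≤ 2 ^ σ / (σ * Real.log 2) * (g y₁ / g y₂) ^ σ := by
    rw [div_mul_eq_mul_div, le_div_iff₀ (by positivity)]
    have e1 : ((n + 1 : ℕ) : ℝ) * (σ * Real.log 2) + 1 ≤ Real.exp (((n + 1 : ℕ) : ℝ) * (σ * Real.log 2)) :=
      Real.add_one_le_exp _
    have e2 : Real.exp (((n + 1 : ℕ) : ℝ) * (σ * Real.log 2)) = 2 ^ σ * ((2 : ℝ) ^ n) ^ σ := by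
      rw [← Real.mul_rpow (by norm_num) (by positivity), ← pow_succ', ← Real.rpow_natCast,
        ← Real.rpow_mul (by norm_num), Real.rpow_def_of_pos (by norm_num : (0 : ℝ) < 2)]
      congr 1; ring
    have e3 : ((2 : ℝ) ^ n) ^ σ ≤ (g y₁ / g y₂) ^ σ :=
      Real.rpow_le_rpow (by positivity) hn.1 hσ.le
    calc _ ≤ 2 ^ σ * ((2 : ℝ) ^ n) ^ σ := by linarith
      _ ≤ _ := by gcongr
  calc _ ≤ _ := h2
    _ ≤ (2 ^ σ / (σ * Real.log 2) * (g y₁ / g y₂) ^ σ) * Real.log C := by gcongr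
    _ = _ := by ring

/-! ### Weighted integrals of the logarithmic derivatives -/

/-- An integral is at most the increment of a function whose derivative dominates the integrand. -/
lemma integral_le_sub_of_hasDerivAt {f F F' : ℝ → ℝ} {a b : ℝ} (hab : a ≤ b)
    (hf : ContinuousOn f (Icc a b)) (hF : ContinuousOn F (Icc a b))
    (hF' : ∀ x ∈ Ioo a b, HasDerivAt F (F' x) x) (hle : ∀ x ∈ Ioo a b, f x ≤ F' x) :
    ∫ x in a..b, f x ≤ F b - F a :=
  intervalIntegral.integral_le_sub_of_hasDeriv_right_of_le hab hF
    (fun x hx => (hF' x hx).hasDerivWithinAt) hf.integrableOn_Icc hle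

/-- Integration by parts moves the derivative from `log |g₁|` to the weight. The variation of the
logarithm is at most `B` times a power `η / 2` of `g z / g ρ`, so half of the decay `-η` survives,
which bounds the result independently of `e`. -/
lemma integral_neg_logDeriv_mul_rpow_neg_le {g g₁ g₂ : ℝ → ℝ} {e ρ η B : ℝ} (he : 0 < e)
    (hρ : e ≤ ρ) (hρ1 : ρ < 1) (hη : 0 < η)
    (hg : ∀ t ∈ Ioo (0 : ℝ) 1, HasDerivAt g (g₁ t) t)
    (hg₁ : ∀ t ∈ Ioo (0 : ℝ) 1, HasDerivAt g₁ (g₂ t) t) (hg₂ : ContinuousOn g₂ (Ioo 0 1))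
    (hpos : ∀ t ∈ Ioo (0 : ℝ) 1, 0 < g t) (hneg : ∀ t ∈ Ioo (0 : ℝ) 1, g₁ t < 0)
    (hN : ∀ y ∈ Icc e ρ, Real.log |g₁ y| - Real.log |g₁ ρ| ≤ B * (g y / g ρ) ^ (η / 2)) :
    ∫ z in e..ρ, -(g₂ z / g₁ z) * (g z / g ρ) ^ (-η) ≤ 3 * B := by
  have hsub : Icc e ρ ⊆ Ioo 0 1 := fun z hz => ⟨he.trans_le hz.1, hz.2.trans_lt hρ1⟩
  have hgc : ContinuousOn g (Icc e ρ) := fun z hz => (hg z (hsub hz)).continuousAt.continuousWithinAt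
  have hg1c : ContinuousOn g₁ (Icc e ρ) :=
    fun z hz => (hg₁ z (hsub hz)).continuousAt.continuousWithinAt
  have hgρ : 0 < g ρ := hpos ρ (hsub (right_mem_Icc.2 hρ))
  have hR : ∀ z ∈ Icc e ρ, 0 < g z / g ρ := fun z hz => div_pos (hpos z (hsub hz)) hgρ
  have hRc : ContinuousOn (fun z => g z / g ρ) (Icc e ρ) := hgc.div_const _
  have hpow : ∀ q : ℝ, ContinuousOn (fun z => (g z / g ρ) ^ q) (Icc e ρ) := fun q =>
    hRc.rpow_const fun z hz => Or.inl (hR z hz).ne'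
  have hNc : ContinuousOn (fun z => Real.log (g₁ z)) (Icc e ρ) :=
    hg1c.log fun z hz => (hneg z (hsub hz)).ne
  simp only [Real.log_abs] at hN
  -- The first term of `F` is the integration by parts. The second, with its factor `2 * B`, has
  -- exactly the derivative needed to absorb the derivative of the weight.
  have key := integral_le_sub_of_hasDerivAt (f := fun z => -(g₂ z / g₁ z) * (g z / g ρ) ^ (-η))
    (F := fun z => -(Real.log (g₁ z) - Real.log (g₁ ρ)) * (g z / g ρ) ^ (-η) +
      2 * B * (g z / g ρ) ^ (-η / 2))
    (F' := fun z => -(g₂ z / g₁ z) * (g z / g ρ) ^ (-η) +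
      -(Real.log (g₁ z) - Real.log (g₁ ρ)) * (g₁ z / g ρ * (-η) * (g z / g ρ) ^ (-η - 1)) +
      2 * B * (g₁ z / g ρ * (-η / 2) * (g z / g ρ) ^ (-η / 2 - 1))) hρ
    (((hg₂.mono hsub).div hg1c fun z hz => (hneg z (hsub hz)).ne).neg.mul (hpow _))
    (((hNc.sub continuousOn_const).neg.mul (hpow _)).add (continuousOn_const.mul (hpow _)))
    (fun z hz => by
      have hz' := Ioo_subset_Icc_self hz
      have d1 := (hg z (hsub hz')).div_const (g ρ)
      have d2 := (hg₁ z (hsub hz')).log (hneg z (hsub hz')).ne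
      exact ((d2.sub_const _).neg.mul (d1.rpow_const (Or.inl (hR z hz').ne'))).add
        ((d1.rpow_const (Or.inl (hR z hz').ne')).const_mul (2 * B)))
    (fun z hz => by
      have hz' := Ioo_subset_Icc_self hz
      have hRz := hR z hz'
      have h1 := hN z hz'
      set R := g z / g ρ
      have e1 : R ^ (-η / 2 - 1) = R ^ (-η - 1) * R ^ (η / 2) := by
        rw [← Real.rpow_add hRz]; congr 1; ring
      have h2 : 0 ≤ -(g₁ z / g ρ) := by
        rw [← neg_div]; exact div_nonneg (by linarith [hneg z (hsub hz')]) hgρ.le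
      have h3 : 0 ≤ -(g₁ z / g ρ) * η * R ^ (-η - 1) *
          (B * R ^ (η / 2) - (Real.log (g₁ z) - Real.log (g₁ ρ))) := by
        have := Real.rpow_nonneg hRz.le (-η - 1)
        have : 0 ≤ B * R ^ (η / 2) - (Real.log (g₁ z) - Real.log (g₁ ρ)) := by linarith
        positivity
      show -(g₂ z / g₁ z) * R ^ (-η) ≤ -(g₂ z / g₁ z) * R ^ (-η) +
        -(Real.log (g₁ z) - Real.log (g₁ ρ)) * (g₁ z / g ρ * (-η) * R ^ (-η - 1)) +
        2 * B * (g₁ z / g ρ * (-η / 2) * R ^ (-η / 2 - 1))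
      rw [e1]
      linarith)
  have hRe := hR e (left_mem_Icc.2 hρ)
  have hB : 0 ≤ B := by
    have := hN ρ (right_mem_Icc.2 hρ)
    rw [div_self hgρ.ne', Real.one_rpow] at this
    linarith
  have h4 : (Real.log (g₁ e) - Real.log (g₁ ρ)) * (g e / g ρ) ^ (-η) ≤ B * (g e / g ρ) ^ (-η / 2) := by
    calc _ ≤ B * (g e / g ρ) ^ (η / 2) * (g e / g ρ) ^ (-η) := by
          gcongr
          exact hN e (left_mem_Icc.2 hρ)
      _ = _ := by rw [mul_assoc, ← Real.rpow_add hRe]; congr 2; ring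
  have h5 : 0 ≤ B * (g e / g ρ) ^ (-η / 2) := by positivity
  refine key.trans ?_
  simp only [div_self hgρ.ne', Real.one_rpow, sub_self, neg_zero, zero_mul, zero_add]
  linarith

/-- Since `g ^ κ` decreases, the term where the derivative falls on the weight has a favourable
sign, and only the boundary value at `ρ` remains. -/
lemma integral_neg_logDeriv_mul_rpow_le {g g₁ g₂ : ℝ → ℝ} {ρ a κ : ℝ} (hρ : 0 < ρ)
    (hρa : ρ ≤ a) (ha : a < 1) (hκ : 0 < κ)
    (hg : ∀ t ∈ Ioo (0 : ℝ) 1, HasDerivAt g (g₁ t) t)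
    (hg₁ : ∀ t ∈ Ioo (0 : ℝ) 1, HasDerivAt g₁ (g₂ t) t) (hg₂ : ContinuousOn g₂ (Ioo 0 1))
    (hpos : ∀ t ∈ Ioo (0 : ℝ) 1, 0 < g t) (hneg : ∀ t ∈ Ioo (0 : ℝ) 1, g₁ t < 0)
    (hmono : MonotoneOn g₁ (Ioo 0 1)) :
    ∫ z in ρ..a, -(g₂ z / g₁ z) * g z ^ κ ≤
      (Real.log |g₁ ρ| - Real.log |g₁ a|) * g ρ ^ κ := by
  have hsub : Icc ρ a ⊆ Ioo 0 1 := fun z hz => ⟨hρ.trans_le hz.1, hz.2.trans_lt ha⟩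
  have hgc : ContinuousOn g (Icc ρ a) := fun z hz => (hg z (hsub hz)).continuousAt.continuousWithinAt
  have hg1c : ContinuousOn g₁ (Icc ρ a) :=
    fun z hz => (hg₁ z (hsub hz)).continuousAt.continuousWithinAt
  have hpow : ∀ q : ℝ, ContinuousOn (fun z => g z ^ q) (Icc ρ a) := fun q =>
    hgc.rpow_const fun z hz => Or.inl (hpos z (hsub hz)).ne'
  have hNc : ContinuousOn (fun z => Real.log (g₁ z)) (Icc ρ a) :=
    hg1c.log fun z hz => (hneg z (hsub hz)).ne
  have key := integral_le_sub_of_hasDerivAt (f := fun z => -(g₂ z / g₁ z) * g z ^ κ)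
    (F := fun z => -(Real.log (g₁ z) - Real.log (g₁ a)) * g z ^ κ)
    (F' := fun z => -(g₂ z / g₁ z) * g z ^ κ +
      -(Real.log (g₁ z) - Real.log (g₁ a)) * (g₁ z * κ * g z ^ (κ - 1))) hρa
    (((hg₂.mono hsub).div hg1c fun z hz => (hneg z (hsub hz)).ne).neg.mul (hpow _))
    ((hNc.sub continuousOn_const).neg.mul (hpow _))
    (fun z hz => by
      have hz' := Ioo_subset_Icc_self hz
      have d1 := hg z (hsub hz')
      have d2 := (hg₁ z (hsub hz')).log (hneg z (hsub hz')).ne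
      exact (d2.sub_const _).neg.mul (d1.rpow_const (Or.inl (hpos z (hsub hz')).ne')))
    (fun z hz => by
      have hz' := Ioo_subset_Icc_self hz
      have hgz := hpos z (hsub hz')
      have h1 : Real.log (g₁ a) ≤ Real.log (g₁ z) := by
        rw [← Real.log_abs (g₁ a), ← Real.log_abs (g₁ z)]
        have ma := hsub (right_mem_Icc.2 hρa)
        apply Real.log_le_log (abs_pos.2 (hneg a ma).ne)
        rw [abs_of_neg (hneg a ma), abs_of_neg (hneg z (hsub hz'))]
        linarith [hmono (hsub hz') ma hz'.2]
      have h2 : 0 ≤ (Real.log (g₁ z) - Real.log (g₁ a)) * ((-g₁ z) * κ * g z ^ (κ - 1)) := by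
        have : 0 < -g₁ z := by linarith [hneg z (hsub hz')]
        have := sub_nonneg.2 h1
        positivity
      linarith)
  refine key.trans (le_of_eq ?_)
  simp only [Real.log_abs, sub_self, neg_zero, zero_mul, zero_sub]
  ring

/-- This is the growth estimate with `θ = z / ρ`, raised to the power `κ`. It trades `1 / z` for a
power of `g`, the quantity in which the variation of `log |g₁|` is controlled. -/
lemma div_rpow_le_of_growth {g : ℝ → ℝ} {a κ C z ρ : ℝ} (hκ : 0 < κ) (hκ1 : κ < 1) (hC : 1 ≤ C)
    (hpos : ∀ t ∈ Ioc (0 : ℝ) 1, 0 < g t) (ha : a < 1)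
    (hgr : ∀ t ∈ Ioc 0 a, ∀ θ ∈ Ioc (0 : ℝ) 1, θ ^ (-(1 / κ)) * g t ≤ C * g (θ * t))
    (hz : 0 < z) (hzρ : z ≤ ρ) (hρ : ρ ≤ a) : 1 / z ≤ C / ρ * (g z / g ρ) ^ κ := by
  have hρ0 : 0 < ρ := hz.trans_le hzρ
  have h1 := hgr ρ ⟨hρ0, hρ⟩ (z / ρ) ⟨by positivity, (div_le_one hρ0).2 hzρ⟩
  rw [div_mul_cancel₀ _ hρ0.ne'] at h1
  have hgρ := hpos ρ ⟨hρ0, by linarith⟩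
  have hgz := hpos z ⟨hz, by linarith⟩
  have h2 : (z / ρ) ^ (-(1 / κ)) ≤ C * (g z / g ρ) := by
    rw [← mul_div_assoc, le_div_iff₀ hgρ]; exact h1
  have h3 := Real.rpow_le_rpow (by positivity) h2 hκ.le
  rw [← Real.rpow_mul (by positivity), Real.mul_rpow (by positivity) (by positivity)] at h3
  rw [show -(1 / κ) * κ = -1 by field_simp, Real.rpow_neg_one, inv_div] at h3
  have h4 : C ^ κ ≤ C := by
    simpa using Real.rpow_le_rpow_of_exponent_le hC hκ1.le
  have h5 : ρ / z ≤ C * (g z / g ρ) ^ κ := h3.trans (by gcongr)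
  rw [div_mul_eq_mul_div, le_div_iff₀ hρ0]
  calc 1 / z * ρ = ρ / z := by ring
    _ ≤ _ := h5

/-- Growth bounds `1 / g z` by a multiple of `z ^ (1 / κ)`, which makes the `1 / z` part integrable
at `0` as `1 / κ > 1`. In the other part `|l|` is at most half the logarithmic derivative of `g₁`,
and `1 / (z * g z) ≲ (g z / g ρ) ^ (κ - 1) / (ρ * g ρ)` supplies the weight with `η = 1 - κ`. -/
lemma integral_small_scale_le {g g₁ g₂ l : ℝ → ℝ} {a κ C B e ρ : ℝ} (hκ : 0 < κ) (hκ1 : κ < 1)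
    (hC : 1 ≤ C) (ha : a < 1)
    (hg : ∀ t ∈ Ioo (0 : ℝ) 1, HasDerivAt g (g₁ t) t)
    (hg₁ : ∀ t ∈ Ioo (0 : ℝ) 1, HasDerivAt g₁ (g₂ t) t) (hg₂ : ContinuousOn g₂ (Ioo 0 1))
    (hl : ContinuousOn l (Ioc 0 1))
    (hpos : ∀ t ∈ Ioc (0 : ℝ) 1, 0 < g t) (hneg : ∀ t ∈ Ioo (0 : ℝ) 1, g₁ t < 0)
    (hgr : ∀ t ∈ Ioc 0 a, ∀ θ ∈ Ioc (0 : ℝ) 1, θ ^ (-(1 / κ)) * g t ≤ C * g (θ * t))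
    (hla : ∀ t ∈ Ioc 0 a, |l t| ≤ 1 / 2 * -(g₂ t / g₁ t))
    (he : 0 < e) (hρ : e ≤ ρ) (hρa : ρ ≤ a)
    (hN : ∀ y ∈ Icc e ρ, Real.log |g₁ y| - Real.log |g₁ ρ| ≤ B * (g y / g ρ) ^ ((1 - κ) / 2)) :
    ∫ z in e..ρ, (1 / z + |l z|) / (z * g z) ≤
      (C * (1 / (1 / κ - 1)) + C / 2 * (3 * B)) / (ρ * g ρ) := by
  have hρ0 : 0 < ρ := he.trans_le hρ
  have hsub : Icc e ρ ⊆ Ioo 0 1 := fun z hz => ⟨he.trans_le hz.1, by linarith [hz.2]⟩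
  have hgc : ContinuousOn g (Icc e ρ) := fun z hz => (hg z (hsub hz)).continuousAt.continuousWithinAt
  have hg1c : ContinuousOn g₁ (Icc e ρ) :=
    fun z hz => (hg₁ z (hsub hz)).continuousAt.continuousWithinAt
  have hgρ : 0 < g ρ := hpos ρ ⟨hρ0, by linarith⟩
  have hq : 0 < 1 / κ - 1 := by
    rw [sub_pos, lt_div_iff₀ hκ]; linarith
  have hzg : ∀ z ∈ Icc e ρ, z * g z ≠ 0 := fun z hz =>
    (mul_pos (hsub hz).1 (hpos z (Ioo_subset_Ioc_self (hsub hz)))).ne'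
  have hlc : ContinuousOn (fun z => |l z|) (Icc e ρ) :=
    (hl.mono (hsub.trans Ioo_subset_Ioc_self)).abs
  have hic : ContinuousOn (fun z : ℝ => 1 / z) (Icc e ρ) :=
    continuousOn_const.div continuousOn_id fun z hz => (hsub hz).1.ne'
  have c1 : ContinuousOn (fun z => (1 / z) / (z * g z)) (Icc e ρ) :=
    hic.div (continuousOn_id.mul hgc) hzg
  have c2 : ContinuousOn (fun z => |l z| / (z * g z)) (Icc e ρ) :=
    hlc.div (continuousOn_id.mul hgc) hzg
  have i1 : ∫ z in e..ρ, (1 / z) / (z * g z) ≤ C * (1 / (1 / κ - 1)) / (ρ * g ρ) := by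
    have := integral_le_sub_of_hasDerivAt (f := fun z => (1 / z) / (z * g z))
      (F := fun z => C / (ρ * g ρ) * ((1 / (1 / κ - 1)) * (z / ρ) ^ (1 / κ - 1)))
      (F' := fun z => C / (ρ * g ρ) * ((1 / (1 / κ - 1)) *
        (1 / ρ * (1 / κ - 1) * (z / ρ) ^ (1 / κ - 1 - 1)))) hρ c1
      (continuousOn_const.mul (continuousOn_const.mul
        ((continuousOn_id.div_const _).rpow_const fun z hz => Or.inr hq.le)))
      (fun z hz => by
        have hz0 := (hsub (Ioo_subset_Icc_self hz)).1
        exact ((((hasDerivAt_id z).div_const ρ).rpow_const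
          (Or.inl (by simp only [id]; positivity))).const_mul _).const_mul _)
      (fun z hz => by
        have hz0 := (hsub (Ioo_subset_Icc_self hz)).1
        have hgz := hpos z (Ioo_subset_Ioc_self (hsub (Ioo_subset_Icc_self hz)))
        have h1 := hgr ρ ⟨hρ0, hρa⟩ (z / ρ) ⟨by positivity, (div_le_one hρ0).2 hz.2.le⟩
        rw [div_mul_cancel₀ _ hρ0.ne'] at h1
        have hw : 0 < z / ρ := by positivity
        have e2 : (z / ρ) ^ (1 / κ - 1 - 1) = (z / ρ) ^ (1 / κ) * (ρ ^ 2 / z ^ 2) := by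
          rw [show 1 / κ - 1 - 1 = 1 / κ + (-2 : ℝ) by ring, Real.rpow_add hw, Real.rpow_neg hw.le]
          congr 1
          rw [show (2 : ℝ) = (2 : ℕ) by norm_num, Real.rpow_natCast]
          field_simp
        rw [Real.rpow_neg hw.le] at h1
        have hP : 0 < (z / ρ) ^ (1 / κ) := Real.rpow_pos_of_pos hw _
        set Q := (z / ρ) ^ (1 / κ)
        have h2 : g ρ ≤ C * g z * Q := by
          rw [inv_mul_eq_div, div_le_iff₀ hP] at h1; exact h1
        rw [e2]
        have e3 : C / (ρ * g ρ) * (1 / (1 / κ - 1) * (1 / ρ * (1 / κ - 1) * (Q * (ρ ^ 2 / z ^ 2))))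
            = C * Q / (g ρ * z ^ 2) := by
          have hq' := hq.ne'
          generalize 1 / κ - 1 = q at hq' ⊢
          field_simp
        rw [e3, div_div, div_le_div_iff₀ (by positivity) (by positivity)]
        calc 1 * (g ρ * z ^ 2) ≤ (C * g z * Q) * z ^ 2 := by rw [one_mul]; gcongr
          _ = _ := by ring)
    refine this.trans ?_
    have h3 : 0 ≤ C / (ρ * g ρ) * (1 / (1 / κ - 1) * (e / ρ) ^ (1 / κ - 1)) := by positivity
    simp only [div_self hρ0.ne', Real.one_rpow]
    have : C / (ρ * g ρ) * (1 / (1 / κ - 1) * 1) = C * (1 / (1 / κ - 1)) / (ρ * g ρ) := by ring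
    linarith
  have i2 : ∫ z in e..ρ, |l z| / (z * g z) ≤ C / 2 * (3 * B) / (ρ * g ρ) := by
    have h1 := integral_neg_logDeriv_mul_rpow_neg_le he hρ (by linarith) (sub_pos.2 hκ1) hg hg₁ hg₂
      (fun t ht => hpos t (Ioo_subset_Ioc_self ht)) hneg hN
    have c3 : ContinuousOn (fun z => -(g₂ z / g₁ z) * (g z / g ρ) ^ (-(1 - κ))) (Icc e ρ) :=
      (((hg₂.mono hsub).div hg1c fun z hz => (hneg z (hsub hz)).ne).neg.mul
        ((hgc.div_const _).rpow_const fun z hz => Or.inl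
          (div_pos (hpos z (Ioo_subset_Ioc_self (hsub hz))) hgρ).ne'))
    calc ∫ z in e..ρ, |l z| / (z * g z)
        ≤ ∫ z in e..ρ, (C / 2 / (ρ * g ρ)) * (-(g₂ z / g₁ z) * (g z / g ρ) ^ (-(1 - κ))) := by
          apply intervalIntegral.integral_mono_on hρ (c2.intervalIntegrable_of_Icc hρ)
            ((continuousOn_const.mul c3).intervalIntegrable_of_Icc hρ)
          intro z hz
          have hz0 := (hsub hz).1
          have hgz := hpos z (Ioo_subset_Ioc_self (hsub hz))
          have hd := div_rpow_le_of_growth hκ hκ1 hC hpos ha hgr hz0 hz.2 hρa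
          have hlz := hla z ⟨hz0, hz.2.trans hρa⟩
          have hw : 0 < g z / g ρ := by positivity
          have e2 : (g z / g ρ) ^ (-(1 - κ)) = (g z / g ρ) ^ κ * (g ρ / g z) := by
            rw [show -(1 - κ) = κ + (-1) by ring, Real.rpow_add hw, Real.rpow_neg_one, inv_div]
          show |l z| / (z * g z) ≤
            (C / 2 / (ρ * g ρ)) * (-(g₂ z / g₁ z) * (g z / g ρ) ^ (-(1 - κ)))
          rw [e2]
          have hnn := (abs_nonneg _).trans hlz
          calc |l z| / (z * g z) = |l z| * (1 / z) * (1 / g z) := by field_simp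
            _ ≤ (1 / 2 * -(g₂ z / g₁ z)) * (C / ρ * (g z / g ρ) ^ κ) * (1 / g z) := by
              gcongr
            _ = _ := by field_simp
      _ = (C / 2 / (ρ * g ρ)) * ∫ z in e..ρ, (-(g₂ z / g₁ z) * (g z / g ρ) ^ (-(1 - κ))) :=
          intervalIntegral.integral_const_mul _ _
      _ ≤ (C / 2 / (ρ * g ρ)) * (3 * B) := by gcongr
      _ = _ := by ring
  calc _ = ∫ z in e..ρ, ((1 / z) / (z * g z) + |l z| / (z * g z)) := by simp only [add_div]
    _ = (∫ z in e..ρ, (1 / z) / (z * g z)) + ∫ z in e..ρ, |l z| / (z * g z) :=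
      intervalIntegral.integral_add (c1.intervalIntegrable_of_Icc hρ)
        (c2.intervalIntegrable_of_Icc hρ)
    _ ≤ _ := by rw [add_div]; gcongr

/-- By growth `g z` decays like `(z / ρ) ^ (-1 / κ)` up to `a`, and `∫ z⁻²` is at most `1 / ρ ≤ g
ρ`. For `|l| / z` the factor `1 / z` becomes `g z ^ κ`, while the variation of `log |g₁|` costs `g ρ
^ (1 - κ)`: the exponents add up to one. Beyond `a` only the bound `M` and a positive multiple of `g
a ≤ g ρ` are used. -/
lemma integral_large_scale_le {g g₁ g₂ l : ℝ → ℝ} {a κ C B M ρ : ℝ} (hκ : 0 < κ) (hκ1 : κ < 1)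
    (hC : 1 ≤ C) (ha : a < 1) (hM : ∀ t ∈ Icc a 1, |l t| ≤ M)
    (hg : ∀ t ∈ Ioo (0 : ℝ) 1, HasDerivAt g (g₁ t) t) (hgc : ContinuousOn g (Ioc 0 1))
    (hg₁ : ∀ t ∈ Ioo (0 : ℝ) 1, HasDerivAt g₁ (g₂ t) t) (hg₂ : ContinuousOn g₂ (Ioo 0 1))
    (hl : ContinuousOn l (Ioc 0 1)) (hanti : AntitoneOn g (Ioc 0 1))
    (hpos : ∀ t ∈ Ioc (0 : ℝ) 1, 0 < g t) (hneg : ∀ t ∈ Ioo (0 : ℝ) 1, g₁ t < 0)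
    (hmono : MonotoneOn g₁ (Ioo 0 1))
    (hgr : ∀ t ∈ Ioc 0 a, ∀ θ ∈ Ioc (0 : ℝ) 1, θ ^ (-(1 / κ)) * g t ≤ C * g (θ * t))
    (hla : ∀ t ∈ Ioc 0 a, |l t| ≤ 1 / 2 * -(g₂ t / g₁ t))
    (hρ : 0 < ρ) (hρa : ρ ≤ a) (hρg : 1 ≤ ρ * g ρ)
    (hN : Real.log |g₁ ρ| - Real.log |g₁ a| ≤ B * (g ρ / g a) ^ (1 - κ)) :
    ∫ z in ρ..1, (g z + 1 / z + |l z|) / z ≤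
      (C + 1 + C * B / (2 * (a * g a)) + (g a + M) / (a * g a)) * g ρ := by
  have ha0 : 0 < a := hρ.trans_le hρa
  have hs1 : Icc ρ 1 ⊆ Ioc 0 1 := fun z hz => ⟨hρ.trans_le hz.1, hz.2⟩
  have hsa : Icc ρ a ⊆ Ioo 0 1 := fun z hz => ⟨hρ.trans_le hz.1, by linarith [hz.2]⟩
  have hsa1 : Icc ρ a ⊆ Icc ρ 1 := Icc_subset_Icc_right ha.le
  have ha1 : Icc a 1 ⊆ Icc ρ 1 := Icc_subset_Icc_left hρa
  have hgρ : 0 < g ρ := hpos ρ ⟨hρ, by linarith⟩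
  have hga : 0 < g a := hpos a ⟨ha0, ha.le⟩
  have hgaρ : g a ≤ g ρ := hanti ⟨hρ, by linarith⟩ ⟨ha0, ha.le⟩ hρa
  have hg1c : ContinuousOn g₁ (Icc ρ a) :=
    fun z hz => (hg₁ z (hsa hz)).continuousAt.continuousWithinAt
  have hgc' := hgc.mono hs1
  have hlc : ContinuousOn (fun z => |l z|) (Icc ρ 1) := (hl.mono hs1).abs
  have hz0 : ∀ z ∈ Icc ρ 1, z ≠ 0 := fun z hz => (hs1 hz).1.ne'
  have c1 : ContinuousOn (fun z => g z / z) (Icc ρ 1) := hgc'.div continuousOn_id hz0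
  have c2 : ContinuousOn (fun z : ℝ => 1 / z / z) (Icc ρ 1) :=
    (continuousOn_const.div continuousOn_id hz0).div continuousOn_id hz0
  have c3 : ContinuousOn (fun z => |l z| / z) (Icc ρ 1) := hlc.div continuousOn_id hz0
  have i1 : ∫ z in ρ..a, g z / z ≤ C * g ρ := by
    have := integral_le_sub_of_hasDerivAt (f := fun z => g z / z)
      (F := fun z => C * g ρ * (-κ * (z / ρ) ^ (-(1 / κ))))
      (F' := fun z => C * g ρ * (-κ * (1 / ρ * (-(1 / κ)) * (z / ρ) ^ (-(1 / κ) - 1)))) hρa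
      (c1.mono hsa1)
      (continuousOn_const.mul (continuousOn_const.mul
        ((continuousOn_id.div_const _).rpow_const fun z hz =>
          Or.inl (div_pos (hsa hz).1 hρ).ne')))
      (fun z hz => by
        have hz0 := (hsa (Ioo_subset_Icc_self hz)).1
        exact ((((hasDerivAt_id z).div_const ρ).rpow_const
          (Or.inl (by simp only [id]; positivity))).const_mul _).const_mul _)
      (fun z hz => by
        have hz0 := (hsa (Ioo_subset_Icc_self hz)).1
        have hgz := hpos z (Ioo_subset_Ioc_self (hsa (Ioo_subset_Icc_self hz)))
        have h1 := hgr z ⟨hz0, hz.2.le⟩ (ρ / z) ⟨by positivity, (div_le_one hz0).2 hz.1.le⟩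
        rw [div_mul_cancel₀ _ hz0.ne'] at h1
        have hw : 0 < z / ρ := by positivity
        have e2 : (z / ρ) ^ (-(1 / κ) - 1) = ((z / ρ) ^ (1 / κ))⁻¹ * (ρ / z) := by
          rw [Real.rpow_sub_one hw.ne', Real.rpow_neg hw.le]; field_simp
        rw [← inv_div z ρ, Real.inv_rpow hw.le, Real.rpow_neg hw.le, inv_inv] at h1
        have hP : 0 < (z / ρ) ^ (1 / κ) := Real.rpow_pos_of_pos hw _
        rw [e2]
        set Q := (z / ρ) ^ (1 / κ)
        have e3 : C * g ρ * (-κ * (1 / ρ * (-(1 / κ)) * (Q⁻¹ * (ρ / z)))) = C * g ρ / Q / z := by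
          field_simp
        rw [e3]
        gcongr
        rw [le_div_iff₀ hP]
        linarith)
    refine this.trans ?_
    have hP : 0 < (a / ρ) ^ (-(1 / κ)) := Real.rpow_pos_of_pos (by positivity) _
    simp only [div_self hρ.ne', Real.one_rpow]
    have : 0 ≤ C * g ρ * (κ * (a / ρ) ^ (-(1 / κ))) := by positivity
    have : C * g ρ * κ ≤ C * g ρ * 1 := by gcongr
    linarith
  have i2 : ∫ z in ρ..1, 1 / z / z ≤ g ρ := by
    have := integral_le_sub_of_hasDerivAt (f := fun z : ℝ => 1 / z / z)
      (F := fun z => -z⁻¹) (F' := fun z => -(-(z ^ 2)⁻¹)) (by linarith) c2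
      ((continuousOn_id.inv₀ hz0).neg)
      (fun z hz => (hasDerivAt_inv (hz0 z (Ioo_subset_Icc_self hz))).neg)
      (fun z hz => by rw [neg_neg, div_div, ← sq, one_div])
    refine this.trans ?_
    have : ρ⁻¹ ≤ g ρ := by rw [inv_le_iff_one_le_mul₀ hρ]; linarith
    norm_num
    linarith
  have i3 : ∫ z in ρ..a, |l z| / z ≤ C * B / (2 * (a * g a)) * g ρ := by
    have hlo := integral_neg_logDeriv_mul_rpow_le hρ hρa ha hκ hg hg₁ hg₂
      (fun t ht => hpos t (Ioo_subset_Ioc_self ht)) hneg hmono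
    have c4 : ContinuousOn (fun z => -(g₂ z / g₁ z) * g z ^ κ) (Icc ρ a) :=
      (((hg₂.mono hsa).div hg1c fun z hz => (hneg z (hsa hz)).ne).neg.mul
        ((hgc'.mono hsa1).rpow_const fun z hz => Or.inl
          (hpos z (Ioo_subset_Ioc_self (hsa hz))).ne'))
    calc ∫ z in ρ..a, |l z| / z
        ≤ ∫ z in ρ..a, (C / (2 * (a * g a ^ κ))) * (-(g₂ z / g₁ z) * g z ^ κ) := by
          apply intervalIntegral.integral_mono_on hρa
            ((c3.mono hsa1).intervalIntegrable_of_Icc hρa)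
            ((continuousOn_const.mul c4).intervalIntegrable_of_Icc hρa)
          intro z hz
          have hz0 := (hsa hz).1
          have hgz := hpos z (Ioo_subset_Ioc_self (hsa hz))
          have hd := div_rpow_le_of_growth hκ hκ1 hC hpos ha hgr hz0 hz.2 le_rfl
          rw [Real.div_rpow hgz.le hga.le] at hd
          have hlz := hla z ⟨hz0, hz.2⟩
          have hnn := (abs_nonneg _).trans hlz
          calc |l z| / z = |l z| * (1 / z) := by ring
            _ ≤ (1 / 2 * -(g₂ z / g₁ z)) * (C / a * (g z ^ κ / g a ^ κ)) := by
              gcongr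
            _ = (C / (2 * (a * g a ^ κ))) * (-(g₂ z / g₁ z) * g z ^ κ) := by
              generalize g₂ z / g₁ z = r
              field_simp
      _ = (C / (2 * (a * g a ^ κ))) * ∫ z in ρ..a, (-(g₂ z / g₁ z) * g z ^ κ) :=
          intervalIntegral.integral_const_mul _ _
      _ ≤ (C / (2 * (a * g a ^ κ))) * ((B * (g ρ / g a) ^ (1 - κ)) * g ρ ^ κ) := by
          gcongr
          exact hlo.trans (by gcongr)
      _ = _ := by
        rw [Real.div_rpow hgρ.le hga.le, Real.rpow_sub hgρ, Real.rpow_sub hga, Real.rpow_one,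
          Real.rpow_one]
        field_simp
  have i4 : ∫ z in a..1, (g z / z + |l z| / z) ≤ (g a + M) / (a * g a) * g ρ := by
    have h1 : ∀ z ∈ Icc a 1, g z / z + |l z| / z ≤ (g a + M) / a := by
      intro z hz
      have h2 : g z ≤ g a := hanti ⟨ha0, ha.le⟩ ⟨ha0.trans_le hz.1, hz.2⟩ hz.1
      have h3 := hM z hz
      rw [← add_div]
      have := hpos z ⟨ha0.trans_le hz.1, hz.2⟩
      have := abs_nonneg (l z)
      apply div_le_div₀ (by linarith) (by linarith) ha0 hz.1
    have hM0 : 0 ≤ M := (abs_nonneg _).trans (hM 1 (right_mem_Icc.2 ha.le))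
    calc _ ≤ ∫ z in a..1, (g a + M) / a :=
          intervalIntegral.integral_mono_on ha.le
            (((c1.add c3).mono ha1).intervalIntegrable_of_Icc ha.le) (by simp) h1
      _ = (1 - a) * ((g a + M) / a) := by rw [intervalIntegral.integral_const, smul_eq_mul]
      _ ≤ 1 * ((g a + M) / a) := by gcongr; linarith
      _ = (g a + M) / (a * g a) * g a := by field_simp
      _ ≤ _ := by gcongr
  have I : ∀ {f : ℝ → ℝ}, ContinuousOn f (Icc ρ 1) → IntervalIntegrable f volume ρ a ∧
      IntervalIntegrable f volume a 1 ∧ IntervalIntegrable f volume ρ 1 := fun hf =>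
    ⟨(hf.mono hsa1).intervalIntegrable_of_Icc hρa, (hf.mono ha1).intervalIntegrable_of_Icc ha.le,
      hf.intervalIntegrable_of_Icc (by linarith)⟩
  calc _ = ∫ z in ρ..1, ((g z / z + |l z| / z) + 1 / z / z) := by
        congr 1; ext z; ring
    _ = (∫ z in ρ..1, (g z / z + |l z| / z)) + ∫ z in ρ..1, 1 / z / z :=
      intervalIntegral.integral_add (I (c1.add c3)).2.2 (I c2).2.2
    _ = ((∫ z in ρ..a, (g z / z + |l z| / z)) + ∫ z in a..1, (g z / z + |l z| / z)) +
        ∫ z in ρ..1, 1 / z / z := by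
      congr 1
      exact (intervalIntegral.integral_add_adjacent_intervals (I (c1.add c3)).1
        (I (c1.add c3)).2.1).symm
    _ = (((∫ z in ρ..a, g z / z) + ∫ z in ρ..a, |l z| / z) +
        ∫ z in a..1, (g z / z + |l z| / z)) + ∫ z in ρ..1, 1 / z / z := by
      rw [intervalIntegral.integral_add (I c1).1 (I c3).1]
    _ ≤ _ := by linarith

/-! ### The analytic profile extracted from the assumptions -/

/-- The consequences of the growth assumptions on `g = γ'` and `l = ψ' / ψ` that the kernel
estimates use. -/
structure PhaseProfile (g l : ℝ → ℝ) (a κ C : ℝ) : Prop where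
  a_pos : 0 < a
  a_le_half : a ≤ 1 / 2
  κ_pos : 0 < κ
  κ_lt_one : κ < 1
  one_le_C : 1 ≤ C
  contDiff : ContDiffOn ℝ 2 g (Ioc 0 1)
  cont_l : ContinuousOn l (Ioc 0 1)
  pos : ∀ t ∈ Ioc (0 : ℝ) 1, 0 < g t
  deriv_mono : MonotoneOn (derivIoc g) (Ioc 0 1)
  growth : ∀ t ∈ Ioc 0 a, ∀ θ ∈ Ioc (0 : ℝ) 1, θ ^ (-(1 / κ)) * g t ≤ C * g (θ * t)
  shift : ∀ y ∈ Ioc 0 a, ∀ x, 0 < x → y + x ≤ 1 → g y * min (x / y) 1 ≤ C * (g y - g (y + x))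
  large : ∀ ρ ∈ Ioc 0 a, 8 ≤ ρ * g ρ
  small_scale : ∀ e ρ, 0 < e → e ≤ ρ → ρ ≤ a →
    ∫ z in e..ρ, (1 / z + |l z|) / (z * g z) ≤ C / (ρ * g ρ)
  large_scale : ∀ ρ ∈ Ioc 0 a, ∫ z in ρ..1, (g z + 1 / z + |l z|) / z ≤ C * g ρ

lemma exists_rpow_neg_ge {q : ℝ} (hq : 0 < q) (X : ℝ) :
    ∃ θ₀ ∈ Ioc (0 : ℝ) 1, ∀ θ ∈ Ioc 0 θ₀, X ≤ θ ^ (-q) := by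
  set Y := max 1 X
  have hY : 1 ≤ Y := le_max_left _ _
  have hY0 : 0 < Y := by linarith
  refine ⟨Y ^ (-(1 / q)), ⟨Real.rpow_pos_of_pos hY0 _,
    Real.rpow_le_one_of_one_le_of_nonpos hY (by simp [hq.le])⟩, fun θ hθ => ?_⟩
  have := Real.rpow_le_rpow_of_nonpos hθ.1 hθ.2 (neg_nonpos.2 hq.le)
  rw [← Real.rpow_mul hY0.le, show -(1 / q) * -q = 1 by field_simp, Real.rpow_one] at this
  exact (le_max_right _ _).trans this

/-- A decreasing derivative would stay above its value at `1`, which bounds `g` near `0` and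
contradicts unboundedness. -/
lemma monotoneOn_derivIoc_of_unbounded {g : ℝ → ℝ} (hg : ContDiffOn ℝ 1 g (Ioc 0 1))
    (hunb : ∀ s, ∃ t ∈ Ioc (0 : ℝ) 1, s ≤ g t) (h : IsMonotoneIoc (derivIoc g)) :
    MonotoneOn (derivIoc g) (Ioc 0 1) := by
  refine h.resolve_right fun hanti => ?_
  obtain ⟨t, ht, hs⟩ := hunb (g 1 + |derivIoc g 1| + 1)
  rcases ht.2.eq_or_lt with rfl | ht1
  · linarith [abs_nonneg (derivIoc g 1)]
  have hsub : Icc t 1 ⊆ Ioc 0 1 := fun z hz => ⟨ht.1.trans_le hz.1, hz.2⟩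
  obtain ⟨c, hc, hc'⟩ := exists_hasDerivAt_eq_slope g (derivIoc g) ht1 (hg.continuousOn.mono hsub)
    (fun z hz => hasDerivAt_derivIoc hg le_rfl ⟨ht.1.trans hz.1, hz.2⟩)
  have h1 := hanti (hsub (Ioo_subset_Icc_self hc)) (right_mem_Ioc.2 one_pos) hc.2.le
  rw [hc', le_div_iff₀ (by linarith)] at h1
  have := neg_abs_le (derivIoc g 1)
  have h0 := abs_nonneg (derivIoc g 1)
  have h3 : -(derivIoc g 1) * (1 - t) ≤ |derivIoc g 1| * 1 := by
    apply mul_le_mul (neg_le_abs _) (by linarith [ht.1]) (by linarith) h0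
  linarith

/-- If the derivative were nonnegative at `t`, it would be so on `(t, 1)`, against strict decrease.
The endpoint `1` is excluded because the derivative may vanish there. -/
lemma derivIoc_neg_of_strictAnti {g : ℝ → ℝ} (hg : ContDiffOn ℝ 1 g (Ioc 0 1))
    (hs : StrictAntiOn g (Ioc 0 1)) (hm : MonotoneOn (derivIoc g) (Ioc 0 1)) :
    ∀ t ∈ Ioo (0 : ℝ) 1, derivIoc g t < 0 := by
  intro t ht
  by_contra! hn
  have hsub : Icc t 1 ⊆ Ioc 0 1 := fun z hz => ⟨ht.1.trans_le hz.1, hz.2⟩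
  obtain ⟨c, hc, hc'⟩ := exists_hasDerivAt_eq_slope g (derivIoc g) ht.2 (hg.continuousOn.mono hsub)
    (fun z hz => hasDerivAt_derivIoc hg le_rfl ⟨ht.1.trans hz.1, hz.2⟩)
  have h1 := hm (Ioo_subset_Ioc_self ht) (hsub (Ioo_subset_Icc_self hc)) hc.1.le
  have h2 := hs (Ioo_subset_Ioc_self ht) (right_mem_Ioc.2 one_pos) ht.2
  have : (g 1 - g t) / (1 - t) < 0 := div_neg_of_neg_of_pos (by linarith) (by linarith [ht.2])
  linarith

lemma convexOn_of_monotoneOn_derivIoc {g : ℝ → ℝ} (hg : ContDiffOn ℝ 1 g (Ioc 0 1))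
    (hm : MonotoneOn (derivIoc g) (Ioc 0 1)) : ConvexOn ℝ (Ioc 0 1) g := by
  have hd : ∀ t ∈ Ioo (0 : ℝ) 1, HasDerivAt g (derivIoc g t) t :=
    fun t ht => hasDerivAt_derivIoc hg le_rfl ht
  apply MonotoneOn.convexOn_of_deriv (convex_Ioc 0 1) hg.continuousOn
  · rw [interior_Ioc]
    exact fun t ht => (hd t ht).differentiableAt.differentiableWithinAt
  · rw [interior_Ioc]
    intro x hx y hy hxy
    rw [(hd x hx).deriv, (hd y hy).deriv]
    exact hm (Ioo_subset_Ioc_self hx) (Ioo_subset_Ioc_self hy) hxy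

theorem PhaseAssumptions.exists_profile {γ ψ : ℝ → ℝ} (h : PhaseAssumptions γ ψ) :
    ∃ a κ C, PhaseProfile (derivIoc γ) (fun t => derivIoc ψ t / ψ t) a κ C := by
  obtain ⟨t₀, s₀, C₀, ht₀, ht₁, hs₀, -, hC₀, ha2, ha3, ⟨e, A, he, hA, het, ha4⟩, -⟩ := h.growth
  set g := derivIoc γ with hgdef
  set l := fun t => derivIoc ψ t / ψ t with hldef
  have hg : ContDiffOn ℝ 2 g (Ioc 0 1) := derivIoc_contDiffOn h.contDiff_phase (by norm_num)
  have hg' : ContDiffOn ℝ 1 (derivIoc g) (Ioc 0 1) := derivIoc_contDiffOn hg (by norm_num)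
  have hg'' : ContDiffOn ℝ 0 (derivIoc (derivIoc g)) (Ioc 0 1) :=
    derivIoc_contDiffOn hg' (by norm_num)
  have hψ' : ContDiffOn ℝ 1 (derivIoc ψ) (Ioc 0 1) := derivIoc_contDiffOn h.contDiff_psi (by norm_num)
  have hg1 : ContDiffOn ℝ 1 g (Ioc 0 1) := hg.of_le (by norm_num)
  have hl : ContinuousOn l (Ioc 0 1) := hψ'.continuousOn.div h.contDiff_psi.continuousOn
    fun t ht => (h.psi_pos t ht).ne'
  have hstrict := h.phase_deriv_strictAnti
  have hpos := h.phase_deriv_pos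
  rw [← hgdef] at hstrict hpos
  have hanti := hstrict.antitoneOn
  have h1e : 1 < 1 + e := by linarith
  have hA1 : 1 < A := by linarith
  set p := Real.log A / Real.log (1 + e) with hp
  -- This is where `A > 1 + e` is needed: it makes `κ = 1 / p` smaller than `1`.
  have hp1 : 1 < p := by
    rw [hp, one_lt_div (Real.log_pos h1e)]
    exact Real.log_lt_log (by linarith) hA
  have hgr := fun t (ht : t ∈ Ioc 0 t₀) θ (hθ : θ ∈ Ioc (0 : ℝ) 1) =>
    growth_of_iterate he hA1 het hanti hpos ha4 ht hθ
  rw [← hp] at hgr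
  have hgt₀ : 0 < g t₀ := hpos t₀ ⟨ht₀, ht₁.le⟩
  have hunb : ∀ s, ∃ t ∈ Ioc (0 : ℝ) 1, s ≤ g t := by
    intro s
    obtain ⟨θ, hθ, hX⟩ := exists_rpow_neg_ge (q := p) (by linarith) (A * s / g t₀)
    refine ⟨θ * t₀, ⟨mul_pos hθ.1 ht₀, mul_le_one₀ hθ.2 ht₀.le ht₁.le⟩, ?_⟩
    refine le_trans ?_ (hgr t₀ ⟨ht₀, le_rfl⟩ θ hθ)
    calc s = A⁻¹ * (A * s / g t₀) * g t₀ := by field_simp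
      _ ≤ _ := by gcongr; exact hX θ ⟨hθ.1, le_rfl⟩
  have hmono := monotoneOn_derivIoc_of_unbounded hg1 hunb h.monotone_phase_deriv_two
  have hneg := derivIoc_neg_of_strictAnti hg1 hstrict hmono
  have hconv := convexOn_of_monotoneOn_derivIoc hg1 hmono
  obtain ⟨t₂, ht₂, hst₂⟩ := hunb (s₀ + 1)
  -- The threshold is the one that turns growth from `t₀` into `8 ≤ ρ * g ρ` for `ρ ≤ θ₀ * t₀`.
  obtain ⟨θ₀, hθ₀, hX⟩ := exists_rpow_neg_ge (q := p - 1) (by linarith) (8 * A / (t₀ * g t₀))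
  -- Below `t₂` one has `γ' > s₀`, so the doubling hypothesis applies; `t₀ / 2` gives strict room
  -- below `t₀`; `θ₀ * t₀` is for `hlarge`.
  set a := min (min (1 / 2) t₂) (min (t₀ / 2) (θ₀ * t₀)) with hadef
  have ha0 : 0 < a := lt_min (lt_min (by norm_num) ht₂.1)
    (lt_min (by linarith) (mul_pos hθ₀.1 ht₀))
  have ha2' : a ≤ 1 / 2 := (min_le_left _ _).trans (min_le_left _ _)
  have hat₂ : a ≤ t₂ := (min_le_left _ _).trans (min_le_right _ _)
  have hat₀ : a < t₀ := lt_of_le_of_lt ((min_le_right _ _).trans (min_le_left _ _)) (by linarith)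
  have haθ : a ≤ θ₀ * t₀ := (min_le_right _ _).trans (min_le_right _ _)
  have ha1 : a < 1 := by linarith
  have hsa : ∀ t ∈ Ioc 0 a, s₀ < g t := fun t ht => by
    have := hanti ⟨ht.1, by linarith [ht.2]⟩ ht₂ (ht.2.trans hat₂)
    linarith
  have hlarge : ∀ ρ ∈ Ioc 0 a, 8 ≤ ρ * g ρ := by
    intro ρ hρ
    have hθ : 0 < ρ / t₀ := div_pos hρ.1 ht₀
    have hθ1 : ρ / t₀ ≤ θ₀ := by rw [div_le_iff₀ ht₀]; exact hρ.2.trans haθ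
    have h1 := hgr t₀ ⟨ht₀, le_rfl⟩ (ρ / t₀) ⟨hθ, hθ1.trans hθ₀.2⟩
    rw [div_mul_cancel₀ _ ht₀.ne'] at h1
    have h2 := hX _ ⟨hθ, hθ1⟩
    have e1 : (ρ / t₀) ^ (-(p - 1)) = (ρ / t₀) ^ (-p) * (ρ / t₀) := by
      rw [show -(p - 1) = -p + 1 by ring, Real.rpow_add_one hθ.ne']
    rw [e1] at h2
    calc (8 : ℝ) = t₀ * (A⁻¹ * (8 * A / (t₀ * g t₀)) * g t₀) := by field_simp
      _ ≤ t₀ * (A⁻¹ * ((ρ / t₀) ^ (-p) * (ρ / t₀)) * g t₀) := by gcongr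
      _ = ρ * (A⁻¹ * (ρ / t₀) ^ (-p) * g t₀) := by field_simp
      _ ≤ _ := by gcongr; exact hρ.1.le
  set κ := 1 / p with hκ
  have hκ0 : 0 < κ := by positivity
  have hκ1 : κ < 1 := by rw [hκ, div_lt_one (by linarith)]; exact hp1
  have hgrA : ∀ t ∈ Ioc 0 a, ∀ θ ∈ Ioc (0 : ℝ) 1, θ ^ (-(1 / κ)) * g t ≤ A * g (θ * t) := by
    intro t ht θ hθ
    have h1 := hgr t ⟨ht.1, ht.2.trans hat₀.le⟩ θ hθ
    rw [hκ, one_div_one_div]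
    calc _ = A * (A⁻¹ * θ ^ (-p) * g t) := by field_simp
      _ ≤ _ := by gcongr
  have hd : ∀ t ∈ Ioo (0 : ℝ) 1, HasDerivAt g (derivIoc g t) t :=
    fun t ht => hasDerivAt_derivIoc hg1 le_rfl ht
  have hd1 : ∀ t ∈ Ioo (0 : ℝ) 1, HasDerivAt (derivIoc g) (derivIoc (derivIoc g) t) t :=
    fun t ht => hasDerivAt_derivIoc hg' le_rfl ht
  have hg2c : ContinuousOn (derivIoc (derivIoc g)) (Ioo 0 1) :=
    hg''.continuousOn.mono Ioo_subset_Ioc_self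
  have hla : ∀ t ∈ Ioc 0 a, |l t| ≤ 1 / 2 * -(derivIoc (derivIoc g) t / derivIoc g t) := by
    intro t ht
    have h1 := ha2 t ⟨ht.1, ht.2.trans_lt hat₀⟩
    have h2 : 0 ≤ derivIoc (derivIoc g) t := hmono.derivWithin_nonneg
    have h3 := hneg t ⟨ht.1, ht.2.trans_lt ha1⟩
    rwa [abs_of_nonpos (div_nonpos_of_nonneg_of_nonpos h2 h3.le)] at h1
  have hC1 : 1 ≤ max 1 C₀ := le_max_left _ _
  have hdbl : ∀ s > s₀, |derivIoc g (Function.invFunOn g (Ioc 0 1) (2 * s))| ≤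
      max 1 C₀ * |derivIoc g (Function.invFunOn g (Ioc 0 1) s)| := fun s hs =>
    (ha3 s hs).trans (mul_le_mul_of_nonneg_right (le_max_right _ _) (abs_nonneg _))
  set B : ℝ → ℝ := fun σ => Real.log (max 1 C₀) * (2 ^ σ / (σ * Real.log 2))
  have hN : ∀ σ > 0, ∀ y₁ y₂, 0 < y₁ → y₁ ≤ y₂ → y₂ ≤ a →
      Real.log |derivIoc g y₁| - Real.log |derivIoc g y₂| ≤ B σ * (g y₁ / g y₂) ^ σ := by
    intro σ hσ y₁ y₂ h1 h12 h2
    exact log_abs_sub_log_abs_le hs₀ hC1 hstrict hg.continuousOn hunb hmono hneg hdbl hσ h1 h12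
      (by linarith) (hsa y₂ ⟨by linarith, h2⟩)
  have hsa1 : Icc a 1 ⊆ Ioc 0 1 := fun z hz => ⟨ha0.trans_le hz.1, hz.2⟩
  obtain ⟨M, hM⟩ := isCompact_Icc.exists_bound_of_continuousOn (hl.mono hsa1)
  set c := (1 - A⁻¹) * min 1 e⁻¹
  have hc : 0 < c := mul_pos (sub_pos.2 (inv_lt_one_of_one_lt₀ hA1)) (lt_min one_pos (inv_pos.2 he))
  set C1 := A * (1 / (1 / κ - 1)) + A / 2 * (3 * B ((1 - κ) / 2))
  set C2 := A + 1 + A * B (1 - κ) / (2 * (a * g a)) + (g a + M) / (a * g a)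
  set C := max (max A c⁻¹) (max C1 C2)
  have hCA : A ≤ C := (le_max_left _ _).trans (le_max_left _ _)
  have hCc : c⁻¹ ≤ C := (le_max_right _ _).trans (le_max_left _ _)
  have hCC1 : C1 ≤ C := (le_max_left _ _).trans (le_max_right _ _)
  have hCC2 : C2 ≤ C := (le_max_right _ _).trans (le_max_right _ _)
  refine ⟨a, κ, C, ha0, ha2', hκ0, hκ1, hA1.le.trans hCA, hg, hl, hpos, hmono, ?_, ?_,
    hlarge, ?_, ?_⟩
  · intro t ht θ hθ
    have : 0 < g (θ * t) := hpos _ ⟨mul_pos hθ.1 ht.1, mul_le_one₀ hθ.2 ht.1.le (ht.2.trans ha1.le)⟩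
    exact (hgrA t ht θ hθ).trans (by gcongr)
  · intro y hy x hx hyx
    have hey : (1 + e) * y ≤ 1 := by nlinarith [hy.2]
    have h1 := sub_shift_ge he hA1 hconv hanti hy.1 hey (hpos y ⟨hy.1, by linarith⟩)
      (ha4 y ⟨hy.1, hy.2.trans_lt hat₀⟩) hx hyx
    have h2 : 0 ≤ g y - g (y + x) :=
      sub_nonneg.2 (hanti ⟨hy.1, by linarith⟩ ⟨by linarith [hy.1], hyx⟩ (by linarith))
    calc _ = c⁻¹ * (c * (g y * min (x / y) 1)) := by field_simp
      _ ≤ c⁻¹ * (g y - g (y + x)) := by gcongr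
      _ ≤ _ := by gcongr
  · intro e' ρ he' heρ hρ
    have hρ0 := he'.trans_le heρ
    have := hpos ρ ⟨hρ0, by linarith⟩
    refine (integral_small_scale_le hκ0 hκ1 hA1.le ha1 hd hd1 hg2c hl hpos hneg hgrA hla he' heρ hρ
      (fun y hy => hN _ (by linarith) y ρ (he'.trans_le hy.1) hy.2 hρ)).trans ?_
    gcongr
  · intro ρ hρ
    have := hpos ρ ⟨hρ.1, by linarith [hρ.2]⟩
    refine (integral_large_scale_le hκ0 hκ1 hA1.le ha1 hM hd hg.continuousOn hd1 hg2c hl hanti hpos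
      hneg (hmono.mono Ioo_subset_Ioc_self) hgrA hla hρ.1 hρ.2 (by linarith [hlarge ρ hρ])
      (hN _ (by linarith) ρ a hρ.1 hρ.2 le_rfl)).trans ?_
    gcongr

/-! ### The phase and oscillatory integration by parts -/

/-- The phase of the kernel, so that `K_{ε,β}(x) = x⁻¹ * exp (i * oscPhase γ ψ β x)` on `[ε, 1]`. -/
noncomputable def oscPhase (γ ψ : ℝ → ℝ) (β x : ℝ) : ℝ :=
  γ x + β * (Real.log (ψ x) - Real.log x)

lemma continuousOn_oscPhase {γ ψ : ℝ → ℝ} (hA : PhaseAssumptions γ ψ) (β : ℝ) :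
    ContinuousOn (oscPhase γ ψ β) (Ioc 0 1) := by
  unfold oscPhase
  exact hA.contDiff_phase.continuousOn.add (continuousOn_const.mul
    ((hA.contDiff_psi.continuousOn.log fun y hy => (hA.psi_pos y hy).ne').sub
      (continuousOn_id.log fun y hy => hy.1.ne')))

lemma hasDerivAt_oscPhase {γ ψ : ℝ → ℝ} (hA : PhaseAssumptions γ ψ) (β : ℝ) {y : ℝ}
    (hy : y ∈ Ioo (0 : ℝ) 1) :
    HasDerivAt (oscPhase γ ψ β) (derivIoc γ y + β * (derivIoc ψ y / ψ y - 1 / y)) y := by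
  have d1 := hasDerivAt_derivIoc hA.contDiff_phase (by norm_num) hy
  have d2 := (hasDerivAt_derivIoc hA.contDiff_psi (by norm_num) hy).log
    (hA.psi_pos y (Ioo_subset_Ioc_self hy)).ne'
  have d3 := Real.hasDerivAt_log hy.1.ne'
  rw [← one_div] at d3
  exact d1.add ((d2.sub d3).const_mul β)

lemma oscKernel_eq_indicator {γ ψ : ℝ → ℝ} (hψ : ∀ t ∈ Ioc (0 : ℝ) 1, 0 < ψ t) {ε : ℝ} (hε : 0 < ε)
    (β : ℝ) : oscKernel γ ψ ε β =
      (Icc ε 1).indicator fun x => ((x⁻¹ : ℝ) : ℂ) * Complex.exp (Complex.I * oscPhase γ ψ β x) := by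
  ext x
  unfold oscKernel
  by_cases hx : x ∈ Icc ε 1
  · rw [if_pos hx, indicator_of_mem hx]
    have hx0 : 0 < x := hε.trans_le hx.1
    have hψx := hψ x ⟨hx0, hx.2⟩
    have hxc : (x : ℂ) ≠ 0 := by exact_mod_cast hx0.ne'
    have hψc : (ψ x : ℂ) ≠ 0 := by exact_mod_cast hψx.ne'
    rw [Complex.cpow_add _ _ hxc, Complex.cpow_one, Complex.cpow_def_of_ne_zero hxc,
      Complex.cpow_def_of_ne_zero hψc, mul_assoc, ← Complex.exp_add, ← Complex.ofReal_log hx0.le,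
      ← Complex.ofReal_log hψx.le, div_mul_eq_div_div, div_right_comm, ← Complex.exp_sub,
      div_eq_mul_inv, mul_comm]
    unfold oscPhase
    push_cast
    congr 2
    ring
  · rw [if_neg hx, indicator_of_notMem hx]

lemma norm_inv_mul_exp (x r : ℝ) :
    ‖((x⁻¹ : ℝ) : ℂ) * Complex.exp (Complex.I * r)‖ = |x|⁻¹ := by
  rw [norm_mul, mul_comm Complex.I, Complex.norm_exp_ofReal_mul_I, mul_one, Complex.norm_real,
    Real.norm_eq_abs, abs_inv]

/-- Integration by parts for an oscillatory integral with phase `θ`, where `θ' = -G` up to a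
perturbation. -/
lemma norm_integral_mul_exp_le {θ θ' G P P' S : ℝ → ℝ} {e b : ℝ} (heb : e ≤ b)
    (hθ : ContinuousOn θ (Icc e b)) (hθ' : ContinuousOn θ' (Icc e b))
    (hdθ : ∀ y ∈ Ioo e b, HasDerivAt θ (θ' y) y)
    (hG : ContinuousOn G (Icc e b)) (hP : ContinuousOn P (Icc e b))
    (hP' : ContinuousOn P' (Icc e b)) (hdP : ∀ y ∈ Ioo e b, HasDerivAt P (P' y) y)
    (hS : ContinuousOn S (Icc e b)) (hP0 : ∀ y ∈ Icc e b, 0 ≤ P y)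
    (hle : ∀ y ∈ Icc e b, |P' y| + P y * |θ' y + G y| ≤ P' y + S y) :
    ‖∫ y in e..b, ((G y * P y : ℝ) : ℂ) * Complex.exp (Complex.I * θ y)‖ ≤
      2 * P b + ∫ y in e..b, S y := by
  set E : ℝ → ℂ := fun y => Complex.exp (Complex.I * θ y)
  have hEn : ∀ y, ‖E y‖ = 1 := fun y => by
    simp only [E]; rw [mul_comm, Complex.norm_exp_ofReal_mul_I]
  have ofR : ∀ {f : ℝ → ℝ}, ContinuousOn f (Icc e b) → ContinuousOn (fun y => (f y : ℂ)) (Icc e b) :=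
    fun hf => Complex.continuous_ofReal.comp_continuousOn hf
  have hE : ContinuousOn E (Icc e b) :=
    Complex.continuous_exp.comp_continuousOn (continuousOn_const.mul (ofR hθ))
  have hGP : ContinuousOn (fun y => ((G y * P y : ℝ) : ℂ) * E y) (Icc e b) :=
    (ofR (hG.mul hP)).mul hE
  have hT : ContinuousOn (fun y => ((P' y : ℂ) + Complex.I * ((P y * (θ' y + G y) : ℝ) : ℂ)) * E y)
      (Icc e b) :=
    ((ofR hP').add (continuousOn_const.mul (ofR (hP.mul (hθ'.add hG))))).mul hE
  have hII : ∀ {f : ℝ → ℂ}, ContinuousOn f (Icc e b) → IntervalIntegrable f volume e b :=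
    fun hf => hf.intervalIntegrable_of_Icc heb
  -- Writing `θ' = (θ' + G) - G` in the derivative of `P * exp (i θ)` isolates the integrand `G *
  -- P`; what remains is an error.
  have hFTC : ∫ y in e..b, (((P' y : ℂ) + Complex.I * ((P y * (θ' y + G y) : ℝ) : ℂ)) * E y -
      Complex.I * (((G y * P y : ℝ) : ℂ) * E y)) = P b * E b - P e * E e := by
    apply intervalIntegral.integral_eq_sub_of_hasDerivAt_of_le (f := fun y => (P y : ℂ) * E y) heb
      ((ofR hP).mul hE)
    · intro y hy
      have h1 := (hdP y hy).ofReal_comp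
      have h2 := (((hdθ y hy).ofReal_comp).const_mul Complex.I).cexp
      convert! h1.mul h2 using 1
      simp only [E]
      push_cast
      ring
    · exact hII (hT.sub (continuousOn_const.mul hGP))
  rw [intervalIntegral.integral_sub (hII hT)
      (hII (f := fun y => Complex.I * (((G y * P y : ℝ) : ℂ) * E y)) (continuousOn_const.mul hGP)),
    intervalIntegral.integral_const_mul] at hFTC
  have hPint : ∫ y in e..b, P' y = P b - P e :=
    intervalIntegral.integral_eq_sub_of_hasDerivAt_of_le heb hP hdP
      (hP'.intervalIntegrable_of_Icc heb)
  have hTn : ‖∫ y in e..b, (((P' y : ℂ) + Complex.I * ((P y * (θ' y + G y) : ℝ) : ℂ)) * E y)‖ ≤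
      ∫ y in e..b, (P' y + S y) := by
    apply intervalIntegral.norm_integral_le_of_norm_le heb _
      ((hP'.add hS).intervalIntegrable_of_Icc heb)
    refine Filter.Eventually.of_forall fun y hy => ?_
    have hy' : y ∈ Icc e b := Ioc_subset_Icc_self hy
    rw [norm_mul, hEn, mul_one]
    refine (norm_add_le _ _).trans (le_trans ?_ (hle y hy'))
    rw [norm_mul, Complex.norm_I, one_mul, Complex.norm_real, Complex.norm_real, Real.norm_eq_abs,
      Real.norm_eq_abs, abs_mul, abs_of_nonneg (hP0 y hy')]
  rw [intervalIntegral.integral_add (hP'.intervalIntegrable_of_Icc heb)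
    (hS.intervalIntegrable_of_Icc heb), hPint] at hTn
  have hb : ‖(P b : ℂ) * E b‖ = P b := by
    rw [norm_mul, hEn, mul_one, Complex.norm_real, Real.norm_of_nonneg (hP0 b (right_mem_Icc.2 heb))]
  have he : ‖(P e : ℂ) * E e‖ = P e := by
    rw [norm_mul, hEn, mul_one, Complex.norm_real, Real.norm_of_nonneg (hP0 e (left_mem_Icc.2 heb))]
  have hI : ‖∫ y in e..b, ((G y * P y : ℝ) : ℂ) * E y‖ =
      ‖Complex.I * ∫ y in e..b, ((G y * P y : ℝ) : ℂ) * E y‖ := by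
    rw [norm_mul, Complex.norm_I, one_mul]
  rw [show Complex.I * (∫ y in e..b, ((G y * P y : ℝ) : ℂ) * E y) =
    (∫ y in e..b, (((P' y : ℂ) + Complex.I * ((P y * (θ' y + G y) : ℝ) : ℂ)) * E y)) -
      (P b * E b - P e * E e) by rw [← hFTC]; ring] at hI
  rw [hI]
  -- The boundary term `P e` cancels against `-P e` from `∫ P'`, so only `2 * P b` is left.
  refine (norm_sub_le _ _).trans ?_
  have := norm_sub_le ((P b : ℂ) * E b) (P e * E e)
  rw [hb, he] at this
  linarith

/-- It bounds from below the denominator `D` in the integration by parts: the increment of `g` is at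
least a multiple of `g y * min (x / y) 1`, and `x * y ≤ min (x / y) 1 * (y * (y + x))` in either
case of the minimum. -/
lemma PhaseProfile.mul_le_of_shift {g l : ℝ → ℝ} {a κ C : ℝ} (h : PhaseProfile g l a κ C)
    {x y : ℝ} (hx : 0 < x) (hy : y ∈ Ioc 0 a) (hyx : y + x ≤ 1) :
    x * (y * g y) ≤ C * ((g y - g (y + x)) * (y * (y + x))) := by
  have hy0 := hy.1
  have hg := h.pos y ⟨hy0, by linarith⟩
  have h1 := h.shift y hy x hx hyx
  have h2 : x * y ≤ min (x / y) 1 * (y * (y + x)) := by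
    rcases le_total (x / y) 1 with h3 | h3
    · rw [min_eq_left h3]
      have : x / y * (y * (y + x)) = x * (y + x) := by field_simp
      rw [this]; nlinarith
    · rw [min_eq_right h3]; nlinarith
  calc x * (y * g y) = (x * y) * g y := by ring
    _ ≤ (min (x / y) 1 * (y * (y + x))) * g y := by gcongr
    _ = (g y * min (x / y) 1) * (y * (y + x)) := by ring
    _ ≤ (C * (g y - g (y + x))) * (y * (y + x)) := by gcongr
    _ = _ := by ring

/-- The amplitude `1 / (y * (y + x))` is written as `G * P`, with `G = g y - g (y + x)` the main
part of minus the phase derivative and `P = 1 / D`. The remaining part of the phase derivative is a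
multiple of `β`, so `β` enters the error linearly. Monotonicity of `g'` bounds `D'` from above, and
no control of `g''` is needed. -/
lemma norm_integral_corr_le {γ ψ : ℝ → ℝ} {a κ C : ℝ} (hA : PhaseAssumptions γ ψ)
    (h : PhaseProfile (derivIoc γ) (fun t => derivIoc ψ t / ψ t) a κ C) (β : ℝ) {x e b : ℝ}
    (hx : 0 < x) (he : 0 < e) (heb : e ≤ b) (hba : b ≤ a) (hbx : b + x ≤ 1) :
    ‖∫ y in e..b, (((y * (y + x))⁻¹ : ℝ) : ℂ) *
        Complex.exp (Complex.I * ((oscPhase γ ψ β (y + x) - oscPhase γ ψ β y : ℝ) : ℂ))‖ ≤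
      2 * (C / x * (1 / (b * derivIoc γ b))) +
        ∫ y in e..b, C / x * (4 + |β|) * (1 / (y * derivIoc γ y) *
          ((1 / y + |derivIoc ψ y / ψ y|) +
            (1 / (y + x) + |derivIoc ψ (y + x) / ψ (y + x)|))) := by
  set g := derivIoc γ with hgdef
  set l := fun t => derivIoc ψ t / ψ t with hldef
  have ha1 := h.a_le_half
  have hC := h.one_le_C
  have hs : Icc e b ⊆ Ioo 0 1 := fun y hy => ⟨he.trans_le hy.1, by linarith [hy.2]⟩
  have hsx : MapsTo (fun y => y + x) (Icc e b) (Ioc 0 1) := fun y hy =>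
    ⟨by linarith [(hs hy).1], by simp only; linarith [hy.2]⟩
  have hsx' : ∀ y ∈ Ioo e b, y + x ∈ Ioo (0 : ℝ) 1 := fun y hy =>
    ⟨by linarith [hy.1], by linarith [hy.2]⟩
  have hs' := hs.trans Ioo_subset_Ioc_self
  have hax : ContinuousOn (fun y : ℝ => y + x) (Icc e b) := by fun_prop
  have hshift : ∀ {f : ℝ → ℝ}, ContinuousOn f (Ioc 0 1) → ContinuousOn (fun y => f (y + x)) (Icc e b) :=
    fun hf => hf.comp hax hsx
  have hg1 : ContDiffOn ℝ 1 g (Ioc 0 1) := h.contDiff.of_le (by norm_num)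
  have hgc := hg1.continuousOn
  have hg1c : ContinuousOn (derivIoc g) (Ioc 0 1) :=
    (derivIoc_contDiffOn (m := 0) hg1 (by norm_num)).continuousOn
  have hinv : ContinuousOn (fun y : ℝ => 1 / y) (Ioc 0 1) :=
    continuousOn_const.div continuousOn_id fun y hy => hy.1.ne'
  have hlc : ContinuousOn l (Ioc 0 1) := h.cont_l
  have hph := continuousOn_oscPhase hA β
  have hph' := fun y hy => hasDerivAt_oscPhase hA β (y := y) hy
  have hphc : ContinuousOn (fun y => g y + β * (l y - 1 / y)) (Ioc 0 1) :=
    hgc.add (continuousOn_const.mul (hlc.sub hinv))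
  set G : ℝ → ℝ := fun y => g y - g (y + x) with hG
  set D : ℝ → ℝ := fun y => G y * (y * (y + x)) with hD
  set D' : ℝ → ℝ := fun y => (derivIoc g y - derivIoc g (y + x)) * (y * (y + x)) +
    G y * (1 * (y + x) + y * 1) with hD'
  have hGc : ContinuousOn G (Icc e b) := (hgc.mono hs').sub (hshift hgc)
  have hyy : ContinuousOn (fun y : ℝ => y * (y + x)) (Icc e b) := by fun_prop
  have hDc : ContinuousOn D (Icc e b) := hGc.mul hyy
  have hD'c : ContinuousOn D' (Icc e b) :=
    (((hg1c.mono hs').sub (hshift hg1c)).mul hyy).add (hGc.mul (by fun_prop))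
  have hdg : ∀ t ∈ Ioo (0 : ℝ) 1, HasDerivAt g (derivIoc g t) t :=
    fun t ht => hasDerivAt_derivIoc hg1 le_rfl ht
  have hdD : ∀ y ∈ Ioo e b, HasDerivAt D (D' y) y := by
    intro y hy
    have d1 := hdg y (hs (Ioo_subset_Icc_self hy))
    have d2 := HasDerivAt.comp_add_const y x (hdg (y + x) (hsx' y hy))
    exact (d1.sub d2).mul ((hasDerivAt_id y).mul ((hasDerivAt_id y).add_const x))
  have hgpos : ∀ y ∈ Icc e b, 0 < g y := fun y hy => h.pos y (hs' hy)
  have hDlow : ∀ y ∈ Icc e b, x * (y * g y) ≤ C * D y := fun y hy =>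
    h.mul_le_of_shift hx ⟨(hs hy).1, hy.2.trans hba⟩ (hsx hy).2
  have hDpos : ∀ y ∈ Icc e b, 0 < D y := fun y hy => by
    have h1 := hDlow y hy
    have h2 : 0 < x * (y * g y) := mul_pos hx (mul_pos (hs hy).1 (hgpos y hy))
    exact pos_of_mul_pos_right (h2.trans_le h1) (by linarith)
  have hPle : ∀ y ∈ Icc e b, (D y)⁻¹ ≤ C / x * (1 / (y * g y)) := by
    intro y hy
    have h1 := hDlow y hy
    have h2 : 0 < y * g y := mul_pos (hs hy).1 (hgpos y hy)
    rw [div_mul_div_comm, mul_one, inv_le_comm₀ (hDpos y hy) (by positivity), inv_div,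
      div_le_iff₀ (by linarith)]
    linarith
  have hmc : ContinuousOn (fun y => 1 / y + |l y|) (Ioc 0 1) := hinv.add hlc.abs
  have hQc : ContinuousOn (fun y => 1 / (y * g y)) (Icc e b) :=
    continuousOn_const.div (continuousOn_id.mul (hgc.mono hs'))
      fun y hy => (mul_pos (hs hy).1 (hgpos y hy)).ne'
  have main := norm_integral_mul_exp_le (θ := fun y => oscPhase γ ψ β (y + x) - oscPhase γ ψ β y)
    (θ' := fun y => (g (y + x) + β * (l (y + x) - 1 / (y + x))) - (g y + β * (l y - 1 / y)))
    (G := G) (P := fun y => (D y)⁻¹) (P' := fun y => -D' y / D y ^ 2)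
    (S := fun y => C / x * (4 + |β|) * (1 / (y * g y) * ((1 / y + |l y|) +
      (1 / (y + x) + |l (y + x)|)))) heb
    ((hshift hph).sub (hph.mono hs')) ((hshift hphc).sub (hphc.mono hs'))
    (fun y hy => (HasDerivAt.comp_add_const y x (hph' (y + x) (hsx' y hy))).sub
      (hph' y (hs (Ioo_subset_Icc_self hy)))) hGc
    (hDc.inv₀ fun y hy => (hDpos y hy).ne')
    (hD'c.neg.div (hDc.pow 2) fun y hy => (pow_pos (hDpos y hy) 2).ne')
    (fun y hy => (hdD y hy).inv (hDpos y (Ioo_subset_Icc_self hy)).ne')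
    (continuousOn_const.mul (hQc.mul ((hmc.mono hs').add (hshift hmc))))
    (fun y hy => (inv_pos.2 (hDpos y hy)).le)
    (fun y hy => by
      have hy0 := (hs hy).1
      have hyx0 : 0 < y + x := by linarith
      have hDy := hDpos y hy
      have hP := hPle y hy
      have hP0 : 0 < (D y)⁻¹ := inv_pos.2 hDy
      have hGy : 0 < G y := by
        have : 0 < y * (y + x) := by positivity
        exact pos_of_mul_pos_left hDy this.le
      have hdm : derivIoc g y ≤ derivIoc g (y + x) :=
        h.deriv_mono (hs' hy) (hsx hy) (by linarith)
      have hD'le : D' y ≤ 2 / y * D y := by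
        have e1 : 2 / y * D y = G y * (2 * (y + x)) := by simp only [hD]; field_simp
        rw [e1]
        have h1 : (derivIoc g y - derivIoc g (y + x)) * (y * (y + x)) ≤ 0 :=
          mul_nonpos_of_nonpos_of_nonneg (by linarith) (by positivity)
        have h2 : G y * (1 * (y + x) + y * 1) ≤ G y * (2 * (y + x)) := by gcongr; linarith
        simp only [hD']; linarith
      -- Only the lower bound `P' ≥ -(2 / y) * P` is available; replacing `P'` by `|P'|` costs at
      -- most twice the negative part.
      have h3 : |(-D' y / D y ^ 2)| ≤ -D' y / D y ^ 2 + 4 / y * (D y)⁻¹ := by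
        have h4 : D' y / D y ^ 2 ≤ 2 / y * (D y)⁻¹ := by
          rw [div_le_iff₀ (by positivity)]
          calc _ ≤ 2 / y * D y := hD'le
            _ = _ := by field_simp
        have h5 : 0 ≤ 2 / y * (D y)⁻¹ := by positivity
        rw [neg_div, abs_le]
        constructor
        · have : 4 / y * (D y)⁻¹ = 2 * (2 / y * (D y)⁻¹) := by ring
          linarith
        · have : 4 / y * (D y)⁻¹ = 2 * (2 / y * (D y)⁻¹) := by ring
          linarith
      have h6 : |(g (y + x) + β * (l (y + x) - 1 / (y + x)) - (g y + β * (l y - 1 / y)) + G y)| ≤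
          |β| * ((1 / y + |l y|) + (1 / (y + x) + |l (y + x)|)) := by
        have : (g (y + x) + β * (l (y + x) - 1 / (y + x)) - (g y + β * (l y - 1 / y)) + G y) =
            β * ((l (y + x) - 1 / (y + x)) - (l y - 1 / y)) := by simp only [hG]; ring
        rw [this, abs_mul]
        gcongr
        have q1 := abs_sub (l (y + x) - 1 / (y + x)) (l y - 1 / y)
        have q2 := abs_sub (l (y + x)) (1 / (y + x))
        have q3 := abs_sub (l y) (1 / y)
        rw [abs_of_pos (by positivity : 0 < 1 / (y + x))] at q2
        rw [abs_of_pos (by positivity : 0 < 1 / y)] at q3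
        linarith
      have h7 : 4 / y ≤ 4 * ((1 / y + |l y|) + (1 / (y + x) + |l (y + x)|)) := by
        have : 4 / y = 4 * (1 / y) := by ring
        rw [this]
        have := abs_nonneg (l y)
        have := abs_nonneg (l (y + x))
        have : 0 < 1 / (y + x) := by positivity
        gcongr
        linarith
      set m := (1 / y + |l y|) + (1 / (y + x) + |l (y + x)|)
      have hm : 0 ≤ m := by positivity
      have hβ := abs_nonneg β
      calc _ ≤ (-D' y / D y ^ 2 + 4 * m * (D y)⁻¹) + (D y)⁻¹ * (|β| * m) := by
            gcongr
            exact h3.trans (by gcongr)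
        _ = -D' y / D y ^ 2 + (4 + |β|) * m * (D y)⁻¹ := by ring
        _ ≤ -D' y / D y ^ 2 + (4 + |β|) * m * (C / x * (1 / (y * g y))) := by gcongr
        _ = _ := by ring)
  have hcongr : ∫ y in e..b, (((y * (y + x))⁻¹ : ℝ) : ℂ) *
        Complex.exp (Complex.I * ((oscPhase γ ψ β (y + x) - oscPhase γ ψ β y : ℝ) : ℂ)) =
      ∫ y in e..b, ((G y * (D y)⁻¹ : ℝ) : ℂ) *
        Complex.exp (Complex.I * ((oscPhase γ ψ β (y + x) - oscPhase γ ψ β y : ℝ) : ℂ)) := by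
    apply intervalIntegral.integral_congr
    intro y hy
    rw [uIcc_of_le heb] at hy
    have hGy : G y ≠ 0 := fun h0 => (hDpos y hy).ne' (by simp [hD, h0])
    have : (y * (y + x))⁻¹ = G y * (D y)⁻¹ := by
      simp only [hD]; rw [mul_inv (G y), mul_inv_cancel_left₀ hGy]
    simp only [this]
  rw [hcongr]
  refine main.trans ?_
  have := hPle b (right_mem_Icc.2 heb)
  gcongr

/-! ### Decay of the autocorrelation -/

/-- The autocorrelation `x ↦ ∫ K(y + x) * conj (K y) dy`. -/
noncomputable def kernelCorr (K : ℝ → ℂ) (x : ℝ) : ℂ := ∫ y, K (y + x) * starRingEnd ℂ (K y)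

/-- The integrand of the autocorrelation of the oscillatory kernel. -/
noncomputable def corrIntegrand (γ ψ : ℝ → ℝ) (β x y : ℝ) : ℂ :=
  (((y * (y + x))⁻¹ : ℝ) : ℂ) *
    Complex.exp (Complex.I * ((oscPhase γ ψ β (y + x) - oscPhase γ ψ β y : ℝ) : ℂ))

lemma kernelCorr_oscKernel {γ ψ : ℝ → ℝ} (hψ : ∀ t ∈ Ioc (0 : ℝ) 1, 0 < ψ t) {ε : ℝ} (hε : 0 < ε)
    (β : ℝ) {x : ℝ} (hx : 0 < x) :
    kernelCorr (oscKernel γ ψ ε β) x = ∫ y in Icc ε (1 - x), corrIntegrand γ ψ β x y := by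
  rw [← integral_indicator measurableSet_Icc]
  unfold kernelCorr
  congr 1
  ext y
  rw [oscKernel_eq_indicator hψ hε]
  by_cases hy : y ∈ Icc ε (1 - x)
  · rw [indicator_of_mem hy, indicator_of_mem (show y + x ∈ Icc ε 1 from ⟨by linarith [hy.1],
      by linarith [hy.2]⟩), indicator_of_mem (show y ∈ Icc ε 1 from ⟨hy.1, by linarith [hy.2]⟩)]
    unfold corrIntegrand
    rw [map_mul, Complex.conj_ofReal, ← Complex.exp_conj, map_mul, Complex.conj_I,
      Complex.conj_ofReal, mul_mul_mul_comm, ← Complex.exp_add, mul_inv_rev]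
    push_cast
    congr 2
    ring
  · rw [indicator_of_notMem hy]
    by_cases h1 : y ∈ Icc ε 1
    · rw [indicator_of_notMem (show y + x ∉ Icc ε 1 from fun h2 => hy ⟨h1.1, by linarith [h2.2]⟩),
        zero_mul]
    · rw [indicator_of_notMem h1, map_zero, mul_zero]

lemma continuousOn_corrIntegrand {γ ψ : ℝ → ℝ} (hA : PhaseAssumptions γ ψ) (β : ℝ) {x : ℝ}
    (hx : 0 < x) : ContinuousOn (corrIntegrand γ ψ β x) (Ioc 0 (1 - x)) := by
  have hph := continuousOn_oscPhase hA β
  have h1 : ContinuousOn (fun y => oscPhase γ ψ β (y + x) - oscPhase γ ψ β y) (Ioc 0 (1 - x)) :=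
    (hph.comp (by fun_prop) fun y hy => ⟨by linarith [hy.1], by linarith [hy.2]⟩).sub
      (hph.mono fun y hy => ⟨hy.1, by linarith [hy.2]⟩)
  have h2 : ContinuousOn (fun y : ℝ => (y * (y + x))⁻¹) (Ioc 0 (1 - x)) :=
    ContinuousOn.inv₀ (by fun_prop) fun y hy => (mul_pos hy.1 (by linarith [hy.1])).ne'
  exact (Complex.continuous_ofReal.comp_continuousOn h2).mul
    (Complex.continuous_exp.comp_continuousOn
      (continuousOn_const.mul (Complex.continuous_ofReal.comp_continuousOn h1)))

lemma norm_integral_corrIntegrand_le_inv (γ ψ : ℝ → ℝ) (β : ℝ) {x b c : ℝ} (hx : 0 < x)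
    (hb : 0 < b) (hbc : b ≤ c) : ‖∫ y in b..c, corrIntegrand γ ψ β x y‖ ≤ 1 / b := by
  have hz0 : ∀ y ∈ Icc b c, y ≠ 0 := fun y hy => (hb.trans_le hy.1).ne'
  have hcont : ContinuousOn (fun y : ℝ => (y ^ 2)⁻¹) (Icc b c) :=
    (continuousOn_id.pow 2).inv₀ fun y hy => pow_ne_zero 2 (hz0 y hy)
  refine (intervalIntegral.norm_integral_le_of_norm_le hbc
    (Filter.Eventually.of_forall fun y hy => ?_) (hcont.intervalIntegrable_of_Icc hbc)).trans
    ((integral_le_sub_of_hasDerivAt (F := fun z => -z⁻¹) (F' := fun z => -(-(z ^ 2)⁻¹)) hbc hcont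
      ((continuousOn_id.inv₀ hz0).neg)
      (fun z hz => (hasDerivAt_inv (hz0 z (Ioo_subset_Icc_self hz))).neg)
      (fun z hz => by rw [neg_neg])).trans ?_)
  · have hy0 : 0 < y := hb.trans hy.1
    unfold corrIntegrand
    rw [norm_mul, mul_comm Complex.I, Complex.norm_exp_ofReal_mul_I, mul_one, Complex.norm_real,
      Real.norm_of_nonneg (by positivity)]
    gcongr
    nlinarith
  · have : 0 < c⁻¹ := inv_pos.2 (by linarith)
    rw [one_div]
    linarith

/-- Oscillation is used only below `b`; above it the integrand is at most `y⁻²`. The variable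
endpoint `c` is needed because the domain may end at `1 - x` before reaching `b`. -/
lemma norm_kernelCorr_le {γ ψ : ℝ → ℝ} (hA : PhaseAssumptions γ ψ) {ε : ℝ} (hε : 0 < ε) (β : ℝ)
    {x b X : ℝ} (hx : 0 < x) (hb : 0 < b) (hX : 0 ≤ X)
    (h : ∀ c ∈ Icc ε b, c ≤ 1 - x → ‖∫ y in ε..c, corrIntegrand γ ψ β x y‖ ≤ X) :
    ‖kernelCorr (oscKernel γ ψ ε β) x‖ ≤ 1 / b + X := by
  have hb' : 0 < 1 / b := by positivity
  rw [kernelCorr_oscKernel hA.psi_pos hε β hx]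
  rcases lt_or_ge (1 - x) ε with h1 | h1
  · rw [Icc_eq_empty (not_le.2 h1), setIntegral_empty, norm_zero]; positivity
  rw [integral_Icc_eq_integral_Ioc, ← intervalIntegral.integral_of_le h1]
  rcases lt_or_ge b ε with h2 | h2
  · have := norm_integral_corrIntegrand_le_inv γ ψ β hx hε h1
    have : 1 / ε ≤ 1 / b := one_div_le_one_div_of_le hb h2.le
    linarith
  rcases le_total (1 - x) b with h3 | h3
  · have := h (1 - x) ⟨h1, h3⟩ le_rfl
    linarith
  · have hint : ∀ u v, ε ≤ u → u ≤ v → v ≤ 1 - x →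
        IntervalIntegrable (corrIntegrand γ ψ β x) volume u v := fun u v hu huv hv =>
      ((continuousOn_corrIntegrand hA β hx).mono fun y hy =>
        ⟨by linarith [hy.1], by linarith [hy.2]⟩).intervalIntegrable_of_Icc huv
    rw [← intervalIntegral.integral_add_adjacent_intervals (hint ε b le_rfl h2 h3)
      (hint b _ h2 h3 le_rfl), add_comm]
    exact (norm_add_le _ _).trans
      (add_le_add (norm_integral_corrIntegrand_le_inv γ ψ β hx hb h3) (h b ⟨h2, le_rfl⟩ h3))

section

variable {γ ψ : ℝ → ℝ} {a κ C : ℝ}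

lemma PhaseProfile.small_scale_mono {g l : ℝ → ℝ} (h : PhaseProfile g l a κ C) {e b ρ : ℝ}
    (he : 0 < e) (heb : e ≤ b) (hb : b ≤ ρ) (hρ : ρ ≤ a) :
    ∫ z in e..b, (1 / z + |l z|) / (z * g z) ≤ C / (ρ * g ρ) := by
  refine le_trans ?_ (h.small_scale e ρ he (heb.trans hb) hρ)
  have hs : Icc e ρ ⊆ Ioc 0 1 := fun z hz => ⟨he.trans_le hz.1, by linarith [hz.2, h.a_le_half]⟩
  apply intervalIntegral.integral_mono_interval le_rfl heb hb
  · refine (ae_restrict_mem measurableSet_Ioc).mono fun z hz => ?_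
    have hz' := hs (Ioc_subset_Icc_self hz)
    have := h.pos z hz'
    have := hz'.1
    show 0 ≤ (1 / z + |l z|) / (z * g z)
    positivity
  · apply ContinuousOn.intervalIntegrable_of_Icc (heb.trans hb)
    exact ((continuousOn_const.div continuousOn_id fun z hz => (hs hz).1.ne').add
      (h.cont_l.mono hs).abs).div (continuousOn_id.mul (h.contDiff.continuousOn.mono hs))
      fun z hz => (mul_pos (hs hz).1 (h.pos z (hs hz))).ne'

/-- The error term produced by integration by parts in the autocorrelation. -/
lemma norm_integral_corrIntegrand_le (hA : PhaseAssumptions γ ψ)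
    (h : PhaseProfile (derivIoc γ) (fun t => derivIoc ψ t / ψ t) a κ C) (β : ℝ) {x e b V : ℝ}
    (hx : 0 < x) (he : 0 < e) (heb : e ≤ b) (hba : b ≤ a) (hbx : b + x ≤ 1)
    (h1 : 1 / (b * derivIoc γ b) ≤ V)
    (h2 : ∫ y in e..b, (1 / y + |derivIoc ψ y / ψ y|) / (y * derivIoc γ y) ≤ V)
    (h3 : ∫ y in e..b, (1 / (y + x) + |derivIoc ψ (y + x) / ψ (y + x)|) / (y * derivIoc γ y) ≤ V) :
    ‖∫ y in e..b, corrIntegrand γ ψ β x y‖ ≤ 10 * (1 + |β|) * (C / x) * V := by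
  set g := derivIoc γ with hgdef
  set l := fun t => derivIoc ψ t / ψ t with hldef
  have ha1 := h.a_le_half
  have hC := h.one_le_C
  have hs : Icc e b ⊆ Ioc 0 1 := fun y hy => ⟨he.trans_le hy.1, by linarith [hy.2]⟩
  have hsx : MapsTo (fun y => y + x) (Icc e b) (Ioc 0 1) := fun y hy =>
    ⟨by linarith [(hs hy).1], by simp only; linarith [hy.2]⟩
  have hmc : ContinuousOn (fun y => 1 / y + |l y|) (Ioc 0 1) :=
    (continuousOn_const.div continuousOn_id fun y hy => hy.1.ne').add h.cont_l.abs
  have hden : ContinuousOn (fun y => y * g y) (Icc e b) :=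
    continuousOn_id.mul (h.contDiff.continuousOn.mono hs)
  have hden0 : ∀ y ∈ Icc e b, y * g y ≠ 0 := fun y hy =>
    (mul_pos (hs hy).1 (h.pos y (hs hy))).ne'
  have c1 : ContinuousOn (fun y => (1 / y + |l y|) / (y * g y)) (Icc e b) :=
    (hmc.mono hs).div hden hden0
  have c2 : ContinuousOn (fun y => (1 / (y + x) + |l (y + x)|) / (y * g y)) (Icc e b) :=
    (hmc.comp (by fun_prop) hsx).div hden hden0
  have main := norm_integral_corr_le hA h β hx he heb hba hbx
  have e1 : ∫ y in e..b, C / x * (4 + |β|) * (1 / (y * g y) * ((1 / y + |l y|) +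
      (1 / (y + x) + |l (y + x)|))) = C / x * (4 + |β|) *
      ((∫ y in e..b, (1 / y + |l y|) / (y * g y)) +
        ∫ y in e..b, (1 / (y + x) + |l (y + x)|) / (y * g y)) := by
    rw [← intervalIntegral.integral_add (c1.intervalIntegrable_of_Icc heb)
      (c2.intervalIntegrable_of_Icc heb), ← intervalIntegral.integral_const_mul]
    congr 1; ext y; ring
  refine main.trans ?_
  change 2 * (C / x * (1 / (b * g b))) + (∫ y in e..b, C / x * (4 + |β|) * (1 / (y * g y) *
    ((1 / y + |l y|) + (1 / (y + x) + |l (y + x)|)))) ≤ _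
  rw [e1]
  have hβ := abs_nonneg β
  have hCx : 0 ≤ C / x := by positivity
  have hV : 0 ≤ V := le_trans (by
    have := h.pos b (hs (right_mem_Icc.2 heb))
    have := (hs (right_mem_Icc.2 heb)).1
    positivity) h1
  calc _ ≤ 2 * (C / x * V) + C / x * (4 + |β|) * (V + V) := by gcongr
    _ = (10 + 2 * |β|) * (C / x) * V := by ring
    _ ≤ _ := by gcongr; linarith

/-- The integral is cut at `b = ρ / 2`, so that `y + x ≤ ρ` throughout. As `y * g y` is decreasing
up to the constant `C`, the terms in `y + x` reduce by translation to the small-scale integral. -/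
lemma norm_kernelCorr_oscKernel_le_inv (hA : PhaseAssumptions γ ψ)
    (h : PhaseProfile (derivIoc γ) (fun t => derivIoc ψ t / ψ t) a κ C) {ε : ℝ} (hε : 0 < ε) (β : ℝ)
    {x ρ : ℝ} (hx : 0 < x) (hρa : ρ ≤ a) (hxρ : x ≤ ρ / 2) :
    ‖kernelCorr (oscKernel γ ψ ε β) x‖ ≤
      2 / ρ + 20 * C ^ 3 * (1 + |β|) / (x * (ρ * derivIoc γ ρ)) := by
  have hρ : 0 < ρ := by linarith
  have ha1 := h.a_le_half
  have hC := h.one_le_C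
  have hC0 : 0 < C := by linarith
  set g := derivIoc γ with hgdef
  set l := fun t => derivIoc ψ t / ψ t with hldef
  have hgρ : 0 < g ρ := h.pos ρ ⟨hρ, by linarith⟩
  have hβ := abs_nonneg β
  have e1 : 2 / ρ = 1 / (ρ / 2) := by field_simp
  rw [e1]
  apply norm_kernelCorr_le hA hε β hx (by positivity) (by positivity)
  intro c hc hcx
  have hc0 : 0 < c := hε.trans_le hc.1
  have hs : Icc ε c ⊆ Ioc 0 1 := fun y hy => ⟨hε.trans_le hy.1, by linarith [hy.2, hc.2]⟩
  have hQ : ∀ y ∈ Ioc (0 : ℝ) ρ, ∀ z ∈ Icc y ρ, 1 / (y * g y) ≤ C / (z * g z) := by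
    intro y hy z hz
    have hz0 := hy.1.trans_le hz.1
    have hgy := h.pos y ⟨hy.1, by linarith [hy.2]⟩
    have hgz := h.pos z ⟨hz0, by linarith [hz.2]⟩
    have hy0 := hy.1
    have hθ : y / z ∈ Ioc (0 : ℝ) 1 := ⟨by positivity, (div_le_one hz0).2 hz.1⟩
    have h1 := h.growth z ⟨hz0, hz.2.trans hρa⟩ (y / z) hθ
    rw [div_mul_cancel₀ _ hz0.ne'] at h1
    have h2 : z / y ≤ (y / z) ^ (-(1 / κ)) := by
      have := Real.rpow_le_rpow_of_exponent_ge hθ.1 hθ.2 (show -(1 / κ) ≤ -1 by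
        have := one_lt_one_div h.κ_pos h.κ_lt_one
        linarith)
      rwa [Real.rpow_neg_one, inv_div] at this
    rw [div_le_div_iff₀ (by positivity) (by positivity)]
    calc 1 * (z * g z) = (z / y * g z) * y := by field_simp
      _ ≤ ((y / z) ^ (-(1 / κ)) * g z) * y := by gcongr
      _ ≤ (C * g y) * y := by gcongr
      _ = _ := by ring
  have hmc : ContinuousOn (fun y => 1 / y + |l y|) (Ioc 0 1) :=
    (continuousOn_const.div continuousOn_id fun y hy => hy.1.ne').add h.cont_l.abs
  have hden : ContinuousOn (fun y => y * g y) (Ioc 0 1) := continuousOn_id.mul h.contDiff.continuousOn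
  have hden0 : ∀ y ∈ Ioc (0 : ℝ) 1, y * g y ≠ 0 := fun y hy => (mul_pos hy.1 (h.pos y hy)).ne'
  have hsx : MapsTo (fun y => y + x) (Icc ε c) (Ioc 0 1) := fun y hy =>
    ⟨by linarith [(hs hy).1], by simp only; linarith [hy.2]⟩
  have hCC : C ≤ C ^ 2 := by nlinarith
  refine (norm_integral_corrIntegrand_le hA h β (V := C ^ 2 / (ρ * g ρ)) hx hε hc.1
    (by linarith [hc.2]) (by linarith) ?_ ?_ ?_).trans ?_
  · refine (hQ c ⟨hc0, by linarith [hc.2]⟩ ρ ⟨by linarith [hc.2], le_rfl⟩).trans ?_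
    gcongr
  · refine (h.small_scale_mono hε hc.1 (by linarith [hc.2]) hρa).trans ?_
    gcongr
  · calc ∫ y in ε..c, (1 / (y + x) + |l (y + x)|) / (y * g y)
        ≤ ∫ y in ε..c, C * ((1 / (y + x) + |l (y + x)|) / ((y + x) * g (y + x))) := by
          apply intervalIntegral.integral_mono_on hc.1
          · exact ((hmc.comp (by fun_prop) hsx).div (hden.mono hs)
              fun y hy => hden0 y (hs hy)).intervalIntegrable_of_Icc hc.1
          · exact (continuousOn_const.mul ((hmc.div hden hden0).comp (by fun_prop)
              hsx)).intervalIntegrable_of_Icc hc.1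
          · intro y hy
            have h4 := hQ y ⟨(hs hy).1, by linarith [hy.2, hc.2]⟩ (y + x)
              ⟨by linarith, by linarith [hy.2, hc.2]⟩
            have : 0 < y + x := (hsx hy).1
            calc _ = (1 / (y + x) + |l (y + x)|) * (1 / (y * g y)) := by ring
              _ ≤ (1 / (y + x) + |l (y + x)|) * (C / ((y + x) * g (y + x))) := by gcongr
              _ = _ := by ring
      _ = C * ∫ y in (ε + x)..(c + x), (1 / y + |l y|) / (y * g y) := by
          rw [intervalIntegral.integral_const_mul,
            intervalIntegral.integral_comp_add_right (fun y => (1 / y + |l y|) / (y * g y))]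
      _ ≤ C * (C / (ρ * g ρ)) := by
          gcongr
          exact h.small_scale_mono (by linarith) (by linarith [hc.1]) (by linarith [hc.2]) hρa
      _ = _ := by ring
  · have : 10 * (1 + |β|) * (C / x) * (C ^ 2 / (ρ * g ρ)) =
        10 * C ^ 3 * (1 + |β|) / (x * (ρ * g ρ)) := by field_simp
    rw [this]
    gcongr
    norm_num

/-- Decay of the autocorrelation at scale `ρ`. -/
lemma norm_kernelCorr_oscKernel_le_rpow (hA : PhaseAssumptions γ ψ)
    (h : PhaseProfile (derivIoc γ) (fun t => derivIoc ψ t / ψ t) a κ C) {ε : ℝ} (hε : 0 < ε) (β : ℝ)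
    {x ρ : ℝ} (hx : 0 < x) (hρa : ρ ≤ a) (hxρ : x ≤ ρ / 2) :
    ‖kernelCorr (oscKernel γ ψ ε β) x‖ ≤
      22 * C ^ 4 * (1 + |β|) / ρ * (1 + (x * derivIoc γ ρ) ^ (-κ)) := by
  have hρ : 0 < ρ := by linarith
  have ha1 := h.a_le_half
  have hC := h.one_le_C
  have hC0 : 0 < C := by linarith
  have hκ := h.κ_pos
  set g := derivIoc γ with hgdef
  have hgρ : 0 < g ρ := h.pos ρ ⟨hρ, by linarith⟩
  have hβ := abs_nonneg β
  -- At a scale `s` where `x * g s` is bounded below, both terms of the previous estimate are of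
  -- order `1 / s`.
  have key : ∀ s ∈ Ioc 0 ρ, x ≤ s / 2 → 1 ≤ C * (x * g s) →
      ‖kernelCorr (oscKernel γ ψ ε β) x‖ ≤ 22 * C ^ 4 * (1 + |β|) / s := by
    intro s hs hxs hCs
    have hs0 := hs.1
    have hgs : 0 < g s := h.pos s ⟨hs0, by linarith [hs.2]⟩
    refine (norm_kernelCorr_oscKernel_le_inv hA h hε β hx (hs.2.trans hρa) hxs).trans ?_
    change 2 / s + 20 * C ^ 3 * (1 + |β|) / (x * (s * g s)) ≤ _
    have h1 : 20 * C ^ 3 * (1 + |β|) / (x * (s * g s)) ≤ 20 * C ^ 4 * (1 + |β|) / s := by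
      rw [div_le_div_iff₀ (by positivity) hs0]
      calc _ = 20 * C ^ 3 * (1 + |β|) * s * 1 := by ring
        _ ≤ 20 * C ^ 3 * (1 + |β|) * s * (C * (x * g s)) := by gcongr
        _ = _ := by ring
    have h2 : 2 / s ≤ 2 * C ^ 4 * (1 + |β|) / s := by
      gcongr
      have : 1 ≤ C ^ 4 := one_le_pow₀ hC
      nlinarith
    calc _ ≤ 2 * C ^ 4 * (1 + |β|) / s + 20 * C ^ 4 * (1 + |β|) / s := by gcongr
      _ = _ := by ring
  have hpos : 0 < x * g ρ := by positivity
  have hrp := Real.rpow_pos_of_pos hpos (-κ)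
  rcases le_or_gt 1 (x * g ρ) with h1 | h1
  · refine (key ρ ⟨hρ, le_rfl⟩ hxρ (by nlinarith)).trans ?_
    exact le_mul_of_one_le_right (by positivity) (by linarith)
  -- Here `ρ` is too coarse a scale. By growth, `θ * ρ` with this `θ` is fine enough for `C * x * g
  -- (θ * ρ) ≥ 1`, and `1 / (θ * ρ)` produces the power `-κ`. The requirement `x ≤ θ * ρ / 2`
  -- follows from `ρ * g ρ ≥ 8` and `κ < 1`.
  · set θ := (x * g ρ) ^ κ with hθ
    have hθ0 : 0 < θ := Real.rpow_pos_of_pos hpos _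
    have hθ1 : θ ≤ 1 := Real.rpow_le_one hpos.le h1.le hκ.le
    have hgrow := h.growth ρ ⟨hρ, hρa⟩ θ ⟨hθ0, hθ1⟩
    have e1 : θ ^ (-(1 / κ)) = (x * g ρ)⁻¹ := by
      rw [hθ, ← Real.rpow_mul hpos.le, show κ * -(1 / κ) = -1 by field_simp, Real.rpow_neg_one]
    rw [e1] at hgrow
    have h2 : 1 ≤ C * (x * g (θ * ρ)) := by
      calc 1 = x * ((x * g ρ)⁻¹ * g ρ) := by field_simp
        _ ≤ x * (C * g (θ * ρ)) := by gcongr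
        _ = _ := by ring
    have h3 : x ≤ θ * ρ / 2 := by
      have h4 : x * g ρ ≤ θ := by
        simpa using Real.rpow_le_rpow_of_exponent_ge hpos h1.le h.κ_lt_one.le
      have h5 := h.large ρ ⟨hρ, hρa⟩
      have : x * 8 ≤ θ * ρ := by
        calc x * 8 ≤ x * (ρ * g ρ) := by gcongr
          _ = (x * g ρ) * ρ := by ring
          _ ≤ θ * ρ := by gcongr
      linarith
    refine (key (θ * ρ) ⟨by positivity, mul_le_of_le_one_left hρ.le hθ1⟩ h3 h2).trans ?_
    have e2 : (x * g ρ) ^ (-κ) = θ⁻¹ := by rw [Real.rpow_neg hpos.le]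
    rw [e2]
    calc _ = 22 * C ^ 4 * (1 + |β|) / ρ * θ⁻¹ := by field_simp
      _ ≤ _ := by gcongr; linarith

/-- Global decay of the autocorrelation. -/
lemma exists_norm_kernelCorr_oscKernel_le (hA : PhaseAssumptions γ ψ)
    (h : PhaseProfile (derivIoc γ) (fun t => derivIoc ψ t / ψ t) a κ C) :
    ∃ B : ℝ, ∀ ε > 0, ∀ β x : ℝ, 0 < x →
      ‖kernelCorr (oscKernel γ ψ ε β) x‖ ≤ B * (1 + |β|) * x ^ (-κ) := by
  have ha := h.a_pos
  have ha1 := h.a_le_half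
  have hC := h.one_le_C
  have hC0 : 0 < C := by linarith
  have hκ := h.κ_pos
  set g := derivIoc γ with hgdef
  set l := fun t => derivIoc ψ t / ψ t with hldef
  have hga : 0 < g a := h.pos a ⟨ha, by linarith⟩
  have hmc : ContinuousOn (fun y => 1 / y + |l y|) (Ioc 0 1) :=
    (continuousOn_const.div continuousOn_id fun y hy => hy.1.ne').add h.cont_l.abs
  obtain ⟨M, hM⟩ := isCompact_Icc.exists_bound_of_continuousOn
    (hmc.mono fun y (hy : y ∈ Icc (a / 2) 1) => ⟨by linarith [hy.1], hy.2⟩)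
  have hM0 : 0 ≤ M := (norm_nonneg _).trans (hM 1 (right_mem_Icc.2 (by linarith)))
  set B₁ := 22 * C ^ 4 / a * (1 + g a ^ (-κ))
  set B₂ := 2 / a + 10 * (C / (a / 2)) * (C + M)
  have hgaκ := Real.rpow_pos_of_pos hga (-κ)
  refine ⟨max B₁ B₂, fun ε hε β x hx => ?_⟩
  have hβ := abs_nonneg β
  have hB₁ : 0 < B₁ := by positivity
  have hxκ := Real.rpow_pos_of_pos hx (-κ)
  rcases le_or_gt 1 x with hx1 | hx1
  · rw [kernelCorr_oscKernel hA.psi_pos hε β hx, Icc_eq_empty (by linarith), setIntegral_empty,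
      norm_zero]
    have : 0 < max B₁ B₂ := lt_max_of_lt_left hB₁
    positivity
  have hx1κ : 1 ≤ x ^ (-κ) := Real.one_le_rpow_of_pos_of_le_one_of_nonpos hx hx1.le (by linarith)
  rcases le_or_gt x (a / 2) with hxa | hxa
  · refine (norm_kernelCorr_oscKernel_le_rpow hA h hε β hx le_rfl hxa).trans ?_
    change 22 * C ^ 4 * (1 + |β|) / a * (1 + (x * g a) ^ (-κ)) ≤ _
    rw [Real.mul_rpow hx.le hga.le]
    calc _ ≤ 22 * C ^ 4 * (1 + |β|) / a * (x ^ (-κ) + x ^ (-κ) * g a ^ (-κ)) := by gcongr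
      _ = B₁ * (1 + |β|) * x ^ (-κ) := by simp only [B₁]; ring
      _ ≤ _ := by gcongr; exact le_max_left _ _
  -- For `x > a / 2` the point `y + x` stays in `[a / 2, 1]`, where the logarithmic derivatives are
  -- bounded by compactness.
  · have h1 : ‖kernelCorr (oscKernel γ ψ ε β) x‖ ≤
        1 / (a / 2) + 10 * (1 + |β|) * (C / (a / 2)) * (C + M) := by
      apply norm_kernelCorr_le hA hε β hx (by positivity) (by positivity)
      intro c hc hcx
      have hc0 : 0 < c := hε.trans_le hc.1
      have hca : c ≤ a := by linarith [hc.2]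
      have hs : Icc ε c ⊆ Ioc 0 a := fun y hy => ⟨hε.trans_le hy.1, by linarith [hy.2, hc.2]⟩
      have hQ : ∀ y ∈ Ioc 0 a, 1 / (y * g y) ≤ 1 := fun y hy => by
        have := h.large y hy
        rw [div_le_one (by linarith)]; linarith
      have hs1 : Icc ε c ⊆ Ioc 0 1 := fun y hy => ⟨(hs hy).1, by linarith [(hs hy).2]⟩
      have hsx : MapsTo (fun y => y + x) (Icc ε c) (Icc (a / 2) 1) := fun y hy =>
        ⟨by simp only; linarith [(hs hy).1], by simp only; linarith [hy.2]⟩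
      refine (norm_integral_corrIntegrand_le hA h β (V := C + M) hx hε hc.1 hca (by linarith)
        ?_ ?_ ?_).trans ?_
      · have := hQ c ⟨hc0, hca⟩
        change 1 / (c * g c) ≤ _
        linarith
      · refine (h.small_scale_mono hε hc.1 le_rfl hca).trans ?_
        have := hQ c ⟨hc0, hca⟩
        rw [div_eq_mul_one_div]
        nlinarith
      · calc ∫ y in ε..c, (1 / (y + x) + |l (y + x)|) / (y * g y)
            ≤ ∫ y in ε..c, M := by
              apply intervalIntegral.integral_mono_on hc.1
              · exact ((hmc.comp (by fun_prop) fun y hy => ⟨by linarith [(hsx hy).1],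
                  (hsx hy).2⟩).div (continuousOn_id.mul (h.contDiff.continuousOn.mono hs1))
                  fun y hy => (mul_pos (hs1 hy).1 (h.pos y (hs1 hy))).ne').intervalIntegrable_of_Icc
                  hc.1
              · simp
              · intro y hy
                have h2 := (le_abs_self _).trans (hM (y + x) (hsx hy))
                have h3 := hQ y (hs hy)
                have h4 := (mul_pos (hs1 hy).1 (h.pos y (hs1 hy)))
                calc _ = (1 / (y + x) + |l (y + x)|) * (1 / (y * g y)) := by ring
                  _ ≤ M * 1 := by gcongr
                  _ = M := mul_one M
          _ = (c - ε) * M := by rw [intervalIntegral.integral_const, smul_eq_mul]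
          _ ≤ 1 * M := by gcongr; linarith
          _ ≤ C + M := by linarith
      · gcongr
    refine h1.trans ?_
    calc _ ≤ 2 / a * (1 + |β|) + 10 * (1 + |β|) * (C / (a / 2)) * (C + M) := by
          gcongr
          rw [show 1 / (a / 2) = 2 / a by field_simp]
          have : 0 < 2 / a := by positivity
          nlinarith
      _ = B₂ * (1 + |β|) * 1 := by simp only [B₂]; ring
      _ ≤ max B₁ B₂ * (1 + |β|) * x ^ (-κ) := by gcongr; exact le_max_right _ _

end

/-! ### The Hörmander condition -/

section

variable {γ ψ : ℝ → ℝ} {a κ C : ℝ}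

lemma norm_oscKernel_le (hA : PhaseAssumptions γ ψ) {ε : ℝ} (hε : 0 < ε) (β x : ℝ) {r : ℝ}
    (hr : 0 < r) (hx : r ≤ x) : ‖oscKernel γ ψ ε β x‖ ≤ 1 / r := by
  rw [oscKernel_eq_indicator hA.psi_pos hε]
  by_cases h : x ∈ Icc ε 1
  · rw [indicator_of_mem h, norm_inv_mul_exp, abs_of_pos (hr.trans_le hx), ← one_div]
    gcongr
  · rw [indicator_of_notMem h, norm_zero]
    positivity

/-- The difference is the integral of the derivative along the segment. It is kept as an integral in
`r`, not replaced by a supremum, so that Tonelli later turns it into `t` times the large-scale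
integral. -/
lemma enorm_oscKernel_sub_le (hA : PhaseAssumptions γ ψ)
    (h : PhaseProfile (derivIoc γ) (fun t => derivIoc ψ t / ψ t) a κ C) {ε : ℝ} (hε : 0 < ε) (β : ℝ)
    {z t : ℝ} (ht : 0 ≤ t) (hz : z ∈ Icc ε 1) (hzt : z - t ∈ Icc ε 1) :
    ‖oscKernel γ ψ ε β z - oscKernel γ ψ ε β (z - t)‖ₑ ≤
      ∫⁻ r in Ioc 0 t, ENNReal.ofReal ((1 + |β|) * ((derivIoc γ (z - r) + 1 / (z - r) +
        |derivIoc ψ (z - r) / ψ (z - r)|) / (z - r))) := by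
  set g := derivIoc γ with hgdef
  set l := fun t => derivIoc ψ t / ψ t with hldef
  have hph' := fun y hy => hasDerivAt_oscPhase hA β (y := y) hy
  set E : ℝ → ℂ := fun x => Complex.exp (Complex.I * oscPhase γ ψ β x)
  have hEn : ∀ y, ‖E y‖ = 1 := fun y => by
    simp only [E]; rw [mul_comm, Complex.norm_exp_ofReal_mul_I]
  set k : ℝ → ℂ := fun x => ((x⁻¹ : ℝ) : ℂ) * E x
  set k' : ℝ → ℂ := fun x => ((-(x ^ 2)⁻¹ : ℝ) : ℂ) * E x +
    ((x⁻¹ : ℝ) : ℂ) * (E x * (Complex.I * ((g x + β * (l x - 1 / x) : ℝ) : ℂ)))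
  have ofR : ∀ {f : ℝ → ℝ} {s : Set ℝ}, ContinuousOn f s → ContinuousOn (fun y => (f y : ℂ)) s :=
    fun hf => Complex.continuous_ofReal.comp_continuousOn hf
  have hEc : ContinuousOn E (Ioc 0 1) :=
    Complex.continuous_exp.comp_continuousOn
      (continuousOn_const.mul (ofR (continuousOn_oscPhase hA β)))
  have hic : ContinuousOn (fun x : ℝ => x⁻¹) (Ioc 0 1) :=
    continuousOn_id.inv₀ fun x hx => hx.1.ne'
  have hkc : ContinuousOn k (Ioc 0 1) := (ofR hic).mul hEc
  have hk'c : ContinuousOn k' (Ioc 0 1) :=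
    ((ofR (((continuousOn_id.pow 2).inv₀ fun x hx => (pow_pos hx.1 2).ne').neg)).mul hEc).add
      ((ofR hic).mul (hEc.mul (continuousOn_const.mul (ofR (h.contDiff.continuousOn.add
        (continuousOn_const.mul (h.cont_l.sub
          (continuousOn_const.div continuousOn_id fun x hx => hx.1.ne'))))))))
  have hk' : ∀ y ∈ Ioo (0 : ℝ) 1, HasDerivAt k (k' y) y := fun y hy =>
    (hasDerivAt_inv hy.1.ne').ofReal_comp.mul
      (((hph' y hy).ofReal_comp.const_mul Complex.I).cexp)
  have hmap : MapsTo (fun r => z - r) (Icc 0 t) (Ioc 0 1) := fun r hr =>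
    ⟨by simp only; linarith [hr.2, hzt.1], by simp only; linarith [hr.1, hz.2]⟩
  have hsubc : ContinuousOn (fun r => z - r) (Icc 0 t) := by fun_prop
  have hFTC : ∫ r in (0 : ℝ)..t, k' (z - r) = k z - k (z - t) := by
    have := intervalIntegral.integral_eq_sub_of_hasDerivAt_of_le (f := fun r => -k (z - r))
      (f' := fun r => k' (z - r)) ht ((hkc.comp hsubc hmap).neg)
      (fun r hr => by
        have h1 := HasDerivAt.comp_const_sub z r (hk' (z - r)
          ⟨by linarith [hr.2, hzt.1], by linarith [hr.1, hz.2]⟩)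
        have h2 := h1.neg
        rw [neg_neg] at h2
        exact h2) ((hk'c.comp hsubc hmap).intervalIntegrable_of_Icc ht)
    rw [this]; simp only [sub_zero]; ring
  rw [oscKernel_eq_indicator hA.psi_pos hε, indicator_of_mem hz, indicator_of_mem hzt]
  change ‖k z - k (z - t)‖ₑ ≤ _
  rw [← hFTC, intervalIntegral.integral_of_le ht]
  refine (enorm_integral_le_lintegral_enorm _).trans (setLIntegral_mono' measurableSet_Ioc ?_)
  intro r hr
  have hy := hmap (Ioc_subset_Icc_self hr)
  change z - r ∈ Ioc (0 : ℝ) 1 at hy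
  generalize z - r = y at hy
  have hy0 := hy.1
  have hgy := h.pos y hy
  rw [← ofReal_norm]
  apply ENNReal.ofReal_le_ofReal
  have hβ := abs_nonneg β
  have hl0 := abs_nonneg (l y)
  have h1 : |g y + β * (l y - 1 / y)| ≤ g y + |β| * (|l y| + 1 / y) := by
    refine (abs_add_le _ _).trans ?_
    rw [abs_of_pos hgy, abs_mul]
    gcongr
    refine (abs_sub _ _).trans ?_
    rw [abs_of_pos (by positivity : 0 < 1 / y)]
  calc ‖k' y‖ ≤ (y ^ 2)⁻¹ + y⁻¹ * |g y + β * (l y - 1 / y)| := by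
        refine (norm_add_le _ _).trans ?_
        rw [norm_mul, norm_mul, norm_mul, norm_mul, hEn, Complex.norm_I, Complex.norm_real,
          Complex.norm_real, Complex.norm_real, norm_neg, Real.norm_of_nonneg (by positivity),
          Real.norm_of_nonneg (by positivity), Real.norm_eq_abs, mul_one, one_mul, one_mul]
    _ ≤ (y ^ 2)⁻¹ + y⁻¹ * (g y + |β| * (|l y| + 1 / y)) := by gcongr
    _ = (g y + 1 / y + |β| * (|l y| + 1 / y)) / y := by field_simp; ring
    _ ≤ ((1 + |β|) * (g y + 1 / y + |l y|)) / y := by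
        gcongr
        nlinarith
    _ = _ := by rw [mul_div_assoc]

/-- The Hörmander condition for the oscillatory kernel at scale `ρ`. -/
lemma lintegral_oscKernel_sub_le (hA : PhaseAssumptions γ ψ)
    (h : PhaseProfile (derivIoc γ) (fun t => derivIoc ψ t / ψ t) a κ C) {ε : ℝ} (hε : 0 < ε) (β : ℝ)
    {ρ t : ℝ} (hρ : ρ ∈ Ioc 0 a) (ht : 0 ≤ t) (htρ : t * derivIoc γ ρ ≤ 1) :
    ∫⁻ z in {z | 2 * ρ ≤ |z|}, ‖oscKernel γ ψ ε β z - oscKernel γ ψ ε β (z - t)‖ₑ ≤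
      ENNReal.ofReal ((1 + C) * (1 + |β|)) := by
  have ha1 := h.a_le_half
  have hC := h.one_le_C
  have hρ0 := hρ.1
  set g := derivIoc γ with hgdef
  set l := fun t => derivIoc ψ t / ψ t with hldef
  have hgρ : 0 < g ρ := h.pos ρ ⟨hρ0, by linarith [hρ.2]⟩
  have htρ' : t ≤ ρ / 8 := by
    have := h.large ρ hρ
    by_contra! hlt
    have : ρ / 8 * g ρ < t * g ρ := by gcongr
    linarith
  have hβ := abs_nonneg β
  set w : ℝ → ℝ := fun s => (1 + |β|) * ((g s + 1 / s + |l s|) / s) with hw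
  have hs : Icc ρ 1 ⊆ Ioc 0 1 := fun s hs => ⟨hρ0.trans_le hs.1, hs.2⟩
  have hw1 : ContinuousOn (fun s => (g s + 1 / s + |l s|) / s) (Icc ρ 1) := by
    have h0 : ∀ s ∈ Icc ρ 1, s ≠ 0 := fun s h1 => (hs h1).1.ne'
    exact (((h.contDiff.continuousOn.mono hs).add (continuousOn_const.div continuousOn_id h0)).add
      (h.cont_l.mono hs).abs).div continuousOn_id h0
  have hwc : ContinuousOn w (Icc ρ 1) := continuousOn_const.mul hw1
  have hw0 : ∀ s ∈ Icc ρ 1, 0 ≤ w s := fun s h1 => by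
    have := (hs h1).1
    have := h.pos s (hs h1)
    positivity
  set W : ℝ → ENNReal := (Icc ρ 1).indicator fun s => ENNReal.ofReal (w s) with hW
  have hWm : Measurable W := by
    rw [hW, ← piecewise_eq_indicator]
    exact (ENNReal.continuous_ofReal.comp_continuousOn hwc).measurable_piecewise
      continuousOn_const measurableSet_Icc
  have hWint : ∫⁻ s, W s ≤ ENNReal.ofReal ((1 + |β|) * (C * g ρ)) := by
    rw [hW, lintegral_indicator measurableSet_Icc,
      ← ofReal_integral_eq_lintegral_ofReal hwc.integrableOn_Icc
        ((ae_restrict_mem measurableSet_Icc).mono hw0)]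
    apply ENNReal.ofReal_le_ofReal
    rw [integral_Icc_eq_integral_Ioc, ← intervalIntegral.integral_of_le (by linarith [hρ.2]),
      intervalIntegral.integral_const_mul]
    gcongr
    exact h.large_scale ρ hρ
  -- If exactly one of `z` and `z - t` lies in `[ε, 1]`, then `z` is within `t` of `1` or of `ε`,
  -- and the surviving value is at most `1 / ρ`; since `t ≤ ρ / 8` these end pieces contribute
  -- `O(1)`.
  have hpt : ∀ z ∈ {z | 2 * ρ ≤ |z|}, ‖oscKernel γ ψ ε β z - oscKernel γ ψ ε β (z - t)‖ₑ ≤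
      (Icc 1 (1 + t)).indicator (fun _ => ENNReal.ofReal (1 / ρ)) z +
      (Icc ε (ε + t)).indicator (fun _ => ENNReal.ofReal (1 / ρ)) z +
      ∫⁻ r in Ioc 0 t, W (z - r) := by
    intro z hz
    have hz : 2 * ρ ≤ |z| := hz
    have hKz : ∀ z, z ∉ Icc ε 1 → oscKernel γ ψ ε β z = 0 := fun z hz => by
      rw [oscKernel_eq_indicator hA.psi_pos hε, indicator_of_notMem hz]
    have hKn : ∀ z, ρ ≤ z → ‖oscKernel γ ψ ε β z‖ₑ ≤ ENNReal.ofReal (1 / ρ) := fun z hz => by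
      rw [← ofReal_norm]
      exact ENNReal.ofReal_le_ofReal (norm_oscKernel_le hA hε β z hρ0 hz)
    by_cases h1 : z ∈ Icc ε 1
    · have hz2 : 2 * ρ ≤ z := by rwa [abs_of_pos (hε.trans_le h1.1)] at hz
      by_cases h2 : z - t ∈ Icc ε 1
      · refine le_trans ?_ le_add_self
        refine (enorm_oscKernel_sub_le hA h hε β ht h1 h2).trans ?_
        refine setLIntegral_mono' measurableSet_Ioc fun r hr => ?_
        rw [hW, indicator_of_mem (show z - r ∈ Icc ρ 1 from
          ⟨by linarith [hr.2], by linarith [hr.1, h1.2]⟩)]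
      · rw [hKz _ h2, sub_zero, indicator_of_mem (show z ∈ Icc ε (ε + t) from ⟨h1.1, by
          by_contra! h3
          exact h2 ⟨by linarith, by linarith [h1.2]⟩⟩)]
        exact ((hKn z (by linarith)).trans le_add_self).trans le_self_add
    · rw [hKz _ h1, zero_sub, enorm_neg]
      by_cases h2 : z - t ∈ Icc ε 1
      · have hz0 : 0 < z := by linarith [h2.1]
        rw [abs_of_pos hz0] at hz
        rw [indicator_of_mem (show z ∈ Icc 1 (1 + t) from ⟨by
          by_contra! h3
          exact h1 ⟨by linarith [h2.1], h3.le⟩, by linarith [h2.2]⟩), add_assoc]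
        exact (hKn (z - t) (by linarith)).trans le_self_add
      · rw [hKz _ h2, enorm_zero]
        exact zero_le
  have hvol : ∀ c : ℝ, ∫⁻ z, (Icc c (c + t)).indicator (fun _ => ENNReal.ofReal (1 / ρ)) z ≤
      ENNReal.ofReal (1 / 2) := by
    intro c
    rw [lintegral_indicator measurableSet_Icc, setLIntegral_const, Real.volume_Icc,
      ← ENNReal.ofReal_mul (by positivity)]
    apply ENNReal.ofReal_le_ofReal
    rw [add_sub_cancel_left, one_div, inv_mul_eq_div, div_le_iff₀ hρ0]
    linarith
  calc _ ≤ ∫⁻ z in {z | 2 * ρ ≤ |z|}, ((Icc 1 (1 + t)).indicator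
          (fun _ => ENNReal.ofReal (1 / ρ)) z +
        (Icc ε (ε + t)).indicator (fun _ => ENNReal.ofReal (1 / ρ)) z +
        ∫⁻ r in Ioc 0 t, W (z - r)) :=
        setLIntegral_mono' (measurableSet_le measurable_const measurable_norm) hpt
    _ ≤ ∫⁻ z, ((Icc 1 (1 + t)).indicator (fun _ => ENNReal.ofReal (1 / ρ)) z +
        (Icc ε (ε + t)).indicator (fun _ => ENNReal.ofReal (1 / ρ)) z +
        ∫⁻ r in Ioc 0 t, W (z - r)) := setLIntegral_le_lintegral _ _
    _ = (∫⁻ z, (Icc 1 (1 + t)).indicator (fun _ => ENNReal.ofReal (1 / ρ)) z) +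
        (∫⁻ z, (Icc ε (ε + t)).indicator (fun _ => ENNReal.ofReal (1 / ρ)) z) +
        ∫⁻ z, ∫⁻ r in Ioc 0 t, W (z - r) := by
      rw [lintegral_add_left, lintegral_add_left]
      · exact measurable_const.indicator measurableSet_Icc
      · exact (measurable_const.indicator measurableSet_Icc).add
          (measurable_const.indicator measurableSet_Icc)
    _ ≤ ENNReal.ofReal (1 / 2) + ENNReal.ofReal (1 / 2) + ENNReal.ofReal ((1 + |β|) * C) := by
      gcongr
      · exact hvol 1
      · exact hvol ε
      · rw [lintegral_lintegral_swap (f := fun z r => W (z - r)) (hWm.comp (measurable_fst.sub measurable_snd)).aemeasurable]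
        simp_rw [lintegral_sub_right_eq_self W]
        rw [setLIntegral_const, Real.volume_Ioc, sub_zero]
        calc _ ≤ ENNReal.ofReal ((1 + |β|) * (C * g ρ)) * ENNReal.ofReal t := by gcongr
          _ = ENNReal.ofReal ((1 + |β|) * C * (t * g ρ)) := by
            rw [← ENNReal.ofReal_mul (by positivity)]; congr 1; ring
          _ ≤ _ := by
            apply ENNReal.ofReal_le_ofReal
            exact mul_le_of_le_one_right (by positivity) htρ
    _ = ENNReal.ofReal (1 / 2 + 1 / 2 + (1 + |β|) * C) := by
      rw [ENNReal.ofReal_add (by norm_num) (by positivity),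
        ENNReal.ofReal_add (by norm_num) (by norm_num)]
    _ ≤ _ := by
      apply ENNReal.ofReal_le_ofReal
      nlinarith

end

/-! ### The large-average set -/

/-- The union of all balls on which the average of `‖f‖` exceeds `α`. -/
def largeAverageSet (f : ℝ → ℂ) (α : ℝ) : Set ℝ :=
  ⋃ p ∈ {p : ℝ × ℝ | 0 < p.2 ∧ ENNReal.ofReal (α * (2 * p.2)) <
    ∫⁻ y in Metric.ball p.1 p.2, ‖f y‖ₑ}, Metric.ball p.1 p.2

lemma isOpen_largeAverageSet (f : ℝ → ℂ) (α : ℝ) : IsOpen (largeAverageSet f α) :=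
  isOpen_biUnion fun _ _ => Metric.isOpen_ball

lemma setLIntegral_ball_le_of_notMem {f : ℝ → ℂ} {α x c r : ℝ} (hx : x ∉ largeAverageSet f α)
    (hxc : x ∈ Metric.ball c r) :
    ∫⁻ y in Metric.ball c r, ‖f y‖ₑ ≤ ENNReal.ofReal (α * (2 * r)) := by
  by_contra! h
  exact hx (mem_biUnion (x := (c, r)) ⟨Metric.pos_of_mem_ball hxc, h⟩ hxc)

/-- This is the Vitali covering argument: the radii are bounded because `α * 2r < ‖f‖₁`, and the
fivefold enlargements of a disjoint subfamily cover the set. -/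
lemma mul_volume_largeAverageSet_le {f : ℝ → ℂ} (hf : Integrable f volume) {α : ℝ} (hα : 0 < α) :
    ENNReal.ofReal α * volume (largeAverageSet f α) ≤ 5 * ∫⁻ y, ‖f y‖ₑ := by
  set T := {p : ℝ × ℝ | 0 < p.2 ∧ ENNReal.ofReal (α * (2 * p.2)) <
    ∫⁻ y in Metric.ball p.1 p.2, ‖f y‖ₑ} with hT
  have hfin : ∫⁻ y, ‖f y‖ₑ ≠ ⊤ := hf.2.ne
  have hR : ∀ p ∈ T, p.2 ≤ (∫⁻ y, ‖f y‖ₑ).toReal / (2 * α) := by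
    intro p hp
    have h1 := hp.2.le.trans (setLIntegral_le_lintegral _ _)
    rw [ENNReal.ofReal_le_iff_le_toReal hfin] at h1
    rw [le_div_iff₀ (by positivity)]
    linarith
  obtain ⟨u, huT, hdisj, hcov⟩ := Vitali.exists_disjoint_subfamily_covering_enlargement_closedBall
    T (fun p => p.1) (fun p => p.2) _ hR 5 (by norm_num)
  have hcount : u.Countable := by
    refine hdisj.countable_of_nonempty_interior fun p hp => ?_
    exact ⟨p.1, Metric.ball_subset_interior_closedBall (Metric.mem_ball_self (huT hp).1)⟩
  have hsub : largeAverageSet f α ⊆ ⋃ p ∈ u, Metric.closedBall p.1 (5 * p.2) := by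
    intro x hx
    simp only [largeAverageSet, mem_iUnion] at hx
    obtain ⟨p, hp, hxp⟩ := hx
    obtain ⟨q, hq, hpq⟩ := hcov p hp
    exact mem_biUnion hq (hpq (Metric.ball_subset_closedBall hxp))
  have : Countable u := hcount
  calc ENNReal.ofReal α * volume (largeAverageSet f α)
      ≤ ENNReal.ofReal α * ∑' p : u, volume (Metric.closedBall p.1.1 (5 * p.1.2)) := by
        gcongr
        exact (measure_mono hsub).trans (measure_biUnion_le volume hcount _)
    _ = ∑' p : u, ENNReal.ofReal α * volume (Metric.closedBall p.1.1 (5 * p.1.2)) :=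
        ENNReal.tsum_mul_left.symm
    _ ≤ ∑' p : u, 5 * ∫⁻ y in Metric.ball p.1.1 p.1.2, ‖f y‖ₑ := by
        apply ENNReal.tsum_le_tsum
        intro p
        have hp := huT p.2
        rw [Real.volume_closedBall, ← ENNReal.ofReal_mul hα.le]
        calc ENNReal.ofReal (α * (2 * (5 * p.1.2))) = 5 * ENNReal.ofReal (α * (2 * p.1.2)) := by
              rw [show α * (2 * (5 * p.1.2)) = 5 * (α * (2 * p.1.2)) by ring,
                ENNReal.ofReal_mul (by norm_num)]
              norm_num
          _ ≤ _ := by gcongr; exact hp.2.le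
    _ = 5 * ∑' p : u, ∫⁻ y in Metric.ball p.1.1 p.1.2, ‖f y‖ₑ := ENNReal.tsum_mul_left
    _ = 5 * ∫⁻ y in ⋃ p : u, Metric.ball p.1.1 p.1.2, ‖f y‖ₑ := by
        rw [lintegral_iUnion (fun _ => Metric.isOpen_ball.measurableSet)]
        intro p q hpq
        exact (hdisj p.2 q.2 fun h => hpq (Subtype.ext h)).mono Metric.ball_subset_closedBall
          Metric.ball_subset_closedBall
    _ ≤ _ := by gcongr; exact Measure.restrict_le_self

/-! ### Dyadic shells for the singularity of order `κ` -/

/-- A power singularity is dominated by a sum over dyadic shells. -/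
lemma rpow_neg_le_tsum_shell {κ : ℝ} (hκ : 0 < κ) {v : ℝ} (hv : |v| ≤ 2) :
    ENNReal.ofReal |v| ^ (-κ) ≤
      ∑' k : ℕ, ENNReal.ofReal ((2 ^ κ) ^ k) * {v : ℝ | |v| ≤ 2 * (1 / 2) ^ k}.indicator 1 v := by
  have h2κ : (1 : ℝ) ≤ 2 ^ κ := Real.one_le_rpow (by norm_num) hκ.le
  rcases eq_or_ne v 0 with rfl | h0
  -- At `v = 0` the left side is `⊤`, and the series diverges because every shell contains `0`.
  · have : ∑' _ : ℕ, (1 : ENNReal) ≤ ∑' k : ℕ, ENNReal.ofReal ((2 ^ κ) ^ k) *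
        {v : ℝ | |v| ≤ 2 * (1 / 2) ^ k}.indicator 1 (0 : ℝ) := by
      apply ENNReal.tsum_le_tsum
      intro k
      rw [indicator_of_mem (by simp), Pi.one_apply, mul_one, ENNReal.one_le_ofReal]
      exact one_le_pow₀ h2κ
    rw [ENNReal.tsum_const_eq_top_of_ne_zero one_ne_zero, top_le_iff] at this
    rw [this]
    exact le_top
  · have hv0 : 0 < |v| := abs_pos.2 h0
    obtain ⟨k, hk1, hk2⟩ := exists_nat_pow_near_of_lt_one (x := |v| / 2) (y := (1 / 2 : ℝ))
      (by positivity) (by linarith) (by norm_num) (by norm_num)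
    refine le_trans ?_ (ENNReal.le_tsum k)
    have hmem : v ∈ {v : ℝ | |v| ≤ 2 * (1 / 2) ^ k} := by
      change |v| ≤ _
      linarith
    rw [indicator_of_mem hmem, Pi.one_apply, mul_one,
      ENNReal.ofReal_rpow_of_pos hv0]
    apply ENNReal.ofReal_le_ofReal
    have h3 : (1 / 2 : ℝ) ^ k ≤ |v| := by
      have : (1 / 2 : ℝ) ^ (k + 1) = (1 / 2) ^ k / 2 := by ring
      linarith
    calc |v| ^ (-κ) ≤ ((1 / 2 : ℝ) ^ k) ^ (-κ) :=
          Real.rpow_le_rpow_of_nonpos (by positivity) h3 (by linarith)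
      _ = (2 ^ κ) ^ k := by
        rw [← Real.rpow_natCast, ← Real.rpow_mul (by norm_num), ← Real.rpow_natCast,
          ← Real.rpow_mul (by norm_num), one_div, Real.inv_rpow (by norm_num),
          ← Real.rpow_neg (by norm_num)]
        congr 1; ring

/-- The geometric series of the dyadic shells. -/
lemma tsum_shell_ne_top {κ : ℝ} (hκ : κ < 1) :
    ∑' k : ℕ, ENNReal.ofReal ((2 ^ κ) ^ k) * ENNReal.ofReal ((1 / 2) ^ k) ≠ ⊤ := by
  have h : ∀ k : ℕ, ENNReal.ofReal ((2 ^ κ) ^ k) * ENNReal.ofReal ((1 / 2) ^ k) =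
      ENNReal.ofReal (2 ^ κ * (1 / 2)) ^ k := fun k => by
    rw [← ENNReal.ofReal_mul (by positivity), ← mul_pow, ENNReal.ofReal_pow (by positivity)]
  simp_rw [h]
  rw [ENNReal.tsum_geometric]
  apply ENNReal.inv_ne_top.2
  refine (tsub_pos_of_lt (ENNReal.ofReal_lt_one.2 ?_)).ne'
  have : (2 : ℝ) ^ κ < 2 := by
    simpa using Real.rpow_lt_rpow_of_exponent_lt one_lt_two hκ
  linarith

/-- This is the gain from spreading: averaged over a unit interval the singularity is bounded
uniformly in its position `s`. The shells have measure `4 * (1 / 2) ^ k`, and `1` covers `|s - t| >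
2`. -/
lemma setLIntegral_rpow_neg_le {κ : ℝ} (hκ : 0 < κ) (s : ℝ) :
    ∫⁻ t in Icc (0 : ℝ) 1, ENNReal.ofReal |s - t| ^ (-κ) ≤
      1 + 4 * ∑' k : ℕ, ENNReal.ofReal ((2 ^ κ) ^ k) * ENNReal.ofReal ((1 / 2) ^ k) := by
  have hm : ∀ k : ℕ, MeasurableSet {t : ℝ | |s - t| ≤ 2 * (1 / 2) ^ k} := fun k =>
    measurableSet_le (by fun_prop) measurable_const
  have hpt : ∀ t : ℝ, ENNReal.ofReal |s - t| ^ (-κ) ≤ 1 + ∑' k : ℕ, ENNReal.ofReal ((2 ^ κ) ^ k) *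
      {t : ℝ | |s - t| ≤ 2 * (1 / 2) ^ k}.indicator 1 t := by
    intro t
    rcases le_or_gt |s - t| 2 with h | h
    · refine (rpow_neg_le_tsum_shell hκ h).trans ?_
      exact le_add_self
    · refine le_trans ?_ le_self_add
      rw [ENNReal.rpow_neg, ENNReal.inv_le_one]
      apply ENNReal.one_le_rpow _ hκ
      rw [ENNReal.one_le_ofReal]; linarith
  calc _ ≤ ∫⁻ t in Icc (0 : ℝ) 1, (1 + ∑' k : ℕ, ENNReal.ofReal ((2 ^ κ) ^ k) *
          {t : ℝ | |s - t| ≤ 2 * (1 / 2) ^ k}.indicator 1 t) := lintegral_mono hpt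
    _ = 1 + ∑' k : ℕ, ∫⁻ t in Icc (0 : ℝ) 1, ENNReal.ofReal ((2 ^ κ) ^ k) *
          {t : ℝ | |s - t| ≤ 2 * (1 / 2) ^ k}.indicator 1 t := by
      rw [lintegral_add_left measurable_const, lintegral_tsum]
      · simp
      · intro k
        exact ((measurable_one.indicator (hm k)).const_mul _).aemeasurable
    _ ≤ _ := by
      rw [← ENNReal.tsum_mul_left]
      gcongr with k
      rw [lintegral_const_mul _ (measurable_one.indicator (hm k))]
      calc _ ≤ ENNReal.ofReal ((2 ^ κ) ^ k) * volume {t : ℝ | |s - t| ≤ 2 * (1 / 2) ^ k} := by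
            gcongr
            refine (setLIntegral_le_lintegral _ _).trans ?_
            rw [lintegral_indicator_one (hm k)]
        _ = ENNReal.ofReal ((2 ^ κ) ^ k) * ENNReal.ofReal (2 * (2 * (1 / 2) ^ k)) := by
            rw [← Real.volume_closedBall s]
            congr 2
            ext t
            simp [Metric.mem_closedBall, Real.dist_eq, abs_sub_comm]
        _ = _ := by
            rw [show (2 * (2 * (1 / 2 : ℝ) ^ k)) = 4 * (1 / 2) ^ k by ring,
              ENNReal.ofReal_mul (by norm_num)]
            norm_num
            ring

/-! ### The `TT*` estimate -/

section

variable {Ω : Type*} [MeasurableSpace Ω] {μ : Measure Ω} [SFinite μ]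

/-- The `TT*` argument: the `L²` norm of a superposition of translates of `K` is controlled by the
autocorrelation of `K`. -/
lemma lintegral_enorm_sq_superposition_le {H : Ω → ℂ} {Z : Ω → ℝ} {K : ℝ → ℂ} {b : ℝ}
    (hH : Integrable H μ) (hZ : Measurable Z) (hK : Measurable K) (hb : ∀ x, ‖K x‖ ≤ b)
    (hsupp : ∀ x ∉ Icc (0 : ℝ) 1, K x = 0) {M : ENNReal}
    (hM : ∀ x, ∫⁻ ω, ‖H ω‖ₑ * ‖kernelCorr K (x - Z ω)‖ₑ ∂μ ≤ M) :
    ∫⁻ x, ‖∫ ω, H ω * K (x - Z ω) ∂μ‖ₑ ^ 2 ≤ M * ∫⁻ ω, ‖H ω‖ₑ ∂μ := by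
  set S : ℝ → ℂ := fun x => ∫ ω, H ω * K (x - Z ω) ∂μ with hS
  set Ψ : Ω × Ω → ℝ → ℂ := fun p x =>
    starRingEnd ℂ (H p.1 * K (x - Z p.1)) * (H p.2 * K (x - Z p.2)) with hΨ
  have hKm : ∀ {β : Type _} [MeasurableSpace β] {φ : β → ℝ}, Measurable φ →
      Measurable fun z => K (φ z) := fun hφ => hK.comp hφ
  have hm1 : AEStronglyMeasurable (fun q : (Ω × Ω) × ℝ => H q.1.1 * K (q.2 - Z q.1.1))
      ((μ.prod μ).prod volume) :=
    ((hH.1.comp_fst (ν := μ)).comp_fst).mul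
      (hKm (measurable_snd.sub (hZ.comp (measurable_fst.comp measurable_fst)))).aestronglyMeasurable
  have hm2 : AEStronglyMeasurable (fun q : (Ω × Ω) × ℝ => H q.1.2 * K (q.2 - Z q.1.2))
      ((μ.prod μ).prod volume) :=
    ((hH.1.comp_snd (μ := μ)).comp_fst).mul
      (hKm (measurable_snd.sub (hZ.comp (measurable_snd.comp measurable_fst)))).aestronglyMeasurable
  have hΨm : AEStronglyMeasurable (Function.uncurry Ψ) ((μ.prod μ).prod volume) :=
    (Complex.continuous_conj.comp_aestronglyMeasurable hm1).mul hm2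
  have hb0 : 0 ≤ b := (norm_nonneg _).trans (hb 0)
  have hΨn : ∀ p x, ‖Ψ p x‖ₑ ≤ ‖H p.1‖ₑ * ‖H p.2‖ₑ *
      (Icc (Z p.1) (Z p.1 + 1)).indicator (fun _ => ENNReal.ofReal b ^ 2) x := by
    intro p x
    have hKe : ∀ z, ‖K z‖ₑ ≤ ENNReal.ofReal b := fun z => by
      rw [← ofReal_norm]; exact ENNReal.ofReal_le_ofReal (hb z)
    have e1 : ‖Ψ p x‖ₑ = ‖H p.1‖ₑ * ‖H p.2‖ₑ * (‖K (x - Z p.1)‖ₑ * ‖K (x - Z p.2)‖ₑ) := by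
      simp only [hΨ]
      rw [enorm_mul, RCLike.enorm_conj, enorm_mul, enorm_mul]; ring
    rw [e1]
    gcongr
    by_cases hx : x ∈ Icc (Z p.1) (Z p.1 + 1)
    · rw [indicator_of_mem hx, sq]
      gcongr <;> exact hKe _
    · rw [hsupp (x - Z p.1) fun h => hx ⟨by linarith [h.1], by linarith [h.2]⟩]
      simp
  -- Boundedness and compact support of `K` give absolute integrability, hence Fubini. The bound `b`
  -- may depend on the truncation, since it does not enter the final estimate.
  have hΨint : Integrable (Function.uncurry Ψ) ((μ.prod μ).prod volume) := by
    refine ⟨hΨm, ?_⟩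
    calc ∫⁻ q, ‖Function.uncurry Ψ q‖ₑ ∂((μ.prod μ).prod volume)
        ≤ ∫⁻ p, (∫⁻ x, ‖Ψ p x‖ₑ) ∂(μ.prod μ) := lintegral_prod_le _
      _ ≤ ∫⁻ p, ‖H p.1‖ₑ * ‖H p.2‖ₑ * ENNReal.ofReal b ^ 2 ∂(μ.prod μ) := by
        refine lintegral_mono fun p => (lintegral_mono (hΨn p)).trans ?_
        rw [lintegral_const_mul _ (measurable_const.indicator measurableSet_Icc),
          lintegral_indicator measurableSet_Icc, setLIntegral_const, Real.volume_Icc]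
        simp
      _ = (∫⁻ ω, ‖H ω‖ₑ ∂μ) * (∫⁻ ω, ‖H ω‖ₑ ∂μ) * ENNReal.ofReal b ^ 2 := by
        rw [lintegral_mul_const' _ _ (by simp),
          lintegral_prod_mul hH.1.enorm hH.1.enorm]
      _ < ⊤ := by
        have := hH.2
        exact ENNReal.mul_lt_top (ENNReal.mul_lt_top this this) (by simp)
  have hSS : ∀ x, ∫ p, Ψ p x ∂(μ.prod μ) = ((‖S x‖ ^ 2 : ℝ) : ℂ) := by
    intro x
    simp only [hΨ]
    rw [integral_prod_mul (fun ω => starRingEnd ℂ (H ω * K (x - Z ω)))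
      (fun ω => H ω * K (x - Z ω)), integral_conj, ← Complex.normSq_eq_norm_sq,
      Complex.normSq_eq_conj_mul_self]
  have hSint : Integrable (fun x => ‖S x‖ ^ 2) volume := by
    have h1 := hΨint.integral_prod_right
    have h2 : Integrable (fun x => ((‖S x‖ ^ 2 : ℝ) : ℂ)) volume := by
      simpa only [Function.uncurry, hSS] using h1
    exact (h2.re : _)
  have hcorr : ∀ p : Ω × Ω, ∫ x, Ψ p x =
      starRingEnd ℂ (H p.1) * H p.2 * kernelCorr K (Z p.1 - Z p.2) := by
    intro p
    have e1 : ∀ x, Ψ p x = starRingEnd ℂ (H p.1) * H p.2 *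
        (K (x - Z p.1 + (Z p.1 - Z p.2)) * starRingEnd ℂ (K (x - Z p.1))) := fun x => by
      simp only [hΨ, map_mul]
      rw [show x - Z p.1 + (Z p.1 - Z p.2) = x - Z p.2 by ring]
      ring
    simp_rw [e1]
    rw [integral_const_mul, integral_sub_right_eq_self
      (fun x => K (x + (Z p.1 - Z p.2)) * starRingEnd ℂ (K x)) (Z p.1)]
    rfl
  have key : ∫⁻ x, ‖S x‖ₑ ^ 2 = ‖∫ p, (∫ x, Ψ p x) ∂(μ.prod μ)‖ₑ := by
    rw [integral_integral_swap hΨint]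
    simp_rw [hSS]
    rw [integral_complex_ofReal, ← ofReal_norm, Complex.norm_real, Real.norm_of_nonneg
      (integral_nonneg fun x => by positivity), ofReal_integral_eq_lintegral_ofReal hSint
      (Filter.Eventually.of_forall fun x => by positivity)]
    refine lintegral_congr fun x => ?_
    rw [ENNReal.ofReal_pow (norm_nonneg _), ofReal_norm]
  calc _ = ‖∫ p, (∫ x, Ψ p x) ∂(μ.prod μ)‖ₑ := key
    _ ≤ ∫⁻ p, ‖∫ x, Ψ p x‖ₑ ∂(μ.prod μ) := enorm_integral_le_lintegral_enorm _
    _ = ∫⁻ p, ‖H p.1‖ₑ * (‖H p.2‖ₑ * ‖kernelCorr K (Z p.1 - Z p.2)‖ₑ) ∂(μ.prod μ) := by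
      refine lintegral_congr fun p => ?_
      rw [hcorr, enorm_mul, enorm_mul, RCLike.enorm_conj, mul_assoc]
    _ ≤ ∫⁻ ω', ∫⁻ ω, ‖H ω'‖ₑ * (‖H ω‖ₑ * ‖kernelCorr K (Z ω' - Z ω)‖ₑ) ∂μ ∂μ :=
      lintegral_prod_le _
    _ ≤ ∫⁻ ω', M * ‖H ω'‖ₑ ∂μ := by
      refine lintegral_mono fun ω' => ?_
      rw [lintegral_const_mul' _ _ enorm_ne_top, mul_comm M]
      gcongr
      exact hM _
    _ = _ := lintegral_const_mul'' _ hH.1.enorm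

end

/-! ### Adapted kernels and the spreading of mass -/

lemma kernelCorr_neg (K : ℝ → ℂ) (x : ℝ) :
    kernelCorr K (-x) = starRingEnd ℂ (kernelCorr K x) := by
  unfold kernelCorr
  rw [← integral_conj, ← integral_add_right_eq_self (fun y => K (y + -x) * starRingEnd ℂ (K y)) x]
  congr 1
  ext y
  rw [add_neg_cancel_right, map_mul, Complex.conj_conj, mul_comm]

lemma enorm_kernelCorr_abs (K : ℝ → ℂ) (x : ℝ) : ‖kernelCorr K |x|‖ₑ = ‖kernelCorr K x‖ₑ := by
  rcases abs_choice x with h | h <;> rw [h]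
  rw [kernelCorr_neg, RCLike.enorm_conj]

/-- A kernel supported in `[0, 1]` whose autocorrelation decays at the scales given by `g` and which
satisfies a Hörmander condition adapted to `g`. -/
structure AdaptedKernel (g : ℝ → ℝ) (a κ B : ℝ) (K : ℝ → ℂ) : Prop where
  measurable : Measurable K
  bounded : ∃ b, ∀ x, ‖K x‖ ≤ b
  support : ∀ x ∉ Icc (0 : ℝ) 1, K x = 0
  corr_global : ∀ x > 0, ‖kernelCorr K x‖ ≤ B * x ^ (-κ)
  corr_scale : ∀ ρ ∈ Ioc 0 a, ∀ x > 0, x ≤ ρ / 2 →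
    ‖kernelCorr K x‖ ≤ B / ρ * (1 + (x * g ρ) ^ (-κ))
  hormander : ∀ ρ ∈ Ioc 0 a, ∀ t, 0 ≤ t → t * g ρ ≤ 1 →
    ∫⁻ z in {z | 2 * ρ ≤ |z|}, ‖K z - K (z - t)‖ₑ ≤ ENNReal.ofReal B

section

variable {g : ℝ → ℝ} {a κ B : ℝ} {K : ℝ → ℂ}

lemma AdaptedKernel.kernelCorr_eq_zero (hK : AdaptedKernel g a κ B K) {x : ℝ} (hx : 1 < |x|) :
    kernelCorr K x = 0 := by
  unfold kernelCorr
  have : ∀ y, K (y + x) * starRingEnd ℂ (K y) = 0 := fun y => by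
    by_cases h1 : y ∈ Icc (0 : ℝ) 1
    · rw [hK.support (y + x), zero_mul]
      intro h2
      rcases lt_abs.1 hx with h3 | h3
      · linarith [h1.1, h2.2]
      · linarith [h1.2, h2.1]
    · rw [hK.support y h1, map_zero, mul_zero]
  simp only [this, integral_zero]

lemma AdaptedKernel.enorm_kernelCorr_le (hK : AdaptedKernel g a κ B K) (hB : 0 < B) (hκ : 0 < κ)
    (v : ℝ) : ‖kernelCorr K v‖ₑ ≤ ENNReal.ofReal B * ENNReal.ofReal |v| ^ (-κ) := by
  rcases eq_or_ne v 0 with rfl | hv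
  · rw [abs_zero, ENNReal.ofReal_zero, ENNReal.zero_rpow_of_neg (neg_lt_zero.2 hκ),
      ENNReal.mul_top (by simpa using hB)]
    exact le_top
  · have h := abs_pos.2 hv
    rw [← enorm_kernelCorr_abs, ENNReal.ofReal_rpow_of_pos h, ← ENNReal.ofReal_mul hB.le, ← ofReal_norm]
    exact ENNReal.ofReal_le_ofReal (hK.corr_global _ h)

lemma AdaptedKernel.enorm_kernelCorr_le_scale (hK : AdaptedKernel g a κ B K) (hB : 0 < B)
    (hκ : 0 < κ) {ρ v : ℝ} (hρ : ρ ∈ Ioc 0 a) (hg : 0 < g ρ) (hv : |v| ≤ ρ / 2) :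
    ‖kernelCorr K v‖ₑ ≤ ENNReal.ofReal (B / ρ) * (1 + ENNReal.ofReal (|v| * g ρ) ^ (-κ)) := by
  have hρ0 := hρ.1
  rcases eq_or_ne v 0 with rfl | hv0
  · rw [abs_zero, zero_mul, ENNReal.ofReal_zero, ENNReal.zero_rpow_of_neg (neg_lt_zero.2 hκ), add_top,
      ENNReal.mul_top (by simpa using div_pos hB hρ0)]
    exact le_top
  · have h := abs_pos.2 hv0
    have h1 : 0 < |v| * g ρ := mul_pos h hg
    rw [← enorm_kernelCorr_abs, ENNReal.ofReal_rpow_of_pos h1, ← ENNReal.ofReal_one,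
      ← ENNReal.ofReal_add zero_le_one (Real.rpow_nonneg h1.le _),
      ← ENNReal.ofReal_mul (by positivity), ← ofReal_norm]
    exact ENNReal.ofReal_le_ofReal (hK.corr_scale ρ hρ _ h hv)

/-- The length over which mass at `y` is spread: `1 / g ρ`, where `ρ` is comparable to the distance
of `y` to the complement of `E`. -/
noncomputable def spreadLength (g : ℝ → ℝ) (a : ℝ) (E : Set ℝ) (y : ℝ) : ℝ :=
  (Ioc 0 a).indicator (fun ρ => (g ρ)⁻¹) (min (Metric.infDist y Eᶜ / 2) a)

variable {l : ℝ → ℝ} {C : ℝ}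

lemma PhaseProfile.measurable_spreadLength (h : PhaseProfile g l a κ C) (E : Set ℝ) :
    Measurable (spreadLength g a E) := by
  have h1 : Measurable ((Ioc 0 a).indicator fun ρ => (g ρ)⁻¹) := by
    have hs : Ioc 0 a ⊆ Ioc 0 1 := Ioc_subset_Ioc_right (by linarith [h.a_le_half])
    rw [← piecewise_eq_indicator]
    exact ((h.contDiff.continuousOn.mono hs).inv₀
      fun x hx => (h.pos x (hs hx)).ne').measurable_piecewise continuousOn_const measurableSet_Ioc
  exact h1.comp (((Metric.continuous_infDist_pt _).div_const 2).min continuous_const).measurable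

lemma PhaseProfile.spreadLength_nonneg (h : PhaseProfile g l a κ C) (E : Set ℝ) (y : ℝ) :
    0 ≤ spreadLength g a E y :=
  indicator_nonneg (fun x hx => (inv_pos.2 (h.pos x ⟨hx.1, by linarith [hx.2, h.a_le_half]⟩)).le) _

lemma PhaseProfile.spreadLength_le (h : PhaseProfile g l a κ C) (E : Set ℝ) (y : ℝ) :
    spreadLength g a E y ≤ min (Metric.infDist y Eᶜ / 2) a / 8 := by
  unfold spreadLength
  have h0 : 0 ≤ min (Metric.infDist y Eᶜ / 2) a := le_min
    (div_nonneg Metric.infDist_nonneg (by norm_num)) h.a_pos.le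
  generalize min (Metric.infDist y Eᶜ / 2) a = ρ at h0
  by_cases hρ : ρ ∈ Ioc 0 a
  · rw [indicator_of_mem hρ]
    have h1 := h.large ρ hρ
    have h2 := h.pos ρ ⟨hρ.1, by linarith [hρ.2, h.a_le_half]⟩
    rw [inv_le_iff_one_le_mul₀ h2]
    linarith
  · rw [indicator_of_notMem hρ]
    positivity

/-- The sum of the dyadic shells `∑ 2 ^ (κ k) * 2 ^ (-k)`. -/
noncomputable def shellSum (κ : ℝ) : ENNReal :=
  ∑' k : ℕ, ENNReal.ofReal ((2 ^ κ) ^ k) * ENNReal.ofReal ((1 / 2) ^ k)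

/-- When `x` is this close to `y`, their distances to the complement are comparable. Rescaling by `g
ρ` turns the spread into a unit interval, so averaging in `t` removes the singularity and leaves
`O(B / ρ)`. The bound `2` on the distance ensures that the cap `a` only costs a constant: `ρ ≥ a *
Dy / 2`. -/
lemma lintegral_kernelCorr_near (h : PhaseProfile g l a κ C) (hK : AdaptedKernel g a κ B K)
    (hB : 0 < B) {E : Set ℝ} {x y : ℝ} (hD : Metric.infDist y Eᶜ ≤ 2)
    (hxy : |x - y| < min (Metric.infDist y Eᶜ / 2) a / 4) :
    ∫⁻ t in Icc (0 : ℝ) 1, ‖kernelCorr K (x - (y + t * spreadLength g a E y))‖ₑ ≤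
      (Metric.ball x (2 * Metric.infDist x Eᶜ)).indicator (fun _ =>
        ENNReal.ofReal (3 * B / (a * Metric.infDist x Eᶜ)) * (2 + 4 * shellSum κ)) y := by
  have ha := h.a_pos
  have hd := h.spreadLength_le E y
  have hd0 := h.spreadLength_nonneg E y
  have hsp : spreadLength g a E y = (Ioc 0 a).indicator (fun ρ => (g ρ)⁻¹)
    (min (Metric.infDist y Eᶜ / 2) a) := rfl
  have h1 := Metric.infDist_le_infDist_add_dist (s := Eᶜ) (x := x) (y := y)
  have h2 := Metric.infDist_le_infDist_add_dist (s := Eᶜ) (x := y) (y := x)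
  rw [Real.dist_eq] at h1 h2
  rw [abs_sub_comm] at h2
  set Dy := Metric.infDist y Eᶜ
  set Dx := Metric.infDist x Eᶜ
  set ρ := min (Dy / 2) a with hρdef
  have hρ0 : 0 < ρ := by linarith [abs_nonneg (x - y)]
  have hρa : ρ ≤ a := min_le_right _ _
  have hρD : ρ ≤ Dy / 2 := min_le_left _ _
  have hmem : ρ ∈ Ioc 0 a := ⟨hρ0, hρa⟩
  have hDρ : a * Dy / 2 ≤ ρ := by
    rw [hρdef, le_min_iff]
    constructor <;> nlinarith [h.a_le_half]
  have hDx : 0 < Dx := by linarith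
  have hg : 0 < g ρ := h.pos ρ ⟨hρ0, by linarith [h.a_le_half]⟩
  rw [indicator_of_mem hmem] at hsp
  rw [indicator_of_mem (show y ∈ Metric.ball x (2 * Dx) by
    rw [Metric.mem_ball, Real.dist_eq, abs_sub_comm]; linarith)]
  calc _ ≤ ∫⁻ t in Icc (0 : ℝ) 1, ENNReal.ofReal (B / ρ) *
        (1 + ENNReal.ofReal |(x - y) * g ρ - t| ^ (-κ)) := by
        refine setLIntegral_mono' measurableSet_Icc fun t ht => ?_
        have e1 : |x - (y + t * spreadLength g a E y)| * g ρ = |(x - y) * g ρ - t| := by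
          rw [← abs_of_pos hg, ← abs_mul, abs_of_pos hg, hsp]
          congr 1
          field_simp
          ring
        rw [← e1]
        apply hK.enorm_kernelCorr_le_scale hB h.κ_pos hmem hg
        have h3 : t * spreadLength g a E y ≤ ρ / 8 := by nlinarith [ht.2]
        have h4 : 0 ≤ t * spreadLength g a E y := mul_nonneg ht.1 hd0
        have h5 := abs_sub (x - y) (t * spreadLength g a E y)
        rw [abs_of_nonneg h4] at h5
        rw [← sub_sub]
        linarith
    _ = ENNReal.ofReal (B / ρ) * (1 + ∫⁻ t in Icc (0 : ℝ) 1,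
          ENNReal.ofReal |(x - y) * g ρ - t| ^ (-κ)) := by
        rw [lintegral_const_mul' _ _ ENNReal.ofReal_ne_top, lintegral_add_left measurable_const]
        simp
    _ ≤ ENNReal.ofReal (3 * B / (a * Dx)) * (1 + (1 + 4 * shellSum κ)) := by
        gcongr ENNReal.ofReal ?_ * (1 + ?_)
        · rw [div_le_div_iff₀ hρ0 (by positivity)]
          have : a * Dx ≤ 3 * ρ := by nlinarith
          nlinarith
        · exact setLIntegral_rpow_neg_le h.κ_pos _
    _ = _ := by ring

/-- The displacement is at most `ρ / 8 ≤ |x - y| / 2`, so the global decay holds at distance `|x -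
y| / 2`. The distance from `y` to the complement is at most `8 / a * |x - y|`; recording this in
each shell lets a comparable ball around `x` reach the complement. -/
lemma lintegral_kernelCorr_far (h : PhaseProfile g l a κ C) (hK : AdaptedKernel g a κ B K)
    (hB : 0 < B) {E : Set ℝ} {x y : ℝ} (hD : Metric.infDist y Eᶜ ≤ 2)
    (hxy : min (Metric.infDist y Eᶜ / 2) a / 4 ≤ |x - y|) :
    ∫⁻ t in Icc (0 : ℝ) 1, ‖kernelCorr K (x - (y + t * spreadLength g a E y))‖ₑ ≤
      ENNReal.ofReal B * ∑' k : ℕ, ENNReal.ofReal ((2 ^ κ) ^ k) *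
        {y | |x - y| ≤ 4 * (1 / 2) ^ k ∧ Metric.infDist y Eᶜ ≤ 8 / a * (4 * (1 / 2) ^ k)}.indicator
          1 y := by
  have ha := h.a_pos
  have hd := h.spreadLength_le E y
  have hd0 := h.spreadLength_nonneg E y
  set Dy := Metric.infDist y Eᶜ
  set ρ := min (Dy / 2) a with hρdef
  have hDρ : a * Dy / 2 ≤ ρ := by
    rw [hρdef, le_min_iff]
    constructor <;> nlinarith [h.a_le_half, (Metric.infDist_nonneg : 0 ≤ Metric.infDist y Eᶜ)]
  have hv : ∀ t ∈ Icc (0 : ℝ) 1, |x - y| / 2 ≤ |x - (y + t * spreadLength g a E y)| := by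
    intro t ht
    have h3 : t * spreadLength g a E y ≤ |x - y| / 2 := by nlinarith [ht.2]
    have h4 : 0 ≤ t * spreadLength g a E y := mul_nonneg ht.1 hd0
    have h5 := abs_sub_abs_le_abs_sub (x - y) (t * spreadLength g a E y)
    rw [abs_of_nonneg h4] at h5
    rw [← sub_sub]
    linarith
  rcases lt_or_ge 2 |x - y| with h2 | h2
  · refine le_trans (le_of_eq ?_) zero_le
    rw [setLIntegral_congr_fun measurableSet_Icc (g := fun _ => 0) fun t ht => ?_, lintegral_zero]
    rw [hK.kernelCorr_eq_zero (by linarith [hv t ht]), enorm_zero]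
  · calc _ ≤ ∫⁻ _ in Icc (0 : ℝ) 1, ENNReal.ofReal B * ENNReal.ofReal |(x - y) / 2| ^ (-κ) := by
          refine setLIntegral_mono' measurableSet_Icc fun t ht => ?_
          refine (hK.enorm_kernelCorr_le hB h.κ_pos _).trans ?_
          gcongr ENNReal.ofReal B * ?_
          rw [ENNReal.rpow_neg, ENNReal.rpow_neg, ENNReal.inv_le_inv]
          apply ENNReal.rpow_le_rpow _ h.κ_pos.le
          apply ENNReal.ofReal_le_ofReal
          rw [abs_div, abs_two]
          exact hv t ht
      _ = ENNReal.ofReal B * ENNReal.ofReal |(x - y) / 2| ^ (-κ) := by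
          rw [setLIntegral_const, Real.volume_Icc]; simp
      _ ≤ _ := by
          gcongr
          refine (rpow_neg_le_tsum_shell h.κ_pos (v := (x - y) / 2) (by
            rw [abs_div, abs_two]; linarith)).trans ?_
          gcongr with k
          by_cases hk : |(x - y) / 2| ≤ 2 * (1 / 2) ^ k
          · have h3 : |x - y| ≤ 4 * (1 / 2) ^ k := by
              rw [abs_div, abs_two] at hk; linarith
            have h4 : Dy ≤ 8 / a * (4 * (1 / 2) ^ k) := by
              rw [div_mul_eq_mul_div, le_div_iff₀ ha]
              linarith
            rw [indicator_of_mem (show (x - y) / 2 ∈ {v : ℝ | |v| ≤ 2 * (1 / 2) ^ k} from hk),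
              indicator_of_mem (show y ∈ {y | |x - y| ≤ 4 * (1 / 2) ^ k ∧
                Metric.infDist y Eᶜ ≤ 8 / a * (4 * (1 / 2) ^ k)} from ⟨h3, h4⟩), Pi.one_apply,
              Pi.one_apply]
          · rw [indicator_of_notMem (show (x - y) / 2 ∉ {v : ℝ | |v| ≤ 2 * (1 / 2) ^ k} from hk)]
            exact zero_le

/-- The part of `f` near the complement of its large-average set, spread at the scales of `g`, has
bounded convolution with the autocorrelation. -/
lemma lintegral_mul_kernelCorr_le (h : PhaseProfile g l a κ C) (hK : AdaptedKernel g a κ B K)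
    (hB : 0 < B) {f : ℝ → ℂ} (hf : Integrable f volume) {α : ℝ} (hα : 0 < α)
    (hne : (largeAverageSet f α)ᶜ.Nonempty) (x : ℝ) :
    ∫⁻ y in {y | Metric.infDist y (largeAverageSet f α)ᶜ ≤ 2}, ‖f y‖ₑ *
      ∫⁻ t in Icc (0 : ℝ) 1,
        ‖kernelCorr K (x - (y + t * spreadLength g a (largeAverageSet f α) y))‖ₑ ≤
      ENNReal.ofReal (88 / a) * (2 + 5 * shellSum κ) * (ENNReal.ofReal B * ENNReal.ofReal α) := by
  have ha := h.a_pos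
  have ha1 := h.a_le_half
  set E := largeAverageSet f α with hE
  set Dx := Metric.infDist x Eᶜ with hDx
  have hDc : Continuous fun y => Metric.infDist y Eᶜ := Metric.continuous_infDist_pt _
  set U : ℕ → Set ℝ := fun k => {y | |x - y| ≤ 4 * (1 / 2) ^ k ∧
    Metric.infDist y Eᶜ ≤ 8 / a * (4 * (1 / 2) ^ k)} with hU
  have hUm : ∀ k, MeasurableSet (U k) := fun k => by
    have e1 : U k = {y | |x - y| ≤ 4 * (1 / 2) ^ k} ∩
        {y | Metric.infDist y Eᶜ ≤ 8 / a * (4 * (1 / 2) ^ k)} := by ext; rfl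
    rw [e1]
    exact (measurableSet_le (by fun_prop) measurable_const).inter
      (measurableSet_le hDc.measurable measurable_const)
  set c := ENNReal.ofReal (3 * B / (a * Dx)) * (2 + 4 * shellSum κ) with hc
  have hpt : ∀ y ∈ {y | Metric.infDist y Eᶜ ≤ 2}, ‖f y‖ₑ * ∫⁻ t in Icc (0 : ℝ) 1,
      ‖kernelCorr K (x - (y + t * spreadLength g a E y))‖ₑ ≤
      (Metric.ball x (2 * Dx)).indicator (fun y => ‖f y‖ₑ * c) y +
        ∑' k : ℕ, ENNReal.ofReal B * ENNReal.ofReal ((2 ^ κ) ^ k) *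
          (U k).indicator (fun y => ‖f y‖ₑ) y := by
    intro y hy
    rcases lt_or_ge |x - y| (min (Metric.infDist y Eᶜ / 2) a / 4) with h1 | h1
    · refine le_trans ?_ le_self_add
      rw [indicator_mul_right]
      gcongr
      exact lintegral_kernelCorr_near h hK hB hy h1
    · refine le_trans ?_ le_add_self
      calc _ ≤ ‖f y‖ₑ * _ := mul_le_mul_right (lintegral_kernelCorr_far h hK hB hy h1) _
        _ = _ := by
          rw [← ENNReal.tsum_mul_left, ← ENNReal.tsum_mul_left]
          congr 1
          ext k
          by_cases hk : y ∈ U k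
          · rw [indicator_of_mem hk, indicator_of_mem hk, Pi.one_apply]; ring
          · rw [indicator_of_notMem hk, indicator_of_notMem hk]; simp
  -- For `Dx > 0` the ball of radius `2 * Dx` meets the complement and carries mass at most `4 * α *
  -- Dx`, which cancels the `1 / Dx` in `c`. For `Dx = 0` it is empty.
  have hnear : ∫⁻ y, (Metric.ball x (2 * Dx)).indicator (fun y => ‖f y‖ₑ * c) y ≤
      (2 + 4 * shellSum κ) * ENNReal.ofReal (12 * B * α / a) := by
    rw [lintegral_indicator Metric.isOpen_ball.measurableSet,
      lintegral_mul_const'' _ hf.1.enorm.restrict]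
    rcases (Metric.infDist_nonneg : 0 ≤ Metric.infDist x Eᶜ).eq_or_lt with h0 | h0
    · rw [← hDx] at h0
      rw [← h0]; simp
    · rw [← hDx] at h0
      obtain ⟨p, hp, hxp⟩ := (Metric.infDist_lt_iff hne).1 (show Metric.infDist x Eᶜ < 2 * Dx by
        linarith)
      have hm := setLIntegral_ball_le_of_notMem (f := f) (α := α) (x := p) (c := x) (r := 2 * Dx)
        hp (by rwa [Metric.mem_ball, dist_comm])
      calc _ ≤ ENNReal.ofReal (α * (2 * (2 * Dx))) * c := by gcongr
        _ = (2 + 4 * shellSum κ) *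
            (ENNReal.ofReal (α * (2 * (2 * Dx))) * ENNReal.ofReal (3 * B / (a * Dx))) := by
          rw [hc]; ring
        _ = _ := by
          rw [← ENNReal.ofReal_mul (by positivity)]
          congr 2
          field_simp
          ring
  -- If `U k` has a point, the complement lies within `36 * r / a` of it (`32 * r / a` plus room for
  -- strictness), so the ball of radius `44 * r / a` around `x` contains `U k` and meets the
  -- complement.
  have hfar : ∀ k, ∫⁻ y in U k, ‖f y‖ₑ ≤
      ENNReal.ofReal (88 * α / a) * ENNReal.ofReal ((1 / 2) ^ k) := by
    intro k
    have hr : (0 : ℝ) < (1 / 2) ^ k := by positivity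
    rw [← ENNReal.ofReal_mul (by positivity)]
    rcases (U k).eq_empty_or_nonempty with h0 | ⟨y, hy⟩
    · rw [h0]; simp
    · set r : ℝ := (1 / 2) ^ k
      have hra : 4 * r ≤ 4 * r / a := by
        rw [le_div_iff₀ ha]; nlinarith
      have hra0 : 0 < r / a := by positivity
      obtain ⟨p, hp, hyp⟩ := (Metric.infDist_lt_iff hne).1
        (show Metric.infDist y Eᶜ < 36 * r / a by
          have h1 : Metric.infDist y Eᶜ ≤ 8 / a * (4 * r) := hy.2
          have : 8 / a * (4 * r) = 32 * (r / a) := by ring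
          have : 36 * r / a = 36 * (r / a) := by ring
          linarith)
      have hxp : p ∈ Metric.ball x (44 * r / a) := by
        rw [Metric.mem_ball, dist_comm]
        have h1 := dist_triangle x y p
        have h2 : dist x y ≤ 4 * r := by rw [Real.dist_eq]; exact hy.1
        have e1 : 36 * r / a = 36 * (r / a) := by ring
        have e2 : 44 * r / a = 44 * (r / a) := by ring
        have e3 : 4 * r / a = 4 * (r / a) := by ring
        linarith
      have hm := setLIntegral_ball_le_of_notMem (f := f) (α := α) hp hxp
      refine (lintegral_mono_set ?_).trans (hm.trans (le_of_eq ?_))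
      · intro z hz
        rw [Metric.mem_ball, dist_comm, Real.dist_eq]
        have h1 : |x - z| ≤ 4 * r := hz.1
        have e2 : 44 * r / a = 44 * (r / a) := by ring
        have e3 : 4 * r / a = 4 * (r / a) := by ring
        linarith
      · congr 1
        field_simp
        ring
  calc _ ≤ ∫⁻ y in {y | Metric.infDist y Eᶜ ≤ 2},
        ((Metric.ball x (2 * Dx)).indicator (fun y => ‖f y‖ₑ * c) y +
        ∑' k : ℕ, ENNReal.ofReal B * ENNReal.ofReal ((2 ^ κ) ^ k) *
          (U k).indicator (fun y => ‖f y‖ₑ) y) :=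
        setLIntegral_mono' (measurableSet_le hDc.measurable measurable_const) hpt
    _ ≤ ∫⁻ y, ((Metric.ball x (2 * Dx)).indicator (fun y => ‖f y‖ₑ * c) y +
        ∑' k : ℕ, ENNReal.ofReal B * ENNReal.ofReal ((2 ^ κ) ^ k) *
          (U k).indicator (fun y => ‖f y‖ₑ) y) := setLIntegral_le_lintegral _ _
    _ = (∫⁻ y, (Metric.ball x (2 * Dx)).indicator (fun y => ‖f y‖ₑ * c) y) +
        ∑' k : ℕ, ENNReal.ofReal B * ENNReal.ofReal ((2 ^ κ) ^ k) * ∫⁻ y in U k, ‖f y‖ₑ := by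
        rw [lintegral_add_left' ((hf.1.enorm.mul_const c).indicator
          Metric.isOpen_ball.measurableSet), lintegral_tsum fun k =>
            ((hf.1.enorm.indicator (hUm k)).const_mul _)]
        congr 2
        ext k
        rw [lintegral_const_mul'' _ (hf.1.enorm.indicator (hUm k)), lintegral_indicator (hUm k)]
    _ ≤ (2 + 4 * shellSum κ) * ENNReal.ofReal (12 * B * α / a) +
        ∑' k : ℕ, ENNReal.ofReal B * ENNReal.ofReal ((2 ^ κ) ^ k) *
          (ENNReal.ofReal (88 * α / a) * ENNReal.ofReal ((1 / 2) ^ k)) := by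
        gcongr with k
        exact hfar k
    _ = (2 + 4 * shellSum κ) * ENNReal.ofReal (12 * B * α / a) +
        ENNReal.ofReal (88 * B * α / a) * shellSum κ := by
        congr 1
        rw [shellSum, ← ENNReal.tsum_mul_left]
        congr 1
        ext k
        rw [show 88 * B * α / a = B * (88 * α / a) by ring, ENNReal.ofReal_mul hB.le]
        ring
    _ ≤ (2 + 4 * shellSum κ) * ENNReal.ofReal (88 * B * α / a) +
        ENNReal.ofReal (88 * B * α / a) * shellSum κ := by
        gcongr
        norm_num
    _ = _ := by
        rw [show 88 * B * α / a = 88 / a * (B * α) by ring, ENNReal.ofReal_mul (by positivity),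
          ENNReal.ofReal_mul hB.le]
        ring

end

/-! ### The weak type estimate -/

section

variable {g l : ℝ → ℝ} {a κ B C : ℝ} {K : ℝ → ℂ}

/-- Spreading `f` at the scales of `g` changes the convolution with `K` by little off the
large-average set. -/
lemma lintegral_enorm_sub_superposition_le (h : PhaseProfile g l a κ C)
    (hK : AdaptedKernel g a κ B K) {f : ℝ → ℂ} (hf : Integrable f volume) {E : Set ℝ}
    (hE : IsOpen E) :
    ∫⁻ x in Eᶜ, ‖(∫ y, K (x - y) * f y) -
      ∫ ω, {y | Metric.infDist y Eᶜ ≤ 2}.indicator f ω.1 *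
        K (x - (ω.1 + ω.2 * spreadLength g a E ω.1))
          ∂(volume : Measure ℝ).prod (volume.restrict (Icc (0 : ℝ) 1))‖ₑ ≤
      ENNReal.ofReal B * ∫⁻ y, ‖f y‖ₑ := by
  set d := spreadLength g a E with hd
  set G : Set ℝ := {y | Metric.infDist y Eᶜ ≤ 2} with hG
  set μ := (volume : Measure ℝ).prod (volume.restrict (Icc (0 : ℝ) 1)) with hμ
  have hGm : MeasurableSet G :=
    measurableSet_le (Metric.continuous_infDist_pt _).measurable measurable_const
  have hdm : Measurable d := h.measurable_spreadLength E
  have hd0 := h.spreadLength_nonneg E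
  obtain ⟨b, hb⟩ := hK.bounded
  have hfG : Integrable (G.indicator f) volume := hf.indicator hGm
  have hH : Integrable (fun ω : ℝ × ℝ => G.indicator f ω.1) μ := hfG.comp_fst _
  have hZ : Measurable fun ω : ℝ × ℝ => ω.1 + ω.2 * d ω.1 :=
    measurable_fst.add (measurable_snd.mul (hdm.comp measurable_fst))
  -- For `x` off `E`, points `y` farther than `2` from the complement are out of reach of the
  -- support of `K`. The second variable is a dummy of total mass one.
  have hEq : ∀ x ∈ Eᶜ, ∫ y, K (x - y) * f y = ∫ ω, G.indicator f ω.1 * K (x - ω.1) ∂μ := by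
    intro x hx
    have h1 := integral_fun_fst (μ := (volume : Measure ℝ)) (ν := volume.restrict (Icc (0 : ℝ) 1))
      (fun y => G.indicator f y * K (x - y))
    rw [hμ, h1]
    simp only [measureReal_restrict_apply_univ, Real.volume_real_Icc, sub_zero, zero_le_one,
      sup_of_le_left, one_smul]
    congr 1
    ext y
    by_cases hy : y ∈ G
    · rw [indicator_of_mem hy, mul_comm]
    · rw [indicator_of_notMem hy, zero_mul, hK.support (x - y), zero_mul]
      intro h2
      have h3 := Metric.infDist_le_dist_of_mem (x := y) hx
      have h4 : 2 < Metric.infDist y Eᶜ := not_le.1 hy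
      rw [Real.dist_eq, abs_sub_comm, abs_of_nonneg h2.1] at h3
      linarith [h2.2]
  have hint1 : ∀ x, Integrable (fun ω : ℝ × ℝ => G.indicator f ω.1 * K (x - ω.1)) μ := fun x =>
    hH.mul_bdd (hK.measurable.comp (measurable_const.sub measurable_fst)).aestronglyMeasurable
      (Filter.Eventually.of_forall fun _ => hb _)
  have hint2 : ∀ x, Integrable (fun ω : ℝ × ℝ => G.indicator f ω.1 *
      K (x - (ω.1 + ω.2 * d ω.1))) μ := fun x =>
    hH.mul_bdd (hK.measurable.comp (measurable_const.sub hZ)).aestronglyMeasurable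
      (Filter.Eventually.of_forall fun _ => hb _)
  have hm : AEMeasurable (fun q : ℝ × (ℝ × ℝ) => ‖G.indicator f q.2.1‖ₑ *
      ‖K (q.1 - q.2.1) - K (q.1 - (q.2.1 + q.2.2 * d q.2.1))‖ₑ)
      ((volume.restrict Eᶜ).prod μ) := by
    refine AEMeasurable.mul (hH.1.comp_snd (μ := volume.restrict Eᶜ)).enorm ?_
    exact ((hK.measurable.comp (measurable_fst.sub (measurable_fst.comp measurable_snd))).sub
      (hK.measurable.comp (measurable_fst.sub (hZ.comp measurable_snd)))).enorm.aemeasurable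
  -- The complement of `E` lies at distance at least `2 * ρ` from `y`, and the displacement is at
  -- most `1 / g ρ`: exactly the range of the Hörmander condition.
  have hker : ∀ y, ∀ t ∈ Icc (0 : ℝ) 1, ∫⁻ x in Eᶜ, ‖K (x - y) - K (x - (y + t * d y))‖ₑ ≤
      ENNReal.ofReal B := by
    intro y t ht
    set ρ := min (Metric.infDist y Eᶜ / 2) a with hρ
    by_cases hmem : ρ ∈ Ioc 0 a
    · have hgρ := h.pos ρ ⟨hmem.1, by linarith [hmem.2, h.a_le_half]⟩
      have hdy : d y = (g ρ)⁻¹ := by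
        rw [hd, spreadLength, ← hρ, indicator_of_mem hmem]
      have hsub : Eᶜ ⊆ {x | 2 * ρ ≤ |x - y|} := fun x hx => by
        have h3 := Metric.infDist_le_dist_of_mem (x := y) hx
        rw [Real.dist_eq, abs_sub_comm] at h3
        have : ρ ≤ Metric.infDist y Eᶜ / 2 := min_le_left _ _
        show 2 * ρ ≤ |x - y|
        linarith
      have hmeas : MeasurableSet {z : ℝ | 2 * ρ ≤ |z|} :=
        measurableSet_le measurable_const measurable_norm
      calc _ ≤ ∫⁻ x in {x | 2 * ρ ≤ |x - y|}, ‖K (x - y) - K (x - y - t * d y)‖ₑ := by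
            simp_rw [← sub_sub]
            exact lintegral_mono_set hsub
        _ = ∫⁻ x, ({z : ℝ | 2 * ρ ≤ |z|}.indicator fun z => ‖K z - K (z - t * d y)‖ₑ) (x - y) := by
            rw [← lintegral_indicator (measurableSet_le measurable_const (by fun_prop))]
            rfl
        _ = ∫⁻ z in {z | 2 * ρ ≤ |z|}, ‖K z - K (z - t * d y)‖ₑ := by
            rw [lintegral_sub_right_eq_self, lintegral_indicator hmeas]
        _ ≤ ENNReal.ofReal B := by
            apply hK.hormander ρ hmem _ (mul_nonneg ht.1 (hd0 y))
            change t * d y * g ρ ≤ 1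
            rw [hdy, mul_assoc, inv_mul_cancel₀ hgρ.ne', mul_one]
            exact ht.2
    · have hdy : d y = 0 := by
        rw [hd, spreadLength, ← hρ, indicator_of_notMem hmem]
      simp [hdy]
  calc _ ≤ ∫⁻ x in Eᶜ, (∫⁻ ω, ‖G.indicator f ω.1‖ₑ *
        ‖K (x - ω.1) - K (x - (ω.1 + ω.2 * d ω.1))‖ₑ ∂μ) := by
        refine setLIntegral_mono' hE.isClosed_compl.measurableSet fun x hx => ?_
        rw [hEq x hx, ← integral_sub (hint1 x) (hint2 x)]
        refine (enorm_integral_le_lintegral_enorm _).trans (le_of_eq ?_)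
        refine lintegral_congr fun ω => ?_
        rw [← mul_sub, enorm_mul]
    _ = ∫⁻ ω, (∫⁻ x in Eᶜ, ‖G.indicator f ω.1‖ₑ *
        ‖K (x - ω.1) - K (x - (ω.1 + ω.2 * d ω.1))‖ₑ) ∂μ := lintegral_lintegral_swap hm
    _ ≤ ∫⁻ y, ∫⁻ t in Icc (0 : ℝ) 1, ∫⁻ x in Eᶜ, ‖G.indicator f y‖ₑ *
        ‖K (x - y) - K (x - (y + t * d y))‖ₑ := lintegral_prod_le _
    _ ≤ ∫⁻ y, ∫⁻ t in Icc (0 : ℝ) 1, ‖f y‖ₑ * ENNReal.ofReal B := by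
        refine lintegral_mono fun y => setLIntegral_mono' measurableSet_Icc fun t ht => ?_
        rw [lintegral_const_mul' _ _ enorm_ne_top]
        gcongr
        · exact enorm_indicator_le_enorm_self _ _
        · exact hker y t ht
    _ = ∫⁻ y, ‖f y‖ₑ * ENNReal.ofReal B := by simp
    _ = _ := by rw [lintegral_mul_const' _ _ ENNReal.ofReal_ne_top, mul_comm]

/-- The weak type `(1, 1)` estimate for adapted kernels. -/
theorem AdaptedKernel.weak_type (h : PhaseProfile g l a κ C) (hK : AdaptedKernel g a κ B K)
    (hB : 1 ≤ B) {f : ℝ → ℂ} (hf : Integrable f volume) {α : ℝ} (hα : 0 < α) :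
    ENNReal.ofReal α * volume {x | α < ‖∫ y, K (x - y) * f y‖} ≤
      (7 + 4 * (ENNReal.ofReal (88 / a) * (2 + 5 * shellSum κ))) *
        (ENNReal.ofReal B * ∫⁻ y, ‖f y‖ₑ) := by
  have hB0 : 0 < B := by linarith
  set E := largeAverageSet f α with hE
  set N := ∫⁻ y, ‖f y‖ₑ with hN
  set A₁ := ENNReal.ofReal (88 / a) * (2 + 5 * shellSum κ) with hA₁
  set d := spreadLength g a E with hd
  set G : Set ℝ := {y | Metric.infDist y Eᶜ ≤ 2} with hG
  set μ := (volume : Measure ℝ).prod (volume.restrict (Icc (0 : ℝ) 1)) with hμ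
  have hEo : IsOpen E := isOpen_largeAverageSet f α
  have hEm := mul_volume_largeAverageSet_le hf hα
  rw [← hE, ← hN] at hEm
  have hNfin : N ≠ ⊤ := hf.2.ne
  have hαE : ENNReal.ofReal α ≠ 0 := by simpa using hα
  -- `E` has finite measure. Without a point outside it, `Metric.infDist` would take the default
  -- value `0`.
  have hne : Eᶜ.Nonempty := by
    rw [nonempty_compl]
    intro h0
    rw [h0, Real.volume_univ, ENNReal.mul_top hαE, top_le_iff] at hEm
    exact ENNReal.mul_ne_top (by simp) hNfin hEm
  have hGm : MeasurableSet G :=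
    measurableSet_le (Metric.continuous_infDist_pt _).measurable measurable_const
  have hdm : Measurable d := h.measurable_spreadLength E
  obtain ⟨b, hb⟩ := hK.bounded
  have hH : Integrable (fun ω : ℝ × ℝ => G.indicator f ω.1) μ := (hf.indicator hGm).comp_fst _
  have hHN : ∫⁻ ω : ℝ × ℝ, ‖G.indicator f ω.1‖ₑ ∂μ ≤ N := by
    refine (lintegral_prod_le _).trans ?_
    simp only [lintegral_const, Measure.restrict_apply_univ, Real.volume_Icc, sub_zero,
      ENNReal.ofReal_one, mul_one]
    exact lintegral_mono fun y => enorm_indicator_le_enorm_self _ _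
  have hZ : Measurable fun ω : ℝ × ℝ => ω.1 + ω.2 * d ω.1 :=
    measurable_fst.add (measurable_snd.mul (hdm.comp measurable_fst))
  set S : ℝ → ℂ := fun x => ∫ ω, G.indicator f ω.1 * K (x - (ω.1 + ω.2 * d ω.1)) ∂μ with hS
  set T : ℝ → ℂ := fun x => ∫ y, K (x - y) * f y with hT
  have hSm : AEStronglyMeasurable S volume := by
    apply AEStronglyMeasurable.integral_prod_right' (f := fun q : ℝ × (ℝ × ℝ) =>
      G.indicator f q.2.1 * K (q.1 - (q.2.1 + q.2.2 * d q.2.1)))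
    exact (hH.1.comp_snd (μ := volume)).mul
      (hK.measurable.comp (measurable_fst.sub (hZ.comp measurable_snd))).aestronglyMeasurable
  have hTm : AEStronglyMeasurable T volume := by
    apply AEStronglyMeasurable.integral_prod_right' (f := fun q : ℝ × ℝ => K (q.1 - q.2) * f q.2)
    exact (hK.measurable.comp (measurable_fst.sub measurable_snd)).aestronglyMeasurable.mul
      (hf.1.comp_snd (μ := volume))
  have hdiff : ∫⁻ x in Eᶜ, ‖T x - S x‖ₑ ≤ ENNReal.ofReal B * N :=
    lintegral_enorm_sub_superposition_le h hK hf hEo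
  have hM : ∀ x, ∫⁻ ω : ℝ × ℝ, ‖G.indicator f ω.1‖ₑ *
      ‖kernelCorr K (x - (ω.1 + ω.2 * d ω.1))‖ₑ ∂μ ≤
      A₁ * (ENNReal.ofReal B * ENNReal.ofReal α) := by
    intro x
    refine (lintegral_prod_le _).trans (le_trans (le_of_eq ?_)
      (lintegral_mul_kernelCorr_le h hK hB0 hf hα hne x))
    rw [← lintegral_indicator hGm]
    refine lintegral_congr fun y => ?_
    change ∫⁻ t in Icc (0 : ℝ) 1, ‖G.indicator f y‖ₑ * ‖kernelCorr K (x - (y + t * d y))‖ₑ = _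
    rw [lintegral_const_mul' _ _ enorm_ne_top]
    by_cases hy : y ∈ G <;> simp [hy, hd, hE]
  have hL2 : ∫⁻ x, ‖S x‖ₑ ^ 2 ≤ A₁ * (ENNReal.ofReal B * ENNReal.ofReal α) * N :=
    (lintegral_enorm_sq_superposition_le hH hZ hK.measurable hb hK.support hM).trans (by gcongr)
  set c := ENNReal.ofReal (α / 2) with hc
  have hc0 : c ≠ 0 := by simpa [hc] using hα
  have hct : c ≠ ⊤ := ENNReal.ofReal_ne_top
  have hαc : ENNReal.ofReal α = 2 * c := by
    rw [hc, show α = 2 * (α / 2) by ring, ENNReal.ofReal_mul (by norm_num)]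
    norm_num
  have hsub : {x | α < ‖T x‖} ⊆ E ∪ ({x | c ≤ ‖T x - S x‖ₑ} ∩ Eᶜ) ∪ {x | c ^ 2 ≤ ‖S x‖ₑ ^ 2} := by
    intro x hx
    have hx : α < ‖T x‖ := hx
    by_cases h1 : x ∈ E
    · exact Or.inl (Or.inl h1)
    by_cases h2 : α / 2 ≤ ‖T x - S x‖
    · refine Or.inl (Or.inr ⟨?_, h1⟩)
      change c ≤ ‖T x - S x‖ₑ
      rw [← ofReal_norm]
      exact ENNReal.ofReal_le_ofReal h2
    · refine Or.inr ?_
      change c ^ 2 ≤ ‖S x‖ₑ ^ 2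
      gcongr
      rw [← ofReal_norm]
      apply ENNReal.ofReal_le_ofReal
      have := norm_le_norm_add_norm_sub' (T x) (S x)
      linarith
  have hV2 : c * volume ({x | c ≤ ‖T x - S x‖ₑ} ∩ Eᶜ) ≤ ENNReal.ofReal B * N :=
    calc _ ≤ c * volume.restrict Eᶜ {x | c ≤ ‖T x - S x‖ₑ} := 
          mul_le_mul' le_rfl (Measure.le_restrict_apply _ _)
      _ ≤ ∫⁻ x in Eᶜ, ‖T x - S x‖ₑ :=
          mul_meas_ge_le_lintegral₀ (hTm.sub hSm).enorm.restrict _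
      _ ≤ _ := hdiff
  -- Chebyshev in `L²` has `α ^ 2` on the left, and one factor `α` is returned by the `TT*` bound.
  -- Since `B` occurs there to the first power, the final constant stays linear in `B`.
  have hV3 : c * volume {x | c ^ 2 ≤ ‖S x‖ₑ ^ 2} ≤ 2 * A₁ * (ENNReal.ofReal B * N) := by
    rw [← ENNReal.mul_le_mul_iff_right hc0 hct]
    calc _ = c ^ 2 * volume {x | c ^ 2 ≤ ‖S x‖ₑ ^ 2} := by ring
      _ ≤ ∫⁻ x, ‖S x‖ₑ ^ 2 := mul_meas_ge_le_lintegral₀ (hSm.enorm.pow_const 2) _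
      _ ≤ A₁ * (ENNReal.ofReal B * (2 * c)) * N := by rw [← hαc]; exact hL2
      _ = _ := by ring
  have hB1 : 1 ≤ ENNReal.ofReal B := by rwa [ENNReal.one_le_ofReal]
  calc ENNReal.ofReal α * volume {x | α < ‖T x‖}
      ≤ ENNReal.ofReal α * (volume E + volume ({x | c ≤ ‖T x - S x‖ₑ} ∩ Eᶜ) +
          volume {x | c ^ 2 ≤ ‖S x‖ₑ ^ 2}) := by
        gcongr
        refine (measure_mono hsub).trans ((measure_union_le _ _).trans ?_)
        gcongr
        exact measure_union_le _ _
    _ = ENNReal.ofReal α * volume E + 2 * (c * volume ({x | c ≤ ‖T x - S x‖ₑ} ∩ Eᶜ)) +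
          2 * (c * volume {x | c ^ 2 ≤ ‖S x‖ₑ ^ 2}) := by rw [hαc]; ring
    _ ≤ 5 * N + 2 * (ENNReal.ofReal B * N) + 2 * (2 * A₁ * (ENNReal.ofReal B * N)) := by gcongr
    _ ≤ 5 * (ENNReal.ofReal B * N) + 2 * (ENNReal.ofReal B * N) +
          2 * (2 * A₁ * (ENNReal.ofReal B * N)) := by
        gcongr
        exact le_mul_of_one_le_left zero_le hB1
    _ = _ := by ring

end

/-! ### The oscillatory kernels are adapted; conclusion -/

lemma measurable_oscKernel {γ ψ : ℝ → ℝ} (hA : PhaseAssumptions γ ψ) {ε : ℝ} (hε : 0 < ε) (β : ℝ) :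
    Measurable (oscKernel γ ψ ε β) := by
  have hs : Icc ε 1 ⊆ Ioc 0 1 := fun x hx => ⟨hε.trans_le hx.1, hx.2⟩
  rw [oscKernel_eq_indicator hA.psi_pos hε, ← piecewise_eq_indicator]
  refine ContinuousOn.measurable_piecewise ?_ continuousOn_const measurableSet_Icc
  exact (Complex.continuous_ofReal.comp_continuousOn
    (continuousOn_id.inv₀ fun x hx => (hs hx).1.ne')).mul
    (Complex.continuous_exp.comp_continuousOn (continuousOn_const.mul
      (Complex.continuous_ofReal.comp_continuousOn ((continuousOn_oscPhase hA β).mono hs))))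

lemma norm_oscKernel_le_inv {γ ψ : ℝ → ℝ} (hA : PhaseAssumptions γ ψ) {ε : ℝ} (hε : 0 < ε) (β x : ℝ) :
    ‖oscKernel γ ψ ε β x‖ ≤ 1 / ε := by
  rcases le_or_gt ε x with hx | hx
  · exact norm_oscKernel_le hA hε β x hε hx
  · rw [oscKernel_eq_indicator hA.psi_pos hε, indicator_of_notMem fun h => by linarith [h.1],
      norm_zero]
    positivity

/-- The oscillatory kernels are adapted to `γ'`, with a constant linear in `1 + |β|`. -/
lemma exists_adaptedKernel_oscKernel {γ ψ : ℝ → ℝ} {a κ C : ℝ} (hA : PhaseAssumptions γ ψ)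
    (h : PhaseProfile (derivIoc γ) (fun t => derivIoc ψ t / ψ t) a κ C) :
    ∃ B : ℝ, 1 ≤ B ∧ ∀ ε > 0, ∀ β : ℝ,
      AdaptedKernel (derivIoc γ) a κ (B * (1 + |β|)) (oscKernel γ ψ ε β) := by
  obtain ⟨B₀, hB₀⟩ := exists_norm_kernelCorr_oscKernel_le hA h
  have hC := h.one_le_C
  set B := max B₀ (max (22 * C ^ 4) (1 + C))
  have h1 : B₀ ≤ B := le_max_left _ _
  have h2 : 22 * C ^ 4 ≤ B := (le_max_left _ _).trans (le_max_right _ _)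
  have h3 : 1 + C ≤ B := (le_max_right _ _).trans (le_max_right _ _)
  refine ⟨B, by linarith, fun ε hε β => ⟨measurable_oscKernel hA hε β,
    ⟨_, norm_oscKernel_le_inv hA hε β⟩, ?_, ?_, ?_, ?_⟩⟩
  · intro x hx
    rw [oscKernel_eq_indicator hA.psi_pos hε, indicator_of_notMem fun h => hx
      ⟨hε.le.trans h.1, h.2⟩]
  · intro x hx
    refine (hB₀ ε hε β x hx).trans ?_
    have := Real.rpow_nonneg hx.le (-κ)
    gcongr
  · intro ρ hρ x hx hxρ
    refine (norm_kernelCorr_oscKernel_le_rpow hA h hε β hx hρ.2 hxρ).trans ?_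
    have hρ0 := hρ.1
    have hg := h.pos ρ ⟨hρ0, by linarith [hρ.2, h.a_le_half]⟩
    have := Real.rpow_nonneg (mul_pos hx hg).le (-κ)
    gcongr
  · intro ρ hρ t ht htρ
    refine (lintegral_oscKernel_sub_le hA h hε β hρ ht htρ).trans ?_
    apply ENNReal.ofReal_le_ofReal
    gcongr

theorem mainTheorem1 (γ ψ : ℝ → ℝ) (h : PhaseAssumptions γ ψ) :
    ∃ A : ℝ, 0 < A ∧ ∀ ε : ℝ, 0 < ε → ∀ β : ℝ, ∀ f : ℝ → ℂ, Integrable f volume →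
      ConvolutionExists (oscKernel γ ψ ε β) f (ContinuousLinearMap.mul ℝ ℂ) volume ∧
      ∀ α : ℝ, 0 < α →
        volume {x : ℝ | α < ‖oscOperator γ ψ ε β f x‖} ≤
          ENNReal.ofReal (A * (1 + |β|) / α * ∫ x, ‖f x‖) := by
  obtain ⟨a, κ, C, hP⟩ := h.exists_profile
  obtain ⟨B, hB, hK⟩ := exists_adaptedKernel_oscKernel h hP
  have hshell : shellSum κ ≠ ⊤ := tsum_shell_ne_top hP.κ_lt_one
  set Q : ENNReal := 7 + 4 * (ENNReal.ofReal (88 / a) * (2 + 5 * shellSum κ)) with hQ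
  have hQt : Q ≠ ⊤ := by
    rw [hQ]
    finiteness
  have hQ0 : Q ≠ 0 := by simp [hQ]
  have hQr : 0 < Q.toReal := ENNReal.toReal_pos hQ0 hQt
  refine ⟨Q.toReal * B, by positivity, fun ε hε β f hf => ⟨fun x => ?_, fun α hα => ?_⟩⟩
  · have h1 : Integrable (fun t => f (x - t)) volume := hf.comp_sub_left x
    exact h1.bdd_mul (measurable_oscKernel h hε β).aestronglyMeasurable
      (Filter.Eventually.of_forall (norm_oscKernel_le_inv h hε β))
  · have hβ := abs_nonneg β
    have hw := (hK ε hε β).weak_type hP (by nlinarith) hf hα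
    have hop : ∀ x, oscOperator γ ψ ε β f x = ∫ y, oscKernel γ ψ ε β (x - y) * f y := fun x => by
      rw [oscOperator, convolution_eq_swap]; rfl
    simp_rw [hop]
    have hN : ∫⁻ y, ‖f y‖ₑ = ENNReal.ofReal (∫ y, ‖f y‖) := by
      rw [ofReal_integral_eq_lintegral_ofReal hf.norm
        (Filter.Eventually.of_forall fun _ => norm_nonneg _)]
      simp_rw [ofReal_norm]
    rw [hN, ← hQ, ← ENNReal.ofReal_toReal hQt, ← ENNReal.ofReal_mul (by positivity),
      ← ENNReal.ofReal_mul hQr.le] at hw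
    rw [show Q.toReal * B * (1 + |β|) / α * ∫ x, ‖f x‖ =
      Q.toReal * (B * (1 + |β|) * ∫ y, ‖f y‖) / α by ring, ENNReal.ofReal_div_of_pos hα,
      ENNReal.le_div_iff_mul_le (by simp [hα]) (by simp), mul_comm]
    exact hw
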